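/- Let $n\ge 4$ and $s\ge 0$. **Tableaux.** Let the letters $1<2<\dots<n-1<n,\bar n<\overline{n-1}<\dots<\bar 1$ be ordered as shown, with $n$ and $\bar n$ incomparable, and put $\bar{\bar a}=a$. Let $\mathcal T(s)$ be the set of $2\times s$ fillings by letters such that the rows weakly increase, $b\not\le a$ for every column $\binom{a}{b}$ (top $a$, bottom $b$), and no column $\binom{n-1}{n}$ (resp. $\binom{n-1}{\bar n}$) has a column $\binom{n}{\overline{n-1}}$ (resp. $\binom{\bar n}{\overline{n-1}}$) anywhere to its right. Let $B(k\varpi_2)\subset\mathcal T(k)$ be the subset of Kashiwara–Nakashima tableaux: those with no column $\binom{1}{\bar 1}$ and, for every letter $a$, no column $\binom{a}{\bar a}$ whose left neighbour has top entry $a$ or whose right neighbour has bottom entry $\bar a$. The classical operators $\tilde e_i,\tilde f_i$ $(1\le i\le n)$ of type $D_n$ act on $B(k\varpi_2)$ through the column word $b_1a_1b_2a_2\cdots b_ka_k\in B(\varpi_1)^{\otimes 2k}$, with the tensor product rule $\tilde f_i(b_2\otimes b_1)=\tilde f_i(b_2)\otimes b_1$ if $\varepsilon_i(b_2)\ge\varphi_i(b_1)$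 and $b_2\otimes\tilde f_i(b_1)$ otherwise, and $\tilde e_i(b_2\otimes b_1)=\tilde e_i(b_2)\otimes b_1$ if $\varepsilon_i(b_2)>\varphi_i(b_1)$ and $b_2\otimes\tilde e_i(b_1)$ otherwise. **Drop and fill.** The drop map $D_{2,s}:\mathcal T(s)\to\bigsqcup_{k=0}^sB(k\varpi_2)$ is the identity on $B(s\varpi_2)$, sends $\binom{1}{\bar 1}\cdots\binom{1}{\bar 1}$ to the empty tableau, and otherwise acts as follows on the unique maximal block of $N\ge 1$ consecutive columns $\binom{a}{\bar a}$ that, for its $a\in\{1,\dots,n,\bar n\}$, has a left neighbour with top entry $a$, or a right neighbour with bottom entry $\bar a$, or has $N\ge 2$: it removes all $N$ columns if such a left or right neighbour exists, and $N-1$ of them if neither does. The fill map $F_{2,s}$ is the inverse of $D_{2,s}$. Put $\Upsilon_{s'}^{s}=F_{2,s}\circ D_{2,s'}:\mathcal T(s')\to\mathcal T(s)$ for $s'<s$. The $\tilde e_i,\tilde f_i$ $(1\le i\le n)$ act on $\mathcal T(s)$ by $F_{2,s}\circ\tilde e_i\circ D_{2,s}$ and $F_{2,s}\circ\tilde f_i\circ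 D_{2,s}$, and $B(k\varpi_2)$, $k\le s$, is identified with its image under $F_{2,s}$ in $\mathcal T(s)$. **Branching components.** Let $\mathcal{BC}(k\varpi_2)$ be the graph whose vertices are the connected components of $B(k\varpi_2)$ with respect to the colours $2,\dots,n$ (these are $U_q(D_{n-1})$-crystals), labelled by their $D_{n-1}$-highest weights, with an edge between two components joined by an arrow of colour $1$. Let $r_k(v)$ be the graph distance of $v$ from the vertex containing the highest weight tableau of $B(k\varpi_2)$, and let $r_k(T)$ be $r_k$ of the vertex containing $T$. Say that $T\in B(k\varpi_2)$ and $T'\in B(j\varpi_2)$ *correspond* if their components have the same label and there are $i_1,\dots,i_p\in\{2,\dots,n\}$ with $T=\tilde f_{i_1}\cdots\tilde f_{i_p}u$ and $T'=\tilde f_{i_1}\cdots\tilde f_{i_p}u'$, where $u,u'$ are the $D_{n-1}$-highest weight vectors of these components. For $0\le k,j\le s$ let $\iota_k^j:B(k\varpi_2)\to B(j\varpi_2)\cup\{0\}$ send $T$ to the $T'$ that corresponds to $T$ and has $r_j(T')-j=r_k(T)-k$, if there is one, and to $0$ otherwise. (For $k\le j$ this is an embedding; for $j<k$ it is the inverse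 of $\iota_j^k$, extended by $0$.) **The affine crystal.** For $T\in B(k\varpi_2)\subset\mathcal T(s)$ put $R(T)=r_k(T)+s-k$, and let $\ell$ be minimal with $\iota_k^s(T)\in\iota_\ell^s(B(\ell\varpi_2))$. Let $\sigma(T)$ be the element of $B((s+\ell-k)\varpi_2)$ that corresponds to $T$ and has $R(\sigma(T))=2s-R(T)$. The crystal $\tilde B^{2,s}$ of type $D_n^{(1)}$ is $\mathcal T(s)$ with the operators above and $\tilde e_0=\sigma\tilde e_1\sigma$, $\tilde f_0=\sigma\tilde f_1\sigma$. For $0\le i\le n$ put $\varepsilon_i(T)=\max\{p\ge 0:\tilde e_i^p(T)\ne\varnothing\}$ and $\varphi_i(T)=\max\{p\ge 0:\tilde f_i^p(T)\ne\varnothing\}$; the level of $T$ is $$\langle c,\varepsilon(T)\rangle=\varepsilon_0(T)+\varepsilon_1(T)+2\sum_{i=2}^{n-2}\varepsilon_i(T)+\varepsilon_{n-1}(T)+\varepsilon_n(T).$$ **Proposition.** All $\varepsilon_i(T),\varphi_i(T)$ with $T\in\tilde B^{2,s}$, $0\le i\le n$, are finite, and the following hold. 1. Let $0\le k\le s$ and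 $T\in B(k\varpi_2)\subset\tilde B^{2,s}$, and let $\ell\in\{0,\dots,s\}$ be minimal such that $\iota_k^\ell(T)\ne 0$. Then $T_m=\iota_k^m(T)\ne 0$ for $\ell\le m\le s$, and for all $\ell\le m<s$, computing in $\tilde B^{2,s}$, $$\varepsilon_1(T_{m+1})=\varepsilon_1(T_m)+1,\quad \varepsilon_0(T_{m+1})=\varepsilon_0(T_m)-1,\quad \varphi_1(T_{m+1})=\varphi_1(T_m)+1,\quad \varphi_0(T_{m+1})=\varphi_0(T_m)-1.$$ 2. For all $k,j\in\{0,\dots,s\}$ and all $T\in B(k\varpi_2)\subset\tilde B^{2,s}$ with $\iota_k^j(T)\ne 0$, the tableaux $T$ and $\iota_k^j(T)$ have the same level in $\tilde B^{2,s}$. 3. The map $\Upsilon_s^{s+1}:\mathcal T(s)\to\mathcal T(s+1)$ raises the level by exactly one: for every $T\in\tilde B^{2,s}$ the level of $\Upsilon_s^{s+1}(T)$ in $\tilde B^{2,s+1}$ is the level of $T$ in $\tilde B^{2,s}$ plus $1$. -/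

import Mathlib

/-! The crystal `B̃^{2,s}` of type `D_n^{(1)}`.

The letters `1 < 2 < ⋯ < n-1 < n, n̄ < \overline{n-1} < ⋯ < 1̄` (with `n` and `n̄` incomparable)
are the nonzero integers of absolute value at most `n`; barring is negation, so `ī` is `-i`. -/

namespace KR

/-! ### Letters, words and two-row tableaux -/

/-- The strict order on the letters of type `D_n`. -/
def Lt (n : ℕ) (x y : ℤ) : Prop :=
  (0 < x ∧ 0 < y ∧ x < y) ∨ (x < 0 ∧ y < 0 ∧ x < y) ∨
    (0 < x ∧ y < 0 ∧ ¬ (x = n ∧ y = -(n : ℤ)))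

/-- The partial order on the letters of type `D_n`. -/
def Le (n : ℕ) (x y : ℤ) : Prop := x = y ∨ Lt n x y

/-- The arrow `i` (`1 ≤ i ≤ n`) out of the letter `x` in the crystal graph of `B(ϖ₁)`. -/
def letterF (n i : ℕ) (x : ℤ) : Option ℤ :=
  if i < n then
    if x = i then some (i + 1) else if x = -((i : ℤ) + 1) then some (-(i : ℤ)) else none
  else if i = n then
    if x = (n : ℤ) - 1 then some (-(n : ℤ)) else if x = n then some (-((n : ℤ) - 1)) else none
  else none

/-- The arrow `i` (`1 ≤ i ≤ n`) into the letter `x`, read backwards. -/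
def letterE (n i : ℕ) (x : ℤ) : Option ℤ :=
  if i < n then
    if x = (i : ℤ) + 1 then some i else if x = -(i : ℤ) then some (-((i : ℤ) + 1)) else none
  else if i = n then
    if x = -(n : ℤ) then some ((n : ℤ) - 1) else if x = -((n : ℤ) - 1) then some n else none
  else none

/-- `φ_i` of a letter: all strings in `B(ϖ₁)` have length at most one. -/
def letterPhi (n i : ℕ) (x : ℤ) : ℕ := if (letterF n i x).isSome then 1 else 0

/-- `ε_i` of a letter. -/
def letterEps (n i : ℕ) (x : ℤ) : ℕ := if (letterE n i x).isSome then 1 else 0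

/-- The pair `(φ_i, ε_i)` of a word `x₁ ⊗ x₂ ⊗ ⋯` in a tensor power of `B(ϖ₁)`, by
`φ(b₂ ⊗ b₁) = φ(b₂) + max(0, φ(b₁) - ε(b₂))` and
`ε(b₂ ⊗ b₁) = ε(b₁) + max(0, ε(b₂) - φ(b₁))` (natural subtraction is the truncated one). -/
def wordPhiEps (n i : ℕ) : List ℤ → ℕ × ℕ
  | [] => (0, 0)
  | x :: w =>
    (letterPhi n i x + ((wordPhiEps n i w).1 - letterEps n i x),
     (wordPhiEps n i w).2 + (letterEps n i x - (wordPhiEps n i w).1))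

/-- `f̃_i` on words, by the tensor product rule: `f̃_i(b₂ ⊗ b₁)` is `f̃_i(b₂) ⊗ b₁` if
`ε_i(b₂) ≥ φ_i(b₁)`, and `b₂ ⊗ f̃_i(b₁)` otherwise. -/
def wordF (n i : ℕ) : List ℤ → Option (List ℤ)
  | [] => none
  | x :: w =>
    if (wordPhiEps n i w).1 ≤ letterEps n i x then (letterF n i x).map (fun y => y :: w)
    else (wordF n i w).map (fun v => x :: v)

/-- `ẽ_i` on words: `ẽ_i(b₂ ⊗ b₁)` is `ẽ_i(b₂) ⊗ b₁` if `ε_i(b₂) > φ_i(b₁)`, and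
`b₂ ⊗ ẽ_i(b₁)` otherwise. -/
def wordE (n i : ℕ) : List ℤ → Option (List ℤ)
  | [] => none
  | x :: w =>
    if (wordPhiEps n i w).1 < letterEps n i x then (letterE n i x).map (fun y => y :: w)
    else (wordE n i w).map (fun v => x :: v)

/-- A two-row rectangular filling, as the list of its columns from left to right; the column
`(a, b)` has `a` in the top row and `b` in the bottom row. -/
abbrev Tab := List (ℤ × ℤ)

/-- The column word `b₁ a₁ b₂ a₂ ⋯`. -/
def word : Tab → List ℤ
  | [] => []
  | c :: t => c.2 :: c.1 :: word t

/-- The filling with a given column word. -/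
def unword : List ℤ → Tab
  | b :: a :: w => (a, b) :: unword w
  | _ => []

/-- The classical Kashiwara operator `f̃_i` (`1 ≤ i ≤ n`) on fillings; `none` is `∅`. -/
def tabF (n i : ℕ) (t : Tab) : Option Tab := (wordF n i (word t)).map unword

/-- The classical Kashiwara operator `ẽ_i` (`1 ≤ i ≤ n`) on fillings. -/
def tabE (n i : ℕ) (t : Tab) : Option Tab := (wordE n i (word t)).map unword

/-- Membership in `𝒯(s)`: fillings of shape `(s,s)` by letters, with weakly increasing rows,
columns `a` over `b` such that `b ≰ a`, and no configuration of a column `n-1` over `n` and,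
anywhere to its right, a column `n` over `\overline{n-1}`, nor the same with `n̄` for `n`. -/
def IsT (n s : ℕ) (t : Tab) : Prop :=
  t.length = s ∧
  (∀ c ∈ t, (1 ≤ |c.1| ∧ |c.1| ≤ n) ∧ (1 ≤ |c.2| ∧ |c.2| ≤ n)) ∧
  t.IsChain (fun c d => Le n c.1 d.1 ∧ Le n c.2 d.2) ∧
  (∀ c ∈ t, ¬ Le n c.2 c.1) ∧
  t.Pairwise (fun c d =>
    ¬ (c = ((n : ℤ) - 1, (n : ℤ)) ∧ d = ((n : ℤ), -((n : ℤ) - 1))) ∧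
    ¬ (c = ((n : ℤ) - 1, -(n : ℤ)) ∧ d = (-(n : ℤ), -((n : ℤ) - 1))))

/-- Membership in `B(kϖ₂)`: the Kashiwara–Nakashima tableaux of shape `(k,k)`. In addition to the
conditions of `𝒯(k)`, a column `a` over `ā` has neither an `a` to the left of its top entry nor an
`ā` to the right of its bottom entry, and the column `1` over `1̄` does not occur. -/
def IsKN (n k : ℕ) (t : Tab) : Prop :=
  IsT n k t ∧
  t.IsChain (fun c d => ¬ (c.1 = d.1 ∧ d.2 = -d.1) ∧ ¬ (c.2 = -c.1 ∧ d.2 = c.2)) ∧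
  ((1 : ℤ), (-1 : ℤ)) ∉ t

/-! ### The branching component graph of `B(kϖ₂)` -/

/-- The vertex set of the crystal `B(kϖ₂)`. -/
abbrev KN (n k : ℕ) := {t : Tab // IsKN n k t}

/-- The crystal graph of `B(kϖ₂)` restricted to the colours `2, …, n` (undirected). -/
def innerGraph (n k : ℕ) : SimpleGraph (KN n k) :=
  SimpleGraph.fromRel (fun t t' => ∃ i, 2 ≤ i ∧ i ≤ n ∧ tabF n i t.1 = some t'.1)

/-- The branching component graph `ℬ𝒞(kϖ₂)` (undirected): its vertices are the connected components
with respect to the colours `2, …, n`, and its edges come from the arrows of colour `1`. -/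
def BC (n k : ℕ) : SimpleGraph (innerGraph n k).ConnectedComponent :=
  SimpleGraph.fromRel (fun v w => ∃ t t' : KN n k,
    (innerGraph n k).connectedComponentMk t = v ∧ (innerGraph n k).connectedComponentMk t' = w ∧
      tabF n 1 t.1 = some t'.1)

/-- The highest weight tableau `u_k` of `B(kϖ₂)`. -/
def hw (k : ℕ) : Tab := List.replicate k (1, 2)

open Classical in
/-- The rank in `ℬ𝒞(kϖ₂)` of the vertex that contains `t`: its graph distance from the vertex that
contains `u_k`. -/
noncomputable def rank (n k : ℕ) (t : Tab) : ℕ :=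
  if h : IsKN n k (hw k) ∧ IsKN n k t then
    (BC n k).dist ((innerGraph n k).connectedComponentMk ⟨hw k, h.1⟩)
      ((innerGraph n k).connectedComponentMk ⟨t, h.2⟩)
  else 0

/-- The `i`-th coordinate of the weight of a tableau. -/
def wt (i : ℕ) (t : Tab) : ℤ :=
  ((word t).count (i : ℤ) : ℤ) - ((word t).count (-(i : ℤ)) : ℤ)

/-- `u` is a highest weight vector for the colours `2, …, n`, that is, for `U_q(D_{n-1})`. -/
def IsInnerHW (n : ℕ) (u : Tab) : Prop := ∀ i, 2 ≤ i → i ≤ n → tabE n i u = none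

/-- `f̃_{i₁} ⋯ f̃_{i_p} u` for a list `[i₁, …, i_p]` of colours. -/
def applyF (n : ℕ) : List ℕ → Tab → Option Tab
  | [], u => some u
  | i :: w, u => (applyF n w u).bind (tabF n i)

/-- `t ∈ B(kϖ₂)` and `t' ∈ B(jϖ₂)` lie in components with the same `D_{n-1}`-highest weight (vertices
of the branching component graphs labelled by the same partition), at the same position:
`t = f̃_{i₁} ⋯ f̃_{i_p} u` and `t' = f̃_{i₁} ⋯ f̃_{i_p} u'`, where `u` and `u'` are the highest weight
vectors of these components and the colours `i₁, …, i_p` are in `{2, …, n}`. -/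
def SamePosition (n k j : ℕ) (t t' : Tab) : Prop :=
  ∃ u u' : Tab, IsKN n k u ∧ IsKN n j u' ∧ IsInnerHW n u ∧ IsInnerHW n u' ∧
    (∀ i, 2 ≤ i → i ≤ n → wt i u = wt i u') ∧
    ∃ w : List ℕ, (∀ i ∈ w, 2 ≤ i ∧ i ≤ n) ∧ applyF n w u = some t ∧ applyF n w u' = some t'

/-! ### The maps `ι_k^j` and `σ` on classical components -/

/-- `t' ∈ B(jϖ₂)` corresponds to `t ∈ B(kϖ₂)` under the inclusions
`ℬ𝒞(0) ⊂ ℬ𝒞(ϖ₂) ⊂ ℬ𝒞(2ϖ₂) ⊂ ⋯`, which preserve the labels and raise the rank by one in each step. -/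
def IsIota (n k j : ℕ) (t t' : Tab) : Prop :=
  IsKN n k t ∧ IsKN n j t' ∧ SamePosition n k j t t' ∧ rank n j t' + k = rank n k t + j

open Classical in
/-- `ι_k^j : B(kϖ₂) → B(jϖ₂) ∪ {0}`, with `none` for `0`: for `k ≤ j` the embedding of crystals for
the colours `2, …, n` that agrees with `ℬ𝒞(kϖ₂) ⊂ ℬ𝒞(jϖ₂)`; for `j < k` the inverse of `ι_j^k`
where this is defined, and `0` elsewhere. -/
noncomputable def iota (n k j : ℕ) (t : Tab) : Option Tab :=
  if h : ∃ t', IsIota n k j t t' then some h.choose else none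

/-- The minimal `ℓ` with `ι_k^s(t) ∈ ι_ℓ^s(B(ℓϖ₂))`. -/
noncomputable def depth (n s k : ℕ) (t : Tab) : ℕ :=
  sInf {l | l ≤ s ∧ ∃ t' r, IsKN n l t' ∧ iota n k s t = some r ∧ iota n l s t' = some r}

/-- The rank function `R` on the union of the `ℬ𝒞(kϖ₂)`, `k = 0, …, s`. -/
noncomputable def bigRank (n s k : ℕ) (t : Tab) : ℕ := rank n k t + (s - k)

/-- `t'` is the image under `σ` of `t ∈ B(kϖ₂)`: it is at the same position as `t` in the vertex with
the same label, of rank `2s - R`, in the component `ℬ𝒞((s+ℓ-k)ϖ₂)`. -/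
def IsSigma (n s k : ℕ) (t t' : Tab) : Prop :=
  IsKN n k t ∧ IsKN n (s + depth n s k t - k) t' ∧
    SamePosition n k (s + depth n s k t - k) t t' ∧
    bigRank n s k t + bigRank n s (s + depth n s k t - k) t' = 2 * s

/-! ### `𝒯(s)` as a classical crystal -/

/-- `t` is obtained from `T` by removing the `m ≥ 1` columns `a` over `ā` of an `a`-configuration
(`a ∈ {1, …, n, n̄}`) of `T`. The three cases are the three kinds of `a`-configurations, where
the neighbouring columns are subject to the conditions only if they are present. -/
def RemovesConfig (n : ℕ) (T t : Tab) : Prop :=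
  ∃ (a : ℤ) (m : ℕ) (A C : Tab), ((1 ≤ a ∧ a ≤ n) ∨ a = -(n : ℤ)) ∧ 1 ≤ m ∧
    ((T = A ++ List.replicate m (a, -a) ++ C ∧ t = A ++ C ∧
        (∃ b, A.getLast? = some (a, b) ∧ b ≠ -a) ∧ C.head? ≠ some (a, -a)) ∨
     (T = A ++ List.replicate m (a, -a) ++ C ∧ t = A ++ C ∧
        (∃ d, C.head? = some (d, -a) ∧ d ≠ a) ∧ A.getLast? ≠ some (a, -a)) ∨
     (T = A ++ List.replicate (m + 1) (a, -a) ++ C ∧ t = A ++ [(a, -a)] ++ C ∧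
        (∀ c, A.getLast? = some c → c.1 ≠ a) ∧ (∀ c, C.head? = some c → c.2 ≠ -a)))

open Classical in
/-- The height-two drop map `D_{2,s} : 𝒯(s) → B(0) ⊕ B(ϖ₂) ⊕ ⋯ ⊕ B(sϖ₂)`. -/
noncomputable def drop (n s : ℕ) (T : Tab) : Tab :=
  if T = List.replicate s (1, -1) then []
  else if IsKN n s T then T
  else if h : ∃ t, RemovesConfig n T t then h.choose
  else T

open Classical in
/-- The height-two fill map `F_{2,s}`, the inverse of `D_{2,s}`. -/
noncomputable def fill (n s : ℕ) (t : Tab) : Tab :=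
  if h : ∃ T, IsT n s T ∧ drop n s T = t then h.choose else []

/-- `Υ_{s'}^s = F_{2,s} ∘ D_{2,s'} : 𝒯(s') → 𝒯(s)`. -/
noncomputable def upsilon (n s' s : ℕ) (T : Tab) : Tab := fill n s (drop n s' T)

/-! ### The affine crystal `B̃^{2,s}` -/

open Classical in
/-- The involution `σ` of `𝒯(s)`; the classical component of `T` is the number of columns of its
image under the drop map. -/
noncomputable def sigma (n s : ℕ) (T : Tab) : Option Tab :=
  if h : ∃ t', IsSigma n s (drop n s T).length (drop n s T) t' then some (fill n s h.choose)
  else none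

/-- `ẽ_i` on `𝒯(s)` for `i = 1, …, n`. -/
noncomputable def clE (n s i : ℕ) (T : Tab) : Option Tab :=
  (tabE n i (drop n s T)).map (fill n s)

/-- `f̃_i` on `𝒯(s)` for `i = 1, …, n`. -/
noncomputable def clF (n s i : ℕ) (T : Tab) : Option Tab :=
  (tabF n i (drop n s T)).map (fill n s)

/-- `ẽ_i` on `B̃^{2,s}` for `i = 0, …, n`, where `ẽ_0 = σ ẽ_1 σ`. -/
noncomputable def affE (n s i : ℕ) (T : Tab) : Option Tab :=
  if i = 0 then ((sigma n s T).bind (clE n s 1)).bind (sigma n s) else clE n s i T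

/-- `f̃_i` on `B̃^{2,s}` for `i = 0, …, n`, where `f̃_0 = σ f̃_1 σ`. -/
noncomputable def affF (n s i : ℕ) (T : Tab) : Option Tab :=
  if i = 0 then ((sigma n s T).bind (clF n s 1)).bind (sigma n s) else clF n s i T

/-- The lengths `p` such that the `p`-fold application of a partial map to `T` is defined. -/
def lengths (g : Tab → Option Tab) (T : Tab) : Set ℕ :=
  {p | (fun o : Option Tab => o.bind g)^[p] (some T) ≠ none}

/-- `ε_i(T) = max {p | ẽ_i^p(T) ≠ ∅}`. -/
noncomputable def eps (n s i : ℕ) (T : Tab) : ℕ := sSup (lengths (affE n s i) T)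

/-- `φ_i(T) = max {p | f̃_i^p(T) ≠ ∅}`. -/
noncomputable def phi (n s i : ℕ) (T : Tab) : ℕ := sSup (lengths (affF n s i) T)

/-- The level `⟨c, ε(T)⟩`, where `c = h_0 + h_1 + 2h_2 + ⋯ + 2h_{n-2} + h_{n-1} + h_n`. -/
noncomputable def level (n s : ℕ) (T : Tab) : ℕ :=
  eps n s 0 T + eps n s 1 T + 2 * (∑ i ∈ Finset.Icc 2 (n - 2), eps n s i T) +
    eps n s (n - 1) T + eps n s n T

end KR

/-!
The maps `ι` and `σ` are defined by the rank in `ℬ𝒞(kϖ₂)` and the position in a component for the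
colours `2, …, n`. Both can be described in terms of column words, and then the statement is one
about words.

*Rank.* An arrow of colour `1` lowers the weight for the letter `1` by one, the other arrows
preserve it, and every tableau is reached from `u_k` by arrows. So the rank of `t ∈ B(kϖ₂)` is
`k - wt₁(t)` (`rank_eq`).

*Position.* Two words are plactically equivalent for the colours `c, …, n` if they are related by a
relation that is compatible with all operators of these colours (`Plactic`). The highest weight
tableaux for the colours `2, …, n` can be listed (`exists_innerHW`). If the letters `1`, `1̄` are
ignored and pairs `2̄ 2` contracted, their words have a normal form that depends on the weight only
(`InnerHW.plactic_normalWord`). Hence two tableaux correspond if and only if their words are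
plactically equivalent for the colours `2, …, n` (`samePosition_iff`), and the list also shows that
a tableau is determined by its length, its position and `wt₁` (`KNTab.eq_of_plactic`), and that
there is a symmetry negating `wt₁` (`KNTab.exists_neg`).

So `ι_k^j` keeps the position and `wt₁` (`IotaRel`, `iota_eq_some_iff`), while `σ` keeps the
position, negates `wt₁`, and sends length `k` to length `s + ℓ - k` (`SigmaRel`, `isSigma_iff`).

*The step from `k` to `k + 1`.* The image of `t` under `ι_k^{k+1}` is found explicitly. In general one
slides the bottom row of `t` by one step to the left past the top row, corrects columns `a` over `ā`,
puts the column `1` over the leaving letter in front, and lets `1̄` enter at the end of the bottom row;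
in the two degenerate cases a column `2` over `2̄` is added (`KNTab.exists_isLift`). Each step of the
sliding is one of the plactic relations of type `D_n` for words of length three
(`KnuthRel.plactic`, `slideCol_knuthRel`), so the word is controlled for the colour `1` too, and
`ε₁`, `φ₁` grow by exactly one. Since the lengths of `t` and `σ(t)` have a fixed sum along an orbit
of the maps `ι`, the same step, read through `σ`, goes one component down, so that `ε₀`, `φ₀` fall by
one (`IotaRel.sigma_isLift`). The other `ε_i` do not change, which gives the invariance of the level.
For `Υ_s^{s+1}` the classical component is kept, while the image under `σ` moves one component up, so
that only `ε₀` changes, by one.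

*Drop and fill.* The columns `a` over `ā` of a tableau in `𝒯(s)` form a single block, so the drop map
is well defined with values in the `B(kϖ₂)` (`isKN_drop`), and it is onto: such a block can be
enlarged, or inserted between the columns `a` over `b` with `b < ā` and those with `b > ā`
(`exists_drop_eq`). Thus the fill map is a section of it (`fill_spec`), and the strings in the affine
crystal have the lengths read off from the words (`lengths_clE`, `lengths_affE_zero`).
-/

namespace KR

/-! ### Kashiwara operators on words -/

/-- The tensor product rule for two words instead of a letter and a word. -/
theorem wordPhiEps_append (n i : ℕ) (u v : List ℤ) :
    wordPhiEps n i (u ++ v) =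
      ((wordPhiEps n i u).1 + ((wordPhiEps n i v).1 - (wordPhiEps n i u).2),
       (wordPhiEps n i v).2 + ((wordPhiEps n i u).2 - (wordPhiEps n i v).1)) := by
  induction u with
  | nil => simp [wordPhiEps]
  | cons x u ih =>
    simp only [List.cons_append, wordPhiEps, ih, Prod.mk.injEq]
    constructor <;> omega

theorem letterF_eq_none_iff (n i : ℕ) (x : ℤ) : letterF n i x = none ↔ letterPhi n i x = 0 := by
  simp [letterPhi]

theorem letterE_eq_none_iff (n i : ℕ) (x : ℤ) : letterE n i x = none ↔ letterEps n i x = 0 := by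
  simp [letterEps]

theorem wordF_eq_none_iff (n i : ℕ) (w : List ℤ) :
    wordF n i w = none ↔ (wordPhiEps n i w).1 = 0 := by
  induction w with
  | nil => simp [wordF, wordPhiEps]
  | cons x w ih =>
    rw [wordF]
    split_ifs with h
    · simp only [Option.map_eq_none_iff, letterF_eq_none_iff, wordPhiEps]; omega
    · simp only [Option.map_eq_none_iff, ih, wordPhiEps]; omega

theorem wordE_eq_none_iff (n i : ℕ) (w : List ℤ) :
    wordE n i w = none ↔ (wordPhiEps n i w).2 = 0 := by
  induction w with
  | nil => simp [wordE, wordPhiEps]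
  | cons x w ih =>
    rw [wordE]
    split_ifs with h
    · simp only [Option.map_eq_none_iff, letterE_eq_none_iff, wordPhiEps]; omega
    · simp only [Option.map_eq_none_iff, ih, wordPhiEps]; omega

/-- The tensor product rule for two words: the tensor product of crystals is associative. -/
theorem wordF_append (n i : ℕ) (u v : List ℤ) :
    wordF n i (u ++ v) = if (wordPhiEps n i v).1 ≤ (wordPhiEps n i u).2
      then (wordF n i u).map (· ++ v) else (wordF n i v).map (u ++ ·) := by
  induction u with
  | nil =>
    simp only [List.nil_append, wordPhiEps, wordF, Option.map_none, Nat.le_zero]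
    split_ifs with h
    · exact (wordF_eq_none_iff n i v).2 h
    · simp
  | cons x u ih =>
    have h1 : (wordPhiEps n i (u ++ v)).1 = _ := congrArg Prod.fst (wordPhiEps_append n i u v)
    have h2 : (wordPhiEps n i (x :: u)).2 =
      (wordPhiEps n i u).2 + (letterEps n i x - (wordPhiEps n i u).1) := rfl
    rw [List.cons_append, wordF, wordF, ih]
    split_ifs <;> first | (exfalso; omega) | rfl | simp [Function.comp_def]

theorem wordE_append (n i : ℕ) (u v : List ℤ) :
    wordE n i (u ++ v) = if (wordPhiEps n i v).1 < (wordPhiEps n i u).2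
      then (wordE n i u).map (· ++ v) else (wordE n i v).map (u ++ ·) := by
  induction u with
  | nil =>
    simp only [List.nil_append, wordPhiEps, wordE, Option.map_none, Nat.not_lt_zero, if_false]
    simp
  | cons x u ih =>
    have h1 : (wordPhiEps n i (u ++ v)).1 = _ := congrArg Prod.fst (wordPhiEps_append n i u v)
    have h2 : (wordPhiEps n i (x :: u)).2 =
      (wordPhiEps n i u).2 + (letterEps n i x - (wordPhiEps n i u).1) := rfl
    rw [List.cons_append, wordE, wordE, ih]
    split_ifs <;> first | (exfalso; omega) | rfl | simp [Function.comp_def]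

theorem letterF_eq_some_iff {n i : ℕ} (hi : 1 ≤ i) (x y : ℤ) :
    letterF n i x = some y ↔ letterE n i y = some x := by
  unfold letterF letterE
  split_ifs <;> simp <;> omega

theorem letterPhi_eq (n i : ℕ) (x : ℤ) : letterPhi n i x =
    if (i < n ∧ (x = i ∨ x = -((i : ℤ) + 1))) ∨ (i = n ∧ (x = (n : ℤ) - 1 ∨ x = n))
    then 1 else 0 := by
  unfold letterPhi letterF
  congr 1
  apply propext
  split_ifs <;> simp <;> omega

theorem letterEps_eq (n i : ℕ) (x : ℤ) : letterEps n i x =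
    if (i < n ∧ (x = (i : ℤ) + 1 ∨ x = -(i : ℤ))) ∨ (i = n ∧ (x = -(n : ℤ) ∨ x = -((n : ℤ) - 1)))
    then 1 else 0 := by
  unfold letterEps letterE
  congr 1
  apply propext
  split_ifs <;> simp <;> omega

theorem letterF_eq_some (n i : ℕ) (x y : ℤ) : letterF n i x = some y ↔
    (i < n ∧ ((x = i ∧ y = i + 1) ∨ (x ≠ i ∧ x = -((i : ℤ) + 1) ∧ y = -i))) ∨
    (i = n ∧ ((x = (n : ℤ) - 1 ∧ y = -n) ∨ (x = n ∧ y = -((n : ℤ) - 1)))) := by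
  unfold letterF
  split_ifs <;> simp <;> omega

theorem letterEps_of_letterF {n i : ℕ} (hn : 2 ≤ n) (hi : 1 ≤ i) {x y : ℤ}
    (h : letterF n i x = some y) :
    letterPhi n i x = 1 ∧ letterEps n i x = 0 ∧ letterPhi n i y = 0 ∧ letterEps n i y = 1 := by
  rw [letterF_eq_some] at h
  simp only [letterPhi_eq, letterEps_eq]
  refine ⟨if_pos ?_, if_neg ?_, if_neg ?_, if_pos ?_⟩ <;> omega

/-- `f̃_i` lowers `φ_i` by one, raises `ε_i` by one, and is undone by `ẽ_i`. -/
theorem wordE_of_wordF {n i : ℕ} (hn : 2 ≤ n) (hi : 1 ≤ i) {w v : List ℤ}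
    (h : wordF n i w = some v) :
    wordE n i v = some w ∧ (wordPhiEps n i w).1 = (wordPhiEps n i v).1 + 1 ∧
      (wordPhiEps n i v).2 = (wordPhiEps n i w).2 + 1 := by
  induction w generalizing v with
  | nil => simp [wordF] at h
  | cons x w ih =>
    rw [wordF] at h
    split_ifs at h with hc
    · obtain ⟨y, hy, rfl⟩ := Option.map_eq_some_iff.1 h
      obtain ⟨h1, h2, h3, h4⟩ := letterEps_of_letterF hn hi hy
      refine ⟨?_, ?_, ?_⟩
      · rw [wordE, if_pos (by omega), (letterF_eq_some_iff hi x y).1 hy]; rfl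
      · simp only [wordPhiEps]; omega
      · simp only [wordPhiEps]; omega
    · obtain ⟨v, hv, rfl⟩ := Option.map_eq_some_iff.1 h
      obtain ⟨h1, h2, h3⟩ := ih hv
      refine ⟨?_, ?_, ?_⟩
      · rw [wordE, if_neg (by omega), h1]; rfl
      · simp only [wordPhiEps]; omega
      · simp only [wordPhiEps]; omega

theorem length_of_wordF {n i : ℕ} {w v : List ℤ} (h : wordF n i w = some v) :
    v.length = w.length := by
  induction w generalizing v with
  | nil => simp [wordF] at h
  | cons x w ih =>
    rw [wordF] at h
    split_ifs at h with hc
    · obtain ⟨y, hy, rfl⟩ := Option.map_eq_some_iff.1 h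
      simp
    · obtain ⟨v, hv, rfl⟩ := Option.map_eq_some_iff.1 h
      simp [ih hv]

/-! ### Two symmetries: duality and the diagram automorphism `n - 1 ↔ n` -/

/-- The dual word: reversed, with all letters barred. Duality interchanges `ẽ_i` and `f̃_i`. -/
def dual (w : List ℤ) : List ℤ := (w.map fun x => -x).reverse

theorem dual_cons (x : ℤ) (w : List ℤ) : dual (x :: w) = dual w ++ [-x] := by simp [dual]

theorem dual_dual (w : List ℤ) : dual (dual w) = w := by simp [dual, List.map_reverse]

theorem letterF_neg (n i : ℕ) (x : ℤ) :
    letterF n i (-x) = (letterE n i x).map fun y => -y := by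
  unfold letterF letterE
  split_ifs <;> simp <;> omega

theorem letterPhi_neg (n i : ℕ) (x : ℤ) : letterPhi n i (-x) = letterEps n i x := by
  simp [letterPhi, letterEps, letterF_neg]

theorem letterE_neg (n i : ℕ) (x : ℤ) :
    letterE n i (-x) = (letterF n i x).map fun y => -y := by
  have := letterF_neg n i (-x)
  rw [neg_neg] at this
  rw [this]; simp

theorem letterEps_neg (n i : ℕ) (x : ℤ) : letterEps n i (-x) = letterPhi n i x := by
  simp [letterPhi, letterEps, letterE_neg]

theorem wordPhiEps_dual (n i : ℕ) (w : List ℤ) :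
    wordPhiEps n i (dual w) = ((wordPhiEps n i w).2, (wordPhiEps n i w).1) := by
  induction w with
  | nil => simp [dual, wordPhiEps]
  | cons x w ih =>
    simp only [dual_cons, wordPhiEps_append, ih, wordPhiEps, letterPhi_neg, letterEps_neg,
      Prod.mk.injEq]
    constructor <;> omega

theorem wordF_dual (n i : ℕ) (w : List ℤ) :
    wordF n i (dual w) = (wordE n i w).map dual := by
  induction w with
  | nil => simp [dual, wordF, wordE]
  | cons x w ih =>
    simp only [dual_cons, wordF_append, ih, wordE, wordPhiEps_dual, wordPhiEps, wordF,
      letterPhi_neg, letterEps_neg, letterF_neg]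
    split_ifs <;> first | (exfalso; omega) | simp [Function.comp_def, dual_cons]

theorem wordE_dual (n i : ℕ) (w : List ℤ) :
    wordE n i (dual w) = (wordF n i w).map dual := by
  have := wordF_dual n i (dual w)
  rw [dual_dual] at this
  rw [this]; simp [Function.comp_def, dual_dual]

theorem wordF_of_wordE {n i : ℕ} (hn : 2 ≤ n) (hi : 1 ≤ i) {w v : List ℤ}
    (h : wordE n i w = some v) :
    wordF n i v = some w ∧ (wordPhiEps n i v).1 = (wordPhiEps n i w).1 + 1 ∧
      (wordPhiEps n i w).2 = (wordPhiEps n i v).2 + 1 := by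
  have h' : wordF n i (dual w) = some (dual v) := by rw [wordF_dual, h]; rfl
  obtain ⟨h1, h2, h3⟩ := wordE_of_wordF hn hi h'
  simp only [wordPhiEps_dual] at h2 h3
  refine ⟨?_, h3, h2⟩
  rw [wordE_dual] at h1
  obtain ⟨z, hz, hz'⟩ := Option.map_eq_some_iff.1 h1
  rw [hz, ← dual_dual z, hz', dual_dual]

/-- The exchange of the two incomparable letters `n` and `n̄`. -/
def swapLetter (n : ℕ) (x : ℤ) : ℤ := if x = n then -n else if x = -n then n else x

theorem swapLetter_swapLetter (n : ℕ) (x : ℤ) : swapLetter n (swapLetter n x) = x := by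
  unfold swapLetter; split_ifs <;> omega

theorem letterF_swap {n : ℕ} (hn : 2 ≤ n) (x : ℤ) :
    letterF n n (swapLetter n x) = (letterF n (n - 1) x).map (swapLetter n) := by
  unfold letterF swapLetter
  split_ifs <;> simp <;> (try split_ifs) <;> omega

theorem letterE_swap {n : ℕ} (hn : 2 ≤ n) (x : ℤ) :
    letterE n n (swapLetter n x) = (letterE n (n - 1) x).map (swapLetter n) := by
  unfold letterE swapLetter
  split_ifs <;> simp <;> (try split_ifs) <;> omega

theorem wordPhiEps_swap {n : ℕ} (hn : 2 ≤ n) (w : List ℤ) :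
    wordPhiEps n n (w.map (swapLetter n)) = wordPhiEps n (n - 1) w := by
  induction w with
  | nil => rfl
  | cons x w ih =>
    simp [wordPhiEps, ih, letterPhi, letterEps, letterF_swap hn, letterE_swap hn]

theorem wordF_swap {n : ℕ} (hn : 2 ≤ n) (w : List ℤ) :
    wordF n n (w.map (swapLetter n)) = (wordF n (n - 1) w).map (List.map (swapLetter n)) := by
  induction w with
  | nil => rfl
  | cons x w ih =>
    simp only [List.map_cons, wordF, wordPhiEps_swap hn, ih, letterEps, letterF_swap hn,
      letterE_swap hn, Option.isSome_map]
    split_ifs <;> simp [Function.comp_def]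

/-! ### Weights -/

/-- The `i`-th coordinate of the weight of a word. -/
def wordWt (i : ℕ) (w : List ℤ) : ℤ := (w.count (i : ℤ) : ℤ) - (w.count (-(i : ℤ)) : ℤ)

theorem wordWt_cons (i : ℕ) (x : ℤ) (w : List ℤ) :
    wordWt i (x :: w) = (if x = i then 1 else 0) - (if x = -(i : ℤ) then 1 else 0) + wordWt i w := by
  simp only [wordWt, List.count_cons, beq_iff_eq]
  split_ifs <;> push_cast <;> ring

theorem wordWt_append (i : ℕ) (u v : List ℤ) :
    wordWt i (u ++ v) = wordWt i u + wordWt i v := by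
  simp only [wordWt, List.count_append]; push_cast; ring

theorem phi_sub_eps_of_lt {n i : ℕ} (hi : 1 ≤ i) (hin : i < n) (w : List ℤ) :
    ((wordPhiEps n i w).1 : ℤ) - (wordPhiEps n i w).2 = wordWt i w - wordWt (i + 1) w := by
  induction w with
  | nil => simp [wordPhiEps, wordWt]
  | cons x w ih =>
    have hl : (letterPhi n i x : ℤ) - letterEps n i x = ((if x = i then 1 else 0)
        - (if x = -(i : ℤ) then 1 else 0)) - ((if x = ((i + 1 : ℕ) : ℤ) then 1 else 0)
        - (if x = -((i + 1 : ℕ) : ℤ) then 1 else 0)) := by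
      rw [letterPhi_eq, letterEps_eq]
      push_cast
      split_ifs <;> omega
    simp only [wordPhiEps, wordWt_cons] at *
    generalize (wordPhiEps n i w) = q at *
    generalize letterPhi n i x = p at *
    generalize letterEps n i x = e at *
    push_cast at *
    omega

theorem phi_sub_eps_last {n : ℕ} (hn : 2 ≤ n) (w : List ℤ) :
    ((wordPhiEps n n w).1 : ℤ) - (wordPhiEps n n w).2 = wordWt (n - 1) w + wordWt n w := by
  induction w with
  | nil => simp [wordPhiEps, wordWt]
  | cons x w ih =>
    have hl : (letterPhi n n x : ℤ) - letterEps n n x = ((if x = ((n - 1 : ℕ) : ℤ) then 1 else 0)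
        - (if x = -((n - 1 : ℕ) : ℤ) then 1 else 0)) + ((if x = n then 1 else 0)
        - (if x = -(n : ℤ) then 1 else 0)) := by
      rw [letterPhi_eq, letterEps_eq, Nat.cast_sub (by omega)]
      push_cast
      split_ifs <;> omega
    simp only [wordPhiEps, wordWt_cons] at *
    generalize (wordPhiEps n n w) = q at *
    generalize letterPhi n n x = p at *
    generalize letterEps n n x = e at *
    push_cast at *
    omega

theorem wordWt_one_of_wordF {n i : ℕ} (hn : 3 ≤ n) (hi : 1 ≤ i) {w v : List ℤ}
    (h : wordF n i w = some v) : wordWt 1 v = wordWt 1 w - if i = 1 then 1 else 0 := by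
  induction w generalizing v with
  | nil => simp [wordF] at h
  | cons x w ih =>
    rw [wordF] at h
    split_ifs at h with hc
    · obtain ⟨y, hy, rfl⟩ := Option.map_eq_some_iff.1 h
      simp only [wordWt_cons]
      rw [letterF_eq_some] at hy
      push_cast
      split_ifs <;> omega
    · obtain ⟨v, hv, rfl⟩ := Option.map_eq_some_iff.1 h
      simp only [wordWt_cons]
      rw [ih hv]; ring

/-- The position of a letter in the list `1, …, n, n̄, …, 1̄`, as a natural number. Every
`ẽ_i` lowers the sum of the heights of the letters of a word. -/
def height (n : ℕ) (x : ℤ) : ℕ := if 0 < x then x.toNat else (2 * n + 1 + x).toNat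

theorem height_lt_of_wordE {n i : ℕ} (hn : 2 ≤ n) (hi : 1 ≤ i) {w v : List ℤ}
    (h : wordE n i w = some v) : (v.map (height n)).sum < (w.map (height n)).sum := by
  induction w generalizing v with
  | nil => simp [wordE] at h
  | cons x w ih =>
    rw [wordE] at h
    split_ifs at h with hc
    · obtain ⟨y, hy, rfl⟩ := Option.map_eq_some_iff.1 h
      simp only [List.map_cons, List.sum_cons, add_lt_add_iff_right]
      unfold letterE at hy
      unfold height
      split_ifs at hy ⊢ <;> simp at hy <;> omega
    · obtain ⟨v, hv, rfl⟩ := Option.map_eq_some_iff.1 h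
      simpa using ih hv

/-! ### Kashiwara–Nakashima tableaux as chains of columns -/

/-- The condition on a single column of a tableau in `B(kϖ₂)`. -/
def ColOK (n : ℕ) (c : ℤ × ℤ) : Prop :=
  (c.1 ≠ 0 ∧ -(n : ℤ) ≤ c.1 ∧ c.1 ≤ n) ∧ (c.2 ≠ 0 ∧ -(n : ℤ) ≤ c.2 ∧ c.2 ≤ n) ∧
    ¬ Le n c.2 c.1 ∧ ¬ (c.1 = 1 ∧ c.2 = -1)

/-- The condition on two neighbouring columns of a tableau in `B(kϖ₂)`. The exclusion of the columns
`n-1` over `n` and `n` over `\overline{n-1}` is needed for neighbours only, see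
`KNTab.pairwise_config`. -/
def Adj (n : ℕ) (c d : ℤ × ℤ) : Prop :=
  Le n c.1 d.1 ∧ Le n c.2 d.2 ∧ ¬ (c.1 = d.1 ∧ d.2 = -d.1) ∧ ¬ (c.2 = -c.1 ∧ d.2 = c.2) ∧
    ¬ (c.1 = (n : ℤ) - 1 ∧ c.2 = n ∧ d.1 = n ∧ d.2 = -((n : ℤ) - 1)) ∧
    ¬ (c.1 = (n : ℤ) - 1 ∧ c.2 = -n ∧ d.1 = -n ∧ d.2 = -((n : ℤ) - 1))

theorem letterPhi_cases {n i : ℕ} (hin : i < n) (x : ℤ) :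
    (letterPhi n i x = 1 ∧ (x = i ∨ x = -((i : ℤ) + 1))) ∨
      (letterPhi n i x = 0 ∧ x ≠ i ∧ x ≠ -((i : ℤ) + 1)) := by
  rw [letterPhi_eq]; split_ifs <;> omega

theorem letterEps_cases {n i : ℕ} (hin : i < n) (x : ℤ) :
    (letterEps n i x = 1 ∧ (x = (i : ℤ) + 1 ∨ x = -(i : ℤ))) ∨
      (letterEps n i x = 0 ∧ x ≠ (i : ℤ) + 1 ∧ x ≠ -(i : ℤ)) := by
  rw [letterEps_eq]; split_ifs <;> omega

theorem letterF_cases {n i : ℕ} (hin : i < n) {x y : ℤ} (h : letterF n i x = some y) :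
    (x = i ∧ y = i + 1) ∨ (x = -((i : ℤ) + 1) ∧ y = -(i : ℤ)) := by
  rw [letterF_eq_some] at h; omega

/-- The colour `n` is left out here and in `Adj.wordF`; it is reduced to the colour `n - 1` by the
exchange of `n` and `n̄`. -/
theorem ColOK.wordF {n i : ℕ} (hi : 1 ≤ i) (hin : i < n) {a b : ℤ} {v : List ℤ}
    (hc : ColOK n (a, b)) (h : wordF n i [b, a] = some v) :
    ∃ a' b', v = [b', a'] ∧ ColOK n (a', b') := by
  simp only [KR.wordF, wordPhiEps, Nat.zero_sub, Nat.add_zero, Nat.zero_le, if_true,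
    Option.map_none] at h
  have p1 := letterPhi_cases hin a
  have e1 := letterEps_cases hin a
  have p2 := letterPhi_cases hin b
  have e2 := letterEps_cases hin b
  split_ifs at h with h1
  · obtain ⟨y, hy, rfl⟩ := Option.map_eq_some_iff.1 h
    have hy' := letterF_cases hin hy
    refine ⟨_, _, rfl, ?_⟩
    simp only [ColOK, Le, Lt] at *
    omega
  · obtain ⟨w, hw, rfl⟩ := Option.map_eq_some_iff.1 h
    obtain ⟨y, hy, rfl⟩ := Option.map_eq_some_iff.1 hw
    have hy' := letterF_cases hin hy
    refine ⟨_, _, rfl, ?_⟩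
    simp only [ColOK, Le, Lt] at *
    omega

/-- The tensor product rule for four factors, as it occurs for two neighbouring columns. -/
theorem wordF_four {n i : ℕ} {x y z w : ℤ} {v : List ℤ} (h : wordF n i [x, y, z, w] = some v) :
    (∃ u, letterF n i x = some u ∧ v = [u, y, z, w] ∧ letterPhi n i y + (letterPhi n i z +
      (letterPhi n i w - letterEps n i z) - letterEps n i y) ≤ letterEps n i x) ∨
    (∃ u, letterF n i y = some u ∧ v = [x, u, z, w] ∧ letterEps n i x < letterPhi n i y +
      (letterPhi n i z + (letterPhi n i w - letterEps n i z) - letterEps n i y) ∧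
      letterPhi n i z + (letterPhi n i w - letterEps n i z) ≤ letterEps n i y) ∨
    (∃ u, letterF n i z = some u ∧ v = [x, y, u, w] ∧ letterEps n i x < letterPhi n i y +
      (letterPhi n i z + (letterPhi n i w - letterEps n i z) - letterEps n i y) ∧
      letterEps n i y < letterPhi n i z + (letterPhi n i w - letterEps n i z) ∧
      letterPhi n i w ≤ letterEps n i z) ∨
    (∃ u, letterF n i w = some u ∧ v = [x, y, z, u] ∧ letterEps n i x < letterPhi n i y +
      (letterPhi n i z + (letterPhi n i w - letterEps n i z) - letterEps n i y) ∧
      letterEps n i y < letterPhi n i z + (letterPhi n i w - letterEps n i z) ∧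
      letterEps n i z < letterPhi n i w) := by
  simp only [KR.wordF, wordPhiEps, Nat.zero_sub, Nat.add_zero, Nat.zero_le, if_true,
    Option.map_none] at h
  split_ifs at h with g1 g2 g3
  · obtain ⟨u, hu, rfl⟩ := Option.map_eq_some_iff.1 h
    exact Or.inl ⟨u, hu, rfl, g1⟩
  · simp only [Option.map_map] at h
    obtain ⟨u, hu, rfl⟩ := Option.map_eq_some_iff.1 h
    exact Or.inr (Or.inl ⟨u, hu, rfl, not_le.1 g1, g2⟩)
  · simp only [Option.map_map] at h
    obtain ⟨u, hu, rfl⟩ := Option.map_eq_some_iff.1 h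
    exact Or.inr (Or.inr (Or.inl ⟨u, hu, rfl, not_le.1 g1, not_le.1 g2, g3⟩))
  · simp only [Option.map_map] at h
    obtain ⟨u, hu, rfl⟩ := Option.map_eq_some_iff.1 h
    exact Or.inr (Or.inr (Or.inr ⟨u, hu, rfl, not_le.1 g1, not_le.1 g2, not_le.1 g3⟩))

set_option maxHeartbeats 4000000 in
theorem Adj.wordF {n i : ℕ} (hi : 1 ≤ i) (hin : i < n) {a b c d : ℤ} {v : List ℤ}
    (h1 : ColOK n (a, b)) (h2 : ColOK n (c, d)) (h12 : Adj n (a, b) (c, d))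
    (h : wordF n i [b, a, d, c] = some v) :
    ∃ a' b' c' d', v = [b', a', d', c'] ∧ Adj n (a', b') (c', d') := by
  have pa := letterPhi_cases hin a
  have ea := letterEps_cases hin a
  have pb := letterPhi_cases hin b
  have eb := letterEps_cases hin b
  have pc := letterPhi_cases hin c
  have ec := letterEps_cases hin c
  have pd := letterPhi_cases hin d
  have ed := letterEps_cases hin d
  rcases wordF_four h with ⟨u, hu, rfl, g⟩ | ⟨u, hu, rfl, g⟩ | ⟨u, hu, rfl, g⟩ | ⟨u, hu, rfl, g⟩
  all_goals
    refine ⟨_, _, _, _, rfl, ?_⟩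
    have hu' := letterF_cases hin hu
    generalize letterPhi n i a = fa at *
    generalize letterPhi n i b = fb at *
    generalize letterPhi n i c = fc at *
    generalize letterPhi n i d = fd at *
    generalize letterEps n i a = ga at *
    generalize letterEps n i b = gb at *
    generalize letterEps n i c = gc at *
    generalize letterEps n i d = gd at *
    clear h hu
    simp only [ColOK, Adj, Le, Lt] at *
  all_goals
    rcases hu' with ⟨rfl, rfl⟩ | ⟨rfl, rfl⟩ <;>
      refine ⟨?_, ?_, ?_, ?_, ?_, ?_⟩ <;> grind (splits := 60)

/-- Kashiwara–Nakashima tableaux of shape `(k, k)` for some `k`, described by conditions on single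
columns and on pairs of neighbouring columns only. -/
def KNTab (n : ℕ) (t : Tab) : Prop := (∀ c ∈ t, ColOK n c) ∧ t.IsChain (Adj n)

theorem word_append (s t : Tab) : word (s ++ t) = word s ++ word t := by
  induction s with
  | nil => rfl
  | cons c s ih => simp [word, ih]

theorem unword_word (t : Tab) : unword (word t) = t := by
  induction t with
  | nil => rfl
  | cons c t ih => simp [word, unword, ih]

theorem length_word (t : Tab) : (word t).length = 2 * t.length := by
  induction t with
  | nil => rfl
  | cons c t ih => simp only [word, List.length_cons, ih]; ring

theorem KNTab.of_cons {n : ℕ} {c : ℤ × ℤ} {t : Tab} (h : KNTab n (c :: t)) : KNTab n t :=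
  ⟨fun d hd => h.1 d (List.mem_cons_of_mem _ hd), h.2.of_cons⟩

theorem kNTab_cons_cons {n : ℕ} {c d : ℤ × ℤ} {t : Tab} :
    KNTab n (c :: d :: t) ↔ ColOK n c ∧ Adj n c d ∧ KNTab n (d :: t) := by
  simp only [KNTab, List.forall_mem_cons, List.isChain_cons_cons]
  tauto

theorem kNTab_singleton {n : ℕ} {c : ℤ × ℤ} : KNTab n [c] ↔ ColOK n c := by
  simp [KNTab]

/-- An arrow changes one letter, and by the tensor product rule it acts on any two neighbouring
columns, one of which contains this letter, as on the word of these two columns alone. -/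
theorem KNTab.exists_of_wordF_of_lt {n i : ℕ} (hi : 1 ≤ i) (hin : i < n) {t : Tab} {v : List ℤ}
    (ht : KNTab n t) (h : wordF n i (word t) = some v) : ∃ t', v = word t' ∧ KNTab n t' := by
  induction t generalizing v with
  | nil => simp [word, KR.wordF] at h
  | cons c t ih =>
    have hc := ht.1 c (by simp)
    have hw : ∀ (e : ℤ × ℤ) (r : Tab), word (e :: r) = [e.2, e.1] ++ word r := fun _ _ => rfl
    rw [hw, wordF_append] at h
    split_ifs at h with h1
    · obtain ⟨u, hu, rfl⟩ := Option.map_eq_some_iff.1 h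
      obtain ⟨a', b', rfl, hc'⟩ := hc.wordF hi hin hu
      refine ⟨(a', b') :: t, rfl, ?_⟩
      cases t with
      | nil => exact kNTab_singleton.2 hc'
      | cons d t =>
        obtain ⟨-, hcd, hd⟩ := kNTab_cons_cons.1 ht
        refine kNTab_cons_cons.2 ⟨hc', ?_, hd⟩
        have hF : wordF n i ([c.2, c.1] ++ [d.2, d.1]) = some ([b', a'] ++ [d.2, d.1]) := by
          rw [wordF_append, if_pos, hu]; · rfl
          rw [hw, wordPhiEps_append] at h1
          dsimp only at h1
          omega
        obtain ⟨_, _, _, _, he, hA⟩ := Adj.wordF hi hin hc (hd.1 d (by simp)) hcd hF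
        simp only [List.cons_append, List.nil_append, List.cons.injEq, and_true] at he
        obtain ⟨rfl, rfl, h3, h4⟩ := he
        subst h3 h4
        exact hA
    · obtain ⟨u, hu, rfl⟩ := Option.map_eq_some_iff.1 h
      obtain ⟨t', rfl, ht'⟩ := ih ht.of_cons hu
      refine ⟨c :: t', rfl, ?_⟩
      cases t' with
      | nil => exact kNTab_singleton.2 hc
      | cons d' t' =>
        refine kNTab_cons_cons.2 ⟨hc, ?_, ht'⟩
        cases t with
        | nil => simp [word, KR.wordF] at hu
        | cons d t =>
          obtain ⟨-, hcd, hd⟩ := kNTab_cons_cons.1 ht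
          rw [hw, wordF_append] at hu
          split_ifs at hu with h2
          · obtain ⟨u, hu, he⟩ := Option.map_eq_some_iff.1 hu
            obtain ⟨a', b', rfl, hd'⟩ := (hd.1 d (by simp)).wordF hi hin hu
            simp only [word, List.cons_append, List.nil_append, List.cons.injEq] at he
            have hF : wordF n i ([c.2, c.1] ++ [d.2, d.1]) = some ([c.2, c.1] ++ [b', a']) := by
              rw [wordF_append, if_neg, hu]; · rfl
              rw [hw, wordPhiEps_append] at h1
              dsimp only at h1
              omega
            obtain ⟨_, _, _, _, he', hA⟩ := Adj.wordF hi hin hc (hd.1 d (by simp)) hcd hF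
            simp only [List.cons_append, List.nil_append, List.cons.injEq, and_true] at he'
            obtain ⟨h3, h4, h5, h6⟩ := he'
            rw [← h3, ← h4, ← h5, ← h6, he.1, he.2.1] at hA
            exact hA
          · obtain ⟨u, hu, he⟩ := Option.map_eq_some_iff.1 hu
            simp only [word, List.cons_append, List.nil_append, List.cons.injEq] at he
            have : d' = d := Prod.ext he.2.1.symm he.1.symm
            rw [this]; exact hcd

/-- The dual filling: rotated by 180 degrees, with all letters barred. -/
def tabDual (t : Tab) : Tab := (t.map fun c => (-c.2, -c.1)).reverse

theorem word_tabDual (t : Tab) : word (tabDual t) = dual (word t) := by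
  induction t with
  | nil => rfl
  | cons c t ih =>
    have : tabDual (c :: t) = tabDual t ++ [(-c.2, -c.1)] := by simp [tabDual]
    rw [this, word_append, ih]
    simp [word, dual_cons]

theorem ColOK.dual {n : ℕ} {c : ℤ × ℤ} (h : ColOK n c) : ColOK n (-c.2, -c.1) := by
  simp only [ColOK, Le, Lt] at *; grind (splits := 60)

theorem Adj.dual {n : ℕ} {c d : ℤ × ℤ} (h : Adj n c d) :
    Adj n (-d.2, -d.1) (-c.2, -c.1) := by
  simp only [Adj, Le, Lt] at *
  refine ⟨?_, ?_, ?_, ?_, ?_, ?_⟩ <;> grind (splits := 60)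

theorem KNTab.dual {n : ℕ} {t : Tab} (h : KNTab n t) : KNTab n (tabDual t) := by
  refine ⟨?_, ?_⟩
  · intro c hc
    simp only [tabDual, List.mem_reverse, List.mem_map] at hc
    obtain ⟨d, hd, rfl⟩ := hc
    exact (h.1 d hd).dual
  · rw [tabDual, List.isChain_reverse, List.isChain_map]
    exact h.2.imp fun a b hab => hab.dual

theorem ColOK.swap {n : ℕ} (hn : 2 ≤ n) {c : ℤ × ℤ} (h : ColOK n c) :
    ColOK n (swapLetter n c.1, swapLetter n c.2) := by
  simp only [ColOK, Le, Lt, swapLetter] at *; grind (splits := 60)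

theorem Adj.swap {n : ℕ} {c d : ℤ × ℤ} (hc : ColOK n c) (hd : ColOK n d)
    (h : Adj n c d) :
    Adj n (swapLetter n c.1, swapLetter n c.2) (swapLetter n d.1, swapLetter n d.2) := by
  have e : ∀ x, (x = (n : ℤ) ∧ swapLetter n x = -n) ∨ (x = -(n : ℤ) ∧ swapLetter n x = n) ∨
      (x ≠ n ∧ x ≠ -(n : ℤ) ∧ swapLetter n x = x) := by
    intro x; unfold swapLetter; split_ifs <;> omega
  have h1 := e c.1
  have h2 := e c.2
  have h3 := e d.1
  have h4 := e d.2
  simp only [ColOK, Adj, Le, Lt] at *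
  refine ⟨?_, ?_, ?_, ?_, ?_, ?_⟩ <;> grind (splits := 60)

/-- The filling with `n` and `n̄` exchanged. -/
def tabSwap (n : ℕ) (t : Tab) : Tab := t.map fun c => (swapLetter n c.1, swapLetter n c.2)

theorem word_tabSwap (n : ℕ) (t : Tab) : word (tabSwap n t) = (word t).map (swapLetter n) := by
  induction t with
  | nil => rfl
  | cons c t ih => simp only [tabSwap, List.map_cons, word] at *; rw [ih]

theorem tabSwap_tabSwap (n : ℕ) (t : Tab) : tabSwap n (tabSwap n t) = t := by
  simp [tabSwap, Function.comp_def, swapLetter_swapLetter]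

theorem KNTab.swap {n : ℕ} (hn : 2 ≤ n) {t : Tab} (h : KNTab n t) : KNTab n (tabSwap n t) := by
  induction t with
  | nil => exact h
  | cons c t ih =>
    cases t with
    | nil => exact kNTab_singleton.2 ((kNTab_singleton.1 h).swap hn)
    | cons d t =>
      obtain ⟨h1, h2, h3⟩ := kNTab_cons_cons.1 h
      exact kNTab_cons_cons.2 ⟨h1.swap hn, h2.swap h1 (h3.1 d (by simp)), ih h3⟩

theorem KNTab.exists_of_wordF {n i : ℕ} (hn : 2 ≤ n) (hi : 1 ≤ i) (hin : i ≤ n) {t : Tab}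
    {v : List ℤ} (ht : KNTab n t) (h : wordF n i (word t) = some v) :
    ∃ t', v = word t' ∧ KNTab n t' := by
  rcases hin.lt_or_eq with hlt | rfl
  · exact ht.exists_of_wordF_of_lt hi hlt h
  · rw [← tabSwap_tabSwap i t, word_tabSwap, wordF_swap hn] at h
    obtain ⟨u, hu, rfl⟩ := Option.map_eq_some_iff.1 h
    obtain ⟨t', rfl, ht'⟩ :=
      (ht.swap hn).exists_of_wordF_of_lt (i := i - 1) (by omega) (by omega) hu
    exact ⟨_, (word_tabSwap i t').symm, ht'.swap hn⟩

/-- The Kashiwara–Nakashima tableaux are stable under the operators `f̃_i`. -/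
theorem KNTab.tabF {n i : ℕ} (hn : 2 ≤ n) (hi : 1 ≤ i) (hin : i ≤ n) {t t' : Tab}
    (ht : KNTab n t) (h : tabF n i t = some t') :
    KNTab n t' ∧ t'.length = t.length ∧ wordF n i (word t) = some (word t') := by
  obtain ⟨v, hv, rfl⟩ := Option.map_eq_some_iff.1 h
  obtain ⟨t', rfl, ht'⟩ := ht.exists_of_wordF hn hi hin hv
  rw [unword_word]
  have := length_of_wordF hv
  rw [length_word, length_word] at this
  exact ⟨ht', by omega, hv⟩

/-- The Kashiwara–Nakashima tableaux are stable under the operators `ẽ_i`. -/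
theorem KNTab.tabE {n i : ℕ} (hn : 2 ≤ n) (hi : 1 ≤ i) (hin : i ≤ n) {t t' : Tab}
    (ht : KNTab n t) (h : tabE n i t = some t') :
    KNTab n t' ∧ t'.length = t.length ∧ wordE n i (word t) = some (word t') := by
  obtain ⟨v, hv, rfl⟩ := Option.map_eq_some_iff.1 h
  have hF : wordF n i (word (tabDual t)) = some (KR.dual v) := by
    rw [word_tabDual, wordF_dual, hv]; rfl
  obtain ⟨t', ht1, ht'⟩ := ht.dual.exists_of_wordF hn hi hin hF
  have hv' : v = word (tabDual t') := by rw [word_tabDual, ← ht1, dual_dual]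
  subst hv'
  rw [unword_word]
  have := length_of_wordF ((wordF_of_wordE hn hi hv).1)
  rw [length_word, length_word] at this
  exact ⟨ht'.dual, by omega, hv⟩

theorem tabF_eq_none_iff (n i : ℕ) (t : Tab) :
    tabF n i t = none ↔ (wordPhiEps n i (word t)).1 = 0 := by
  rw [KR.tabF, Option.map_eq_none_iff, wordF_eq_none_iff]

theorem tabE_eq_none_iff (n i : ℕ) (t : Tab) :
    tabE n i t = none ↔ (wordPhiEps n i (word t)).2 = 0 := by
  rw [KR.tabE, Option.map_eq_none_iff, wordE_eq_none_iff]

theorem tabF_of_wordF {n i : ℕ} {t t' : Tab} (h : wordF n i (word t) = some (word t')) :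
    tabF n i t = some t' := by
  rw [KR.tabF, h, Option.map_some, unword_word]

/-! ### Agreement with the definition of `B(kϖ₂)` -/

theorem Le.trans {n : ℕ} {x y z : ℤ} (hy : -(n : ℤ) ≤ y ∧ y ≤ n) (hxy : Le n x y)
    (hyz : Le n y z) : Le n x z := by
  simp only [Le, Lt] at *; omega

/-- The rows of a filling with weakly increasing rows are increasing on all pairs of columns. -/
theorem pairwise_le_of_isChain {n : ℕ} {t : Tab}
    (hc : ∀ c ∈ t, (-(n : ℤ) ≤ c.1 ∧ c.1 ≤ n) ∧ (-(n : ℤ) ≤ c.2 ∧ c.2 ≤ n))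
    (h : t.IsChain fun c d => Le n c.1 d.1 ∧ Le n c.2 d.2) :
    t.Pairwise fun c d => Le n c.1 d.1 ∧ Le n c.2 d.2 := by
  induction t with
  | nil => exact List.Pairwise.nil
  | cons c t ih =>
    have iht := ih (fun d hd => hc d (by simp [hd])) h.of_cons
    refine List.pairwise_cons.2 ⟨?_, iht⟩
    cases t with
    | nil => simp
    | cons d t =>
      have hcd := (List.isChain_cons_cons.1 h).1
      have hd := hc d (by simp)
      intro e he
      rcases List.mem_cons.1 he with rfl | he
      · exact hcd
      · have := (List.pairwise_cons.1 iht).1 e he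
        exact ⟨hcd.1.trans hd.1 this.1, hcd.2.trans hd.2 this.2⟩

theorem KNTab.pairwise_le {n : ℕ} {t : Tab} (h : KNTab n t) :
    t.Pairwise fun c d => Le n c.1 d.1 ∧ Le n c.2 d.2 :=
  pairwise_le_of_isChain (fun c hc => ⟨(h.1 c hc).1.2, (h.1 c hc).2.1.2⟩)
    (h.2.imp fun _ _ hab => ⟨hab.1, hab.2.1⟩)

/-- Among tableaux without `a`-configurations, the exclusion of the columns `n-1` over `n` and `n`
over `\overline{n-1}` at any distance follows from that for neighbours. -/
theorem KNTab.pairwise_config {n : ℕ} {t : Tab} (h : KNTab n t) :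
    t.Pairwise (fun c d =>
      ¬ (c = ((n : ℤ) - 1, (n : ℤ)) ∧ d = ((n : ℤ), -((n : ℤ) - 1))) ∧
      ¬ (c = ((n : ℤ) - 1, -(n : ℤ)) ∧ d = (-(n : ℤ), -((n : ℤ) - 1)))) := by
  induction t with
  | nil => exact List.Pairwise.nil
  | cons c t ih =>
    refine List.pairwise_cons.2 ⟨?_, ih h.of_cons⟩
    cases t with
    | nil => simp
    | cons d t =>
      obtain ⟨hc, hcd, hd⟩ := kNTab_cons_cons.1 h
      have hdd := hd.1 d (by simp)
      intro e he
      rcases List.mem_cons.1 he with rfl | he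
      · have := hcd.2.2.2.2
        simp only [Prod.ext_iff]
        tauto
      · have ihd := (List.pairwise_cons.1 (ih h.of_cons)).1 e he
        have hle := (List.pairwise_cons.1 hd.pairwise_le).1 e he
        simp only [ColOK, Adj, Le, Lt, Prod.ext_iff] at *
        constructor <;> grind (splits := 60)

theorem isKN_iff {n k : ℕ} {t : Tab} : IsKN n k t ↔ t.length = k ∧ KNTab n t := by
  constructor
  · rintro ⟨⟨h1, h2, h3, h4, h5⟩, h6, h7⟩
    refine ⟨h1, ?_, ?_⟩
    · intro c hc
      have h2c := h2 c hc
      have h7c : c ≠ (1, -1) := by rintro rfl; exact h7 hc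
      rw [Ne, Prod.ext_iff] at h7c
      refine ⟨?_, ?_, h4 c hc, h7c⟩
      · obtain ⟨⟨h, h'⟩, -⟩ := h2c
        rw [abs_le] at h'
        exact ⟨by rintro h0; simp [h0] at h, h'.1, h'.2⟩
      · obtain ⟨-, ⟨h, h'⟩⟩ := h2c
        rw [abs_le] at h'
        exact ⟨by rintro h0; simp [h0] at h, h'.1, h'.2⟩
    · rw [List.isChain_iff_getElem] at h3 h6 ⊢
      intro j hj
      have a := h3 j hj
      have b := h6 j hj
      rw [List.pairwise_iff_getElem] at h5
      have c := h5 j (j + 1) (by omega) hj (by omega)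
      simp only [Prod.ext_iff] at c
      simp only [Adj]
      tauto
  · rintro ⟨h1, h2⟩
    refine ⟨⟨h1, ?_, ?_, ?_, h2.pairwise_config⟩, ?_, ?_⟩
    · intro c hc
      obtain ⟨a, b, -⟩ := h2.1 c hc
      exact ⟨⟨Int.one_le_abs a.1, abs_le.2 a.2⟩, ⟨Int.one_le_abs b.1, abs_le.2 b.2⟩⟩
    · exact h2.2.imp fun _ _ hab => ⟨hab.1, hab.2.1⟩
    · exact fun c hc => (h2.1 c hc).2.2.1
    · exact h2.2.imp fun _ _ hab => ⟨hab.2.2.1, hab.2.2.2.1⟩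
    · exact fun h => (h2.1 _ h).2.2.2 ⟨rfl, rfl⟩

/-! ### Plactic relations of length three -/

/-- The letters of type `D_n`. -/
def IsLetter (n : ℕ) (x : ℤ) : Prop := x ≠ 0 ∧ -(n : ℤ) ≤ x ∧ x ≤ n

/-- The position of a letter in the list `1, …, n, n̄, …, 1̄`, as an integer. On letters it agrees with
`height`, but has values with which differences can be formed. -/
def pos (n : ℕ) (x : ℤ) : ℤ := if 0 < x then x else 2 * n + 1 + x

theorem pos_cases {n : ℕ} {x : ℤ} (h : IsLetter n x) :
    (0 < x ∧ pos n x = x ∧ 1 ≤ x ∧ x ≤ n) ∨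
      (x < 0 ∧ pos n x = 2 * n + 1 + x ∧ -(n : ℤ) ≤ x) := by
  unfold pos; simp only [IsLetter] at h; split_ifs <;> omega

theorem pos_bound {n : ℕ} {x : ℤ} (h : IsLetter n x) : 1 ≤ pos n x ∧ pos n x ≤ 2 * n := by
  have := pos_cases h; omega

theorem pos_inj {n : ℕ} {x y : ℤ} (hx : IsLetter n x) (hy : IsLetter n y)
    (h : pos n x = pos n y) : x = y := by
  have := pos_cases hx; have := pos_cases hy; omega

theorem pos_neg {n : ℕ} {x : ℤ} (h : IsLetter n x) : pos n (-x) = 2 * n + 1 - pos n x := by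
  have h1 := pos_cases h
  have h2 : IsLetter n (-x) := by simp only [IsLetter] at *; omega
  have := pos_cases h2; omega

theorem IsLetter.neg {n : ℕ} {x : ℤ} (h : IsLetter n x) : IsLetter n (-x) := by
  simp only [IsLetter] at *; omega

theorem le_iff_pos {n : ℕ} {x y : ℤ} (hx : IsLetter n x) (hy : IsLetter n y) :
    Le n x y ↔ pos n x ≤ pos n y ∧ ¬ (pos n x = n ∧ pos n y = n + 1) := by
  have := pos_cases hx
  have := pos_cases hy
  simp only [Le, Lt]
  omega

theorem pos_swap {n : ℕ} {x : ℤ} (h : IsLetter n x) : IsLetter n (swapLetter n x) ∧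
    ((pos n x = n ∧ pos n (swapLetter n x) = n + 1) ∨
    (pos n x = n + 1 ∧ pos n (swapLetter n x) = n) ∨
    (pos n x ≠ n ∧ pos n x ≠ n + 1 ∧ pos n (swapLetter n x) = pos n x)) := by
  have h0 : (x = (n : ℤ) ∧ swapLetter n x = -n) ∨ (x = -(n : ℤ) ∧ swapLetter n x = n) ∨
      (x ≠ n ∧ x ≠ -(n : ℤ) ∧ swapLetter n x = x) := by
    unfold swapLetter; split_ifs <;> omega
  have h1 : IsLetter n (swapLetter n x) := by simp only [IsLetter] at *; omega
  have := pos_cases h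
  have := pos_cases h1
  exact ⟨h1, by omega⟩

/-- The plactic relations of type `D_n` between words of length three, in terms of the positions of
the letters. They identify the two copies of `B(ϖ₁ + ϖ₂)` in `B(ϖ₁)^{⊗3}`: the word `b a c` on the
left is the column `a` over `b` followed by the letter `c`, on the right the column comes
last. The cases `b a c ~ b c a` and `b a c ~ a b c` are the Knuth relations, the others tell how
these are modified when the two letters to be exchanged are `a` and `ā`. -/
def Knuth (n b a c x y z : ℤ) : Prop :=
  (x = b ∧ y = c ∧ z = a ∧ (a < b ∨ (b = n ∧ a = n + 1)) ∧ b ≤ c ∧ (b = n → c ≠ n + 1) ∧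
    a + c ≠ 2 * n + 1) ∨
  (x = b ∧ y = 2 * n - a ∧ z = a + 1 ∧ c = 2 * n + 1 - a ∧ a ≤ n - 1 ∧ a + 1 ≤ b ∧
    b ≤ 2 * n - a ∧ (a = n - 1 → b = n + 1)) ∨
  (x = n ∧ y = n ∧ z = n + 1 ∧ b = n ∧ a = n - 1 ∧ c = n + 2) ∨
  (x = a ∧ y = b ∧ z = c ∧ (a < b ∨ (b = n ∧ a = n + 1)) ∧ a ≤ c ∧ (a = n → c ≠ n + 1) ∧
    (c < b ∨ (b = n ∧ c = n + 1)) ∧ a + b ≠ 2 * n + 1) ∨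
  (x = a - 1 ∧ y = 2 * n + 2 - a ∧ z = c ∧ b = 2 * n + 1 - a ∧ a ≤ n ∧ a ≤ c ∧
    c ≤ 2 * n + 1 - a ∧ (a = n → c = n)) ∨
  (x = n - 1 ∧ y = n + 2 ∧ z = n + 1 ∧ b = n ∧ a = n + 1 ∧ c = n + 1)

/-- The plactic relations as a relation on words. -/
def KnuthRel (n : ℕ) (v w : List ℤ) : Prop :=
  ∃ b a c x y z, v = [b, a, c] ∧ w = [x, y, z] ∧ IsLetter n b ∧ IsLetter n a ∧ IsLetter n c ∧
    IsLetter n x ∧ IsLetter n y ∧ IsLetter n z ∧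
    Knuth n (pos n b) (pos n a) (pos n c) (pos n x) (pos n y) (pos n z)

theorem KnuthRel.dual {n : ℕ} {v w : List ℤ} (h : KnuthRel n v w) :
    KnuthRel n (KR.dual w) (KR.dual v) := by
  obtain ⟨b, a, c, x, y, z, rfl, rfl, hb, ha, hc, hx, hy, hz, h⟩ := h
  refine ⟨_, _, _, _, _, _, rfl, rfl, hz.neg, hy.neg, hx.neg, hc.neg, ha.neg, hb.neg, ?_⟩
  rw [pos_neg hb, pos_neg ha, pos_neg hc, pos_neg hx, pos_neg hy, pos_neg hz]
  have bx := pos_bound hx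
  obtain h | h | h | h | h | h := h
  · exact Or.inr (Or.inr (Or.inr (Or.inl (by omega))))
  · exact Or.inr (Or.inr (Or.inr (Or.inr (Or.inl (by omega)))))
  · exact Or.inr (Or.inr (Or.inr (Or.inr (Or.inr (by omega)))))
  · exact Or.inl (by omega)
  · exact Or.inr (Or.inl (by omega))
  · exact Or.inr (Or.inr (Or.inl (by omega)))

theorem KnuthRel.swap {n : ℕ} {v w : List ℤ} (h : KnuthRel n v w) :
    KnuthRel n (v.map (swapLetter n)) (w.map (swapLetter n)) := by
  obtain ⟨b, a, c, x, y, z, rfl, rfl, hb, ha, hc, hx, hy, hz, h⟩ := h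
  obtain ⟨hb', eb⟩ := pos_swap hb
  obtain ⟨ha', ea⟩ := pos_swap ha
  obtain ⟨hc', ec⟩ := pos_swap hc
  obtain ⟨hx', ex⟩ := pos_swap hx
  obtain ⟨hy', ey⟩ := pos_swap hy
  obtain ⟨hz', ez⟩ := pos_swap hz
  refine ⟨_, _, _, _, _, _, rfl, rfl, hb', ha', hc', hx', hy', hz', ?_⟩
  clear hb' ha' hc' hx' hy' hz' hb ha hc hx hy hz
  obtain h | h | h | h | h | h := h
  · refine Or.inl ⟨?_, ?_, ?_, ?_, ?_, ?_, ?_⟩ <;> grind (splits := 25)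
  · by_cases hn : pos n a = n - 1
    · refine Or.inr (Or.inr (Or.inl ⟨?_, ?_, ?_, ?_, ?_, ?_⟩)) <;> grind (splits := 25)
    · refine Or.inr (Or.inl ⟨?_, ?_, ?_, ?_, ?_, ?_, ?_, ?_⟩) <;> grind (splits := 25)
  · refine Or.inr (Or.inl ⟨?_, ?_, ?_, ?_, ?_, ?_, ?_, ?_⟩) <;> grind (splits := 25)
  · refine Or.inr (Or.inr (Or.inr (Or.inl ⟨?_, ?_, ?_, ?_, ?_, ?_, ?_, ?_⟩))) <;>
      grind (splits := 25)
  · by_cases hn : pos n a = n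
    · refine Or.inr (Or.inr (Or.inr (Or.inr (Or.inr ⟨?_, ?_, ?_, ?_, ?_, ?_⟩)))) <;>
        grind (splits := 25)
    · refine Or.inr (Or.inr (Or.inr (Or.inr (Or.inl ⟨?_, ?_, ?_, ?_, ?_, ?_, ?_, ?_⟩)))) <;>
        grind (splits := 25)
  · refine Or.inr (Or.inr (Or.inr (Or.inr (Or.inl ⟨?_, ?_, ?_, ?_, ?_, ?_, ?_, ?_⟩)))) <;>
      grind (splits := 25)

/-- The colour `i < n` as seen by a single letter. -/
theorem letter_cases {n i : ℕ} (hi : 1 ≤ i) (hin : i < n) {x : ℤ} (hx : IsLetter n x) :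
    (letterPhi n i x = 1 ∧ letterEps n i x = 0 ∧ ∃ u, letterF n i x = some u ∧ IsLetter n u ∧
      pos n u = pos n x + 1 ∧ (pos n x = i ∨ pos n x = 2 * n - i)) ∨
    (letterPhi n i x = 0 ∧ letterEps n i x = 1 ∧ letterF n i x = none ∧
      (pos n x = i + 1 ∨ pos n x = 2 * n - i + 1)) ∨
    (letterPhi n i x = 0 ∧ letterEps n i x = 0 ∧ letterF n i x = none ∧
      pos n x ≠ i ∧ pos n x ≠ 2 * n - i ∧ pos n x ≠ i + 1 ∧ pos n x ≠ 2 * n - i + 1) := by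
  have hp := letterPhi_cases hin x
  have he := letterEps_cases hin x
  have h0 := letterF_eq_none_iff n i x
  have hpos := pos_cases hx
  rcases hF : letterF n i x with _ | u
  · have := h0.1 hF
    rcases he with he | he
    · exact Or.inr (Or.inl ⟨this, he.1, rfl, by omega⟩)
    · exact Or.inr (Or.inr ⟨this, he.1, rfl, by omega⟩)
  · have h1 : letterPhi n i x ≠ 0 := fun h => by rw [h0.2 h] at hF; simp at hF
    have := letterF_cases hin hF
    have hu : IsLetter n u := by simp only [IsLetter]; omega
    have := pos_cases hu
    exact Or.inl ⟨by omega, by omega, u, rfl, hu, by omega, by omega⟩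

/-! ### Arrows and plactic relations -/

/-- Two words look alike for the colour `i` if they have the same `φ_i` and `ε_i` and `f̃_i`
preserves a relation `Q` between them. -/
def FMatch (n i : ℕ) (Q : List ℤ → List ℤ → Prop) (v w : List ℤ) : Prop :=
  wordPhiEps n i v = wordPhiEps n i w ∧ Option.Rel Q (wordF n i v) (wordF n i w)

theorem KnuthRel.of {n : ℕ} {b a c x y z : ℤ}
    (h : Knuth n (pos n b) (pos n a) (pos n c) (pos n x) (pos n y) (pos n z))
    (hb : IsLetter n b := by assumption) (ha : IsLetter n a := by assumption)
    (hc : IsLetter n c := by assumption) (hx : IsLetter n x := by assumption)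
    (hy : IsLetter n y := by assumption) (hz : IsLetter n z := by assumption) :
    KnuthRel n [b, a, c] [x, y, z] :=
  ⟨_, _, _, _, _, _, rfl, rfl, hb, ha, hc, hx, hy, hz, h⟩

/-- The lemmas `fMatch_*` treat the six cases in the definition of `Knuth`, by inspection of the three
letters: an arrow leads from one case to the same or to a neighbouring case. -/
theorem fMatch_first {n i : ℕ} (hi : 1 ≤ i) (hin : i < n) {b a c : ℤ}
    (hb : IsLetter n b) (ha : IsLetter n a) (hc : IsLetter n c)
    (h1 : pos n a < pos n b ∨ (pos n b = n ∧ pos n a = n + 1)) (h2 : pos n b ≤ pos n c)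
    (h3 : pos n b = n → pos n c ≠ n + 1) (h4 : pos n a + pos n c ≠ 2 * n + 1) :
    FMatch n i (KnuthRel n) [b, a, c] [b, c, a] := by
  have bb := pos_bound hb
  have ba := pos_bound ha
  have bc := pos_bound hc
  rcases letter_cases hi hin hb with
    ⟨pb, eb, u, hu, lu, pu, xb⟩ | ⟨pb, eb, hu, xb⟩ | ⟨pb, eb, hu, xb⟩ <;>
  rcases letter_cases hi hin ha with
    ⟨pa, ea, v, hv, lv, pv, xa⟩ | ⟨pa, ea, hv, xa⟩ | ⟨pa, ea, hv, xa⟩ <;>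
  rcases letter_cases hi hin hc with
    ⟨pc, ec, w, hw, lw, pw, xc⟩ | ⟨pc, ec, hw, xc⟩ | ⟨pc, ec, hw, xc⟩ <;>
  refine ⟨?_, ?_⟩ <;>
  simp only [wordF, wordPhiEps, pa, ea, pb, eb, pc, ec, hu, hv, hw, Option.map_some,
    Option.map_none] <;> clear pa ea pb eb pc ec hu hv hw <;>
  first
  | exact .none
  | (refine .some (.of (Or.inl ⟨rfl, rfl, rfl, ?_, ?_, ?_, ?_⟩)) <;> first | assumption | grind)
  | (exfalso; grind)
  | skip
  all_goals
    by_cases hn : pos n a = n - 1 ∧ pos n b = n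
    · refine .some (.of (Or.inr (Or.inr (Or.inl ⟨?_, ?_, ?_, ?_, ?_, ?_⟩)))) <;> omega
    · refine .some (.of (Or.inr (Or.inl ⟨?_, ?_, ?_, ?_, ?_, ?_, ?_, ?_⟩))) <;> grind

theorem fMatch_fourth {n i : ℕ} (hi : 1 ≤ i) (hin : i < n) {b a c : ℤ}
    (hb : IsLetter n b) (ha : IsLetter n a) (hc : IsLetter n c)
    (h1 : pos n a < pos n b ∨ (pos n b = n ∧ pos n a = n + 1)) (h2 : pos n a ≤ pos n c)
    (h3 : pos n a = n → pos n c ≠ n + 1)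
    (h4 : pos n c < pos n b ∨ (pos n b = n ∧ pos n c = n + 1))
    (h5 : pos n a + pos n b ≠ 2 * n + 1) :
    FMatch n i (KnuthRel n) [b, a, c] [a, b, c] := by
  have bb := pos_bound hb
  have ba := pos_bound ha
  have bc := pos_bound hc
  rcases letter_cases hi hin hb with
    ⟨pb, eb, u, hu, lu, pu, xb⟩ | ⟨pb, eb, hu, xb⟩ | ⟨pb, eb, hu, xb⟩ <;>
  rcases letter_cases hi hin ha with
    ⟨pa, ea, v, hv, lv, pv, xa⟩ | ⟨pa, ea, hv, xa⟩ | ⟨pa, ea, hv, xa⟩ <;>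
  rcases letter_cases hi hin hc with
    ⟨pc, ec, w, hw, lw, pw, xc⟩ | ⟨pc, ec, hw, xc⟩ | ⟨pc, ec, hw, xc⟩ <;>
  refine ⟨?_, ?_⟩ <;>
  simp only [wordF, wordPhiEps, pa, ea, pb, eb, pc, ec, hu, hv, hw, Option.map_some,
    Option.map_none] <;> clear pa ea pb eb pc ec hu hv hw <;>
  first
  | exact .none
  | (refine .some (.of (Or.inr (Or.inr (Or.inr (Or.inl
      ⟨rfl, rfl, rfl, ?_, ?_, ?_, ?_, ?_⟩))))) <;> first | assumption | grind)
  | (exfalso; grind)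
  | (by_cases hbc : pos n b = n ∧ pos n c = n + 1
     · refine .some (.of (Or.inr (Or.inr (Or.inl ⟨?_, ?_, ?_, ?_, ?_, ?_⟩)))) <;> grind
     · refine .some (.of (Or.inl ⟨?_, ?_, ?_, ?_, ?_, ?_, ?_⟩)) <;> grind)
  | skip
  all_goals
    refine .some (.of (Or.inr (Or.inr (Or.inr (Or.inr (Or.inl
      ⟨?_, ?_, ?_, ?_, ?_, ?_, ?_, ?_⟩)))))) <;> grind

theorem fMatch_second {n i : ℕ} (hi : 1 ≤ i) (hin : i < n) {b a c y z : ℤ}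
    (hb : IsLetter n b) (ha : IsLetter n a) (hc : IsLetter n c) (hy : IsLetter n y)
    (hz : IsLetter n z) (e2 : pos n y = 2 * n - pos n a) (e3 : pos n z = pos n a + 1)
    (h1 : pos n c = 2 * n + 1 - pos n a) (h2 : pos n a ≤ n - 1) (h3 : pos n a + 1 ≤ pos n b)
    (h4 : pos n b ≤ 2 * n - pos n a) (h5 : pos n a = n - 1 → pos n b = n + 1) :
    FMatch n i (KnuthRel n) [b, a, c] [b, y, z] := by
  have bb := pos_bound hb
  have ba := pos_bound ha
  rcases letter_cases hi hin hb with
    ⟨pb, eb, u, hu, lu, pu, xb⟩ | ⟨pb, eb, hu, xb⟩ | ⟨pb, eb, hu, xb⟩ <;>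
  rcases letter_cases hi hin ha with
    ⟨pa, ea, v, hv, lv, pv, xa⟩ | ⟨pa, ea, hv, xa⟩ | ⟨pa, ea, hv, xa⟩ <;>
  rcases letter_cases hi hin hc with
    ⟨pc, ec, w, hw, lw, pw, xc⟩ | ⟨pc, ec, hw, xc⟩ | ⟨pc, ec, hw, xc⟩ <;>
  try (exfalso; grind)
  all_goals
    rcases letter_cases hi hin hy with
      ⟨py, ey, y', hy', ly, py', xy⟩ | ⟨py, ey, hy', xy⟩ | ⟨py, ey, hy', xy⟩ <;>
    rcases letter_cases hi hin hz with
      ⟨pz, ez, z', hz', lz, pz', xz⟩ | ⟨pz, ez, hz', xz⟩ | ⟨pz, ez, hz', xz⟩ <;>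
    try (exfalso; grind)
  all_goals
    refine ⟨?_, ?_⟩ <;>
    simp only [wordF, wordPhiEps, pa, ea, pb, eb, pc, ec, py, ey, pz, ez, hu, hv, hw, hy', hz',
      Option.map_some, Option.map_none] <;>
    clear pa ea pb eb pc ec py ey pz ez hu hv hw hy' hz' <;>
    first
    | exact .none
    | (refine .some (.of (Or.inl ⟨?_, ?_, ?_, ?_, ?_, ?_, ?_⟩)) <;> grind)
    | (refine .some (.of (Or.inr (Or.inl ⟨?_, ?_, ?_, ?_, ?_, ?_, ?_, ?_⟩))) <;> grind)

theorem fMatch_fifth {n i : ℕ} (hi : 1 ≤ i) (hin : i < n) {b a c x y : ℤ}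
    (hb : IsLetter n b) (ha : IsLetter n a) (hc : IsLetter n c) (hx : IsLetter n x)
    (hy : IsLetter n y) (e2 : pos n x = pos n a - 1) (e3 : pos n y = 2 * n + 2 - pos n a)
    (h1 : pos n b = 2 * n + 1 - pos n a) (h2 : pos n a ≤ n) (h3 : pos n a ≤ pos n c)
    (h4 : pos n c ≤ 2 * n + 1 - pos n a) (h5 : pos n a = n → pos n c = n) :
    FMatch n i (KnuthRel n) [b, a, c] [x, y, c] := by
  have bx := pos_bound hx
  have bc := pos_bound hc
  rcases letter_cases hi hin hb with
    ⟨pb, eb, u, hu, lu, pu, xb⟩ | ⟨pb, eb, hu, xb⟩ | ⟨pb, eb, hu, xb⟩ <;>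
  rcases letter_cases hi hin ha with
    ⟨pa, ea, v, hv, lv, pv, xa⟩ | ⟨pa, ea, hv, xa⟩ | ⟨pa, ea, hv, xa⟩ <;>
  rcases letter_cases hi hin hc with
    ⟨pc, ec, w, hw, lw, pw, xc⟩ | ⟨pc, ec, hw, xc⟩ | ⟨pc, ec, hw, xc⟩ <;>
  try (exfalso; grind)
  all_goals
    rcases letter_cases hi hin hy with
      ⟨py, ey, y', hy', ly, py', xy⟩ | ⟨py, ey, hy', xy⟩ | ⟨py, ey, hy', xy⟩ <;>
    rcases letter_cases hi hin hx with
      ⟨px, ex, x', hx', lx, px', xx⟩ | ⟨px, ex, hx', xx⟩ | ⟨px, ex, hx', xx⟩ <;>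
    try (exfalso; grind)
  all_goals
    refine ⟨?_, ?_⟩ <;>
    simp only [wordF, wordPhiEps, pa, ea, pb, eb, pc, ec, py, ey, px, ex, hu, hv, hw, hy', hx',
      Option.map_some, Option.map_none] <;>
    clear pa ea pb eb pc ec py ey px ex hu hv hw hy' hx' <;>
    first
    | exact .none
    | (refine .some (.of (Or.inr (Or.inr (Or.inr (Or.inl
        ⟨?_, ?_, ?_, ?_, ?_, ?_, ?_, ?_⟩))))) <;> grind)
    | (refine .some (.of (Or.inr (Or.inr (Or.inr (Or.inr (Or.inl
        ⟨?_, ?_, ?_, ?_, ?_, ?_, ?_, ?_⟩)))))) <;> grind)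

theorem fMatch_third {n i : ℕ} (hi : 1 ≤ i) (hin : i < n) {b a c z : ℤ}
    (hb : IsLetter n b) (ha : IsLetter n a) (hc : IsLetter n c) (hz : IsLetter n z)
    (e1 : pos n b = n) (e2 : pos n a = n - 1) (e3 : pos n c = n + 2) (e4 : pos n z = n + 1) :
    FMatch n i (KnuthRel n) [b, a, c] [b, b, z] := by
  rcases letter_cases hi hin hb with
    ⟨pb, eb, u, hu, lu, pu, xb⟩ | ⟨pb, eb, hu, xb⟩ | ⟨pb, eb, hu, xb⟩ <;>
  rcases letter_cases hi hin ha with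
    ⟨pa, ea, v, hv, lv, pv, xa⟩ | ⟨pa, ea, hv, xa⟩ | ⟨pa, ea, hv, xa⟩ <;>
  rcases letter_cases hi hin hc with
    ⟨pc, ec, w, hw, lw, pw, xc⟩ | ⟨pc, ec, hw, xc⟩ | ⟨pc, ec, hw, xc⟩ <;>
  rcases letter_cases hi hin hz with
    ⟨pz, ez, z', hz', lz, pz', xz⟩ | ⟨pz, ez, hz', xz⟩ | ⟨pz, ez, hz', xz⟩ <;>
  try (exfalso; grind)
  all_goals
    refine ⟨?_, ?_⟩ <;>
    simp only [wordF, wordPhiEps, pa, ea, pb, eb, pc, ec, pz, ez, hu, hv, hw, hz',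
      Option.map_some, Option.map_none] <;>
    clear pa ea pb eb pc ec pz ez hu hv hw hz' <;>
    exact .none

theorem fMatch_sixth {n i : ℕ} (hi : 1 ≤ i) (hin : i < n) {b a x y : ℤ}
    (hb : IsLetter n b) (ha : IsLetter n a) (hx : IsLetter n x) (hy : IsLetter n y)
    (e1 : pos n b = n) (e2 : pos n a = n + 1) (e3 : pos n x = n - 1) (e4 : pos n y = n + 2) :
    FMatch n i (KnuthRel n) [b, a, a] [x, y, a] := by
  rcases letter_cases hi hin hb with
    ⟨pb, eb, u, hu, lu, pu, xb⟩ | ⟨pb, eb, hu, xb⟩ | ⟨pb, eb, hu, xb⟩ <;>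
  rcases letter_cases hi hin ha with
    ⟨pa, ea, v, hv, lv, pv, xa⟩ | ⟨pa, ea, hv, xa⟩ | ⟨pa, ea, hv, xa⟩ <;>
  rcases letter_cases hi hin hx with
    ⟨pc, ec, w, hw, lw, pw, xc⟩ | ⟨pc, ec, hw, xc⟩ | ⟨pc, ec, hw, xc⟩ <;>
  rcases letter_cases hi hin hy with
    ⟨pz, ez, z', hz', lz, pz', xz⟩ | ⟨pz, ez, hz', xz⟩ | ⟨pz, ez, hz', xz⟩ <;>
  try (exfalso; grind)
  all_goals
    refine ⟨?_, ?_⟩ <;>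
    simp only [wordF, wordPhiEps, pa, ea, pb, eb, pc, ec, pz, ez, hu, hv, hw, hz',
      Option.map_some, Option.map_none] <;>
    clear pa ea pb eb pc ec pz ez hu hv hw hz' <;>
    first
    | exact .none
    | (refine .some (.of (Or.inl ⟨?_, ?_, ?_, ?_, ?_, ?_, ?_⟩)) <;> grind)

/-- The arrows of the colours `1, …, n - 1` respect the plactic relations. -/
theorem KnuthRel.fMatch {n i : ℕ} (hi : 1 ≤ i) (hin : i < n) {v w : List ℤ}
    (h : KnuthRel n v w) : FMatch n i (KnuthRel n) v w := by
  obtain ⟨b, a, c, x, y, z, rfl, rfl, hb, ha, hc, hx, hy, hz, h⟩ := h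
  obtain ⟨e1, e2, e3, h⟩ | ⟨e1, e2, e3, h⟩ | ⟨e1, e2, e3, h⟩ | ⟨e1, e2, e3, h⟩ | ⟨e1, e2, e3, h⟩ |
    ⟨e1, e2, e3, h⟩ := h
  · obtain rfl := pos_inj hx hb e1
    obtain rfl := pos_inj hy hc e2
    obtain rfl := pos_inj hz ha e3
    exact fMatch_first hi hin hb ha hc h.1 h.2.1 h.2.2.1 h.2.2.2
  · obtain rfl := pos_inj hx hb e1
    exact fMatch_second hi hin hb ha hc hy hz e2 e3 h.1 h.2.1 h.2.2.1 h.2.2.2.1 h.2.2.2.2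
  · obtain rfl := pos_inj hx hb (e1.trans h.1.symm)
    obtain rfl := pos_inj hy hb (e2.trans h.1.symm)
    exact fMatch_third hi hin hb ha hc hz h.1 h.2.1 h.2.2 e3
  · obtain rfl := pos_inj hx ha e1
    obtain rfl := pos_inj hy hb e2
    obtain rfl := pos_inj hz hc e3
    exact fMatch_fourth hi hin hb ha hc h.1 h.2.1 h.2.2.1 h.2.2.2.1 h.2.2.2.2
  · obtain rfl := pos_inj hz hc e3
    exact fMatch_fifth hi hin hb ha hc hx hy e1 e2 h.1 h.2.1 h.2.2.1 h.2.2.2.1 h.2.2.2.2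
  · obtain rfl := pos_inj hz ha (e3.trans h.2.1.symm)
    obtain rfl := pos_inj hc ha (h.2.2.trans h.2.1.symm)
    exact fMatch_sixth hi hin hb ha hx hy h.1 h.2.1 e1 e2

/-! ### The plactic congruence -/

section

/-- A relation between words that is compatible with all crystal operators of the colours
`c, …, n`. -/
def IsBisim (n c : ℕ) (Q : List ℤ → List ℤ → Prop) : Prop :=
  ∀ x y, Q x y → ∀ i, c ≤ i → i ≤ n → wordPhiEps n i x = wordPhiEps n i y ∧
    Option.Rel Q (wordF n i x) (wordF n i y) ∧ Option.Rel Q (wordE n i x) (wordE n i y)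

/-- The plactic congruence for the colours `c, …, n`: the connected components of the two words
are isomorphic under a map that takes the one word to the other. -/
def Plactic (n c : ℕ) (x y : List ℤ) : Prop := ∃ Q, IsBisim n c Q ∧ Q x y

variable {n c : ℕ}

theorem optionRel_mono {α : Type} {Q R : α → α → Prop} (h : ∀ x y, Q x y → R x y)
    {a b : Option α} (hab : Option.Rel Q a b) : Option.Rel R a b := by
  cases hab with
  | none => exact .none
  | some hab => exact .some (h _ _ hab)

theorem isBisim_plactic (n c : ℕ) : IsBisim n c (Plactic n c) := by
  rintro x y ⟨Q, hQ, hxy⟩ i hi hin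
  obtain ⟨h1, h2, h3⟩ := hQ x y hxy i hi hin
  exact ⟨h1, optionRel_mono (fun a b h => ⟨Q, hQ, h⟩) h2,
    optionRel_mono (fun a b h => ⟨Q, hQ, h⟩) h3⟩

theorem Plactic.phiEps {x y : List ℤ} (h : Plactic n c x y) {i : ℕ} (hi : c ≤ i) (hin : i ≤ n) :
    wordPhiEps n i x = wordPhiEps n i y := (isBisim_plactic n c x y h i hi hin).1

theorem Plactic.wordF {x y : List ℤ} (h : Plactic n c x y) {i : ℕ} (hi : c ≤ i) (hin : i ≤ n) :
    Option.Rel (Plactic n c) (wordF n i x) (wordF n i y) :=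
  (isBisim_plactic n c x y h i hi hin).2.1

theorem Plactic.wordE {x y : List ℤ} (h : Plactic n c x y) {i : ℕ} (hi : c ≤ i) (hin : i ≤ n) :
    Option.Rel (Plactic n c) (wordE n i x) (wordE n i y) :=
  (isBisim_plactic n c x y h i hi hin).2.2

theorem Plactic.exists_wordF {x y x' : List ℤ} (h : Plactic n c x y) {i : ℕ} (hi : c ≤ i)
    (hin : i ≤ n) (hx : KR.wordF n i x = some x') :
    ∃ y', KR.wordF n i y = some y' ∧ Plactic n c x' y' := by
  have := h.wordF hi hin
  rw [hx] at this
  generalize KR.wordF n i y = o at *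
  cases this with
  | some h => exact ⟨_, rfl, h⟩

theorem Plactic.exists_wordE {x y x' : List ℤ} (h : Plactic n c x y) {i : ℕ} (hi : c ≤ i)
    (hin : i ≤ n) (hx : KR.wordE n i x = some x') :
    ∃ y', KR.wordE n i y = some y' ∧ Plactic n c x' y' := by
  have := h.wordE hi hin
  rw [hx] at this
  generalize KR.wordE n i y = o at *
  cases this with
  | some h => exact ⟨_, rfl, h⟩

theorem optionRel_refl {α : Type} (a : Option α) : Option.Rel (· = ·) a a := by
  cases a with
  | none => exact .none
  | some a => exact .some rfl

theorem optionRel_symm {α : Type} {Q : α → α → Prop} {a b : Option α} (h : Option.Rel Q a b) :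
    Option.Rel (fun x y => Q y x) b a := by
  cases h with
  | none => exact .none
  | some h => exact .some h

theorem optionRel_trans {α : Type} {Q R : α → α → Prop} {a b d : Option α}
    (h : Option.Rel Q a b) (h' : Option.Rel R b d) :
    Option.Rel (fun x z => ∃ y, Q x y ∧ R y z) a d := by
  cases h with
  | none => cases h' with | none => exact .none
  | some h => cases h' with | some h' => exact .some ⟨_, h, h'⟩

theorem optionRel_map {α : Type} {Q R : α → α → Prop} {f g : α → α} {a b : Option α}
    (h : Option.Rel Q a b) (hfg : ∀ x y, Q x y → R (f x) (g y)) :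
    Option.Rel R (a.map f) (b.map g) := by
  cases h with
  | none => exact .none
  | some h => exact .some (hfg _ _ h)

theorem Plactic.refl (x : List ℤ) : Plactic n c x x :=
  ⟨(· = ·), by rintro x _ rfl i _ _; exact ⟨rfl, optionRel_refl _, optionRel_refl _⟩, rfl⟩

theorem Plactic.symm {x y : List ℤ} (h : Plactic n c x y) : Plactic n c y x :=
  ⟨fun a b => Plactic n c b a, fun _ _ hab _ hi hin =>
    ⟨(hab.phiEps hi hin).symm, optionRel_symm (hab.wordF hi hin), optionRel_symm (hab.wordE hi hin)⟩,
    h⟩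

theorem Plactic.trans {x y z : List ℤ} (h : Plactic n c x y) (h' : Plactic n c y z) :
    Plactic n c x z :=
  ⟨fun a d => ∃ b, Plactic n c a b ∧ Plactic n c b d, fun _ _ ⟨_, hab, hbd⟩ _ hi hin =>
    ⟨(hab.phiEps hi hin).trans (hbd.phiEps hi hin),
      optionRel_trans (hab.wordF hi hin) (hbd.wordF hi hin),
      optionRel_trans (hab.wordE hi hin) (hbd.wordE hi hin)⟩, y, h, h'⟩

theorem Plactic.mono {c' : ℕ} (hc : c ≤ c') {x y : List ℤ} (h : Plactic n c x y) :
    Plactic n c' x y :=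
  ⟨Plactic n c, fun a b hab i hi hin => isBisim_plactic n c a b hab i (hc.trans hi) hin, h⟩

theorem Plactic.append {u u' v v' : List ℤ} (hu : Plactic n c u u') (hv : Plactic n c v v') :
    Plactic n c (u ++ v) (u' ++ v') := by
  refine ⟨fun x y => ∃ u u' v v', Plactic n c u u' ∧ Plactic n c v v' ∧ x = u ++ v ∧ y = u' ++ v',
    ?_, u, u', v, v', hu, hv, rfl, rfl⟩
  rintro _ _ ⟨u, u', v, v', hu, hv, rfl, rfl⟩ i hi hin
  refine ⟨?_, ?_, ?_⟩
  · rw [wordPhiEps_append, wordPhiEps_append, hu.phiEps hi hin, hv.phiEps hi hin]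
  · rw [wordF_append, wordF_append, hu.phiEps hi hin, hv.phiEps hi hin]
    split_ifs
    · exact optionRel_map (hu.wordF hi hin) fun x y h => ⟨x, y, v, v', h, hv, rfl, rfl⟩
    · exact optionRel_map (hv.wordF hi hin) fun x y h => ⟨u, u', x, y, hu, h, rfl, rfl⟩
  · rw [wordE_append, wordE_append, hu.phiEps hi hin, hv.phiEps hi hin]
    split_ifs
    · exact optionRel_map (hu.wordE hi hin) fun x y h => ⟨x, y, v, v', h, hv, rfl, rfl⟩
    · exact optionRel_map (hv.wordE hi hin) fun x y h => ⟨u, u', x, y, hu, h, rfl, rfl⟩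

theorem Plactic.cons (x : ℤ) {v v' : List ℤ} (hv : Plactic n c v v') :
    Plactic n c (x :: v) (x :: v') := (Plactic.refl [x]).append hv

/-- The arrows of all colours respect the plactic relations. -/
theorem KnuthRel.fMatch_of_le {i : ℕ} (hn : 2 ≤ n) (hi : 1 ≤ i) (hin : i ≤ n) {v w : List ℤ}
    (h : KnuthRel n v w) : FMatch n i (KnuthRel n) v w := by
  rcases hin.lt_or_eq with hlt | rfl
  · exact h.fMatch hi hlt
  · have hs : ∀ w : List ℤ, w = (w.map (swapLetter i)).map (swapLetter i) := fun w => by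
      simp [Function.comp_def, swapLetter_swapLetter]
    obtain ⟨h1, h2⟩ := h.swap.fMatch (i := i - 1) (by omega) (by omega)
    refine ⟨?_, ?_⟩
    · rw [hs v, hs w, wordPhiEps_swap hn, wordPhiEps_swap hn, h1]
    · rw [hs v, hs w, wordF_swap hn, wordF_swap hn]
      exact optionRel_map h2 fun x y h => h.swap

theorem KnuthRel.plactic (hn : 2 ≤ n) {v w : List ℤ} (h : KnuthRel n v w) : Plactic n 1 v w := by
  refine ⟨KnuthRel n, fun x y h i hi hin => ⟨(h.fMatch_of_le hn hi hin).1,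
    (h.fMatch_of_le hn hi hin).2, ?_⟩, h⟩
  have := optionRel_symm (h.dual.fMatch_of_le hn hi hin).2
  rw [wordF_dual, wordF_dual] at this
  generalize KR.wordE n i x = a at *
  generalize KR.wordE n i y = b at *
  cases a with
  | none => cases b with
    | none => exact .none
    | some b => cases this
  | some a => cases b with
    | none => cases this
    | some b => cases this with
      | some h => exact .some (by simpa only [dual_dual] using h.dual)

/-- A word that is killed by all operators is plactically trivial. -/
theorem plactic_nil {x : List ℤ} (h : ∀ i, c ≤ i → i ≤ n → wordPhiEps n i x = (0, 0)) :
    Plactic n c x [] := by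
  refine ⟨fun a b => a = x ∧ b = [], ?_, rfl, rfl⟩
  rintro a _ ⟨ha, rfl⟩ i hi hin
  obtain rfl := ha
  have h0 := h i hi hin
  have hF := (wordF_eq_none_iff n i a).2 (by rw [h0])
  have hE := (wordE_eq_none_iff n i a).2 (by rw [h0])
  rw [h0, hF, hE]
  exact ⟨rfl, .none, .none⟩

theorem wordPhiEps_singleton (n i : ℕ) (x : ℤ) :
    wordPhiEps n i [x] = (letterPhi n i x, letterEps n i x) := by simp [wordPhiEps]

theorem letterPhi_eq_zero_of_lt {i : ℕ} {x : ℤ} (h1 : |x| < i)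
    (h2 : |x| < (n : ℤ) - 1) : letterPhi n i x = 0 := by
  rw [letterPhi_eq, if_neg]
  rw [abs_lt] at h1 h2
  omega

theorem letterEps_eq_zero_of_lt {i : ℕ} {x : ℤ} (h1 : |x| < i)
    (h2 : |x| < (n : ℤ) - 1) : letterEps n i x = 0 := by
  rw [letterEps_eq, if_neg]
  rw [abs_lt] at h1 h2
  omega

/-- For the colours `2, …, n` the letters `1` and `1̄` do not matter. -/
theorem plactic_one {x : ℤ} (hn : 3 ≤ n) (hx : |x| = 1) : Plactic n 2 [x] [] := by
  refine plactic_nil fun i hi hin => ?_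
  rw [wordPhiEps_singleton, letterPhi_eq_zero_of_lt (by omega) (by omega),
    letterEps_eq_zero_of_lt (by omega) (by omega)]

/-- For the colours `2, …, n` the letters `2` and `2̄` are contracted. -/
theorem plactic_two (hn : 4 ≤ n) : Plactic n 2 [-2, 2] [] := by
  refine plactic_nil fun i hi hin => ?_
  rcases hi.lt_or_eq with hi | rfl
  · simp only [wordPhiEps]
    rw [letterPhi_eq_zero_of_lt (by simp; omega) (by simp; omega),
      letterEps_eq_zero_of_lt (by simp; omega) (by simp; omega),
      letterPhi_eq_zero_of_lt (by simp; omega) (by simp; omega),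
      letterEps_eq_zero_of_lt (by simp; omega) (by simp; omega)]
  · simp only [wordPhiEps, letterPhi_eq, letterEps_eq]
    grind

theorem Plactic.wordWt_eq (hn : 3 ≤ n) {x y : List ℤ} (h : Plactic n 2 x y) {i : ℕ} (hi : 2 ≤ i)
    (hin : i ≤ n) : wordWt i x = wordWt i y := by
  have hlast : wordWt n x = wordWt n y := by
    have h1 := phi_sub_eps_last (n := n) (by omega) x
    have h2 := phi_sub_eps_last (n := n) (by omega) y
    have h3 := phi_sub_eps_of_lt (n := n) (i := n - 1) (by omega) (by omega) x
    have h4 := phi_sub_eps_of_lt (n := n) (i := n - 1) (by omega) (by omega) y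
    rw [h.phiEps (by omega) le_rfl] at h1
    rw [h.phiEps (by omega) (by omega)] at h3
    rw [Nat.sub_add_cancel (by omega)] at h3 h4
    omega
  induction hk : n - i generalizing i with
  | zero => rw [show i = n by omega]; exact hlast
  | succ k ih =>
    have h1 := phi_sub_eps_of_lt (n := n) (i := i) (by omega) (by omega) x
    have h2 := phi_sub_eps_of_lt (n := n) (i := i) (by omega) (by omega) y
    have h3 := ih (i := i + 1) (by omega) (by omega) (by omega)
    rw [h.phiEps (by omega) (by omega)] at h1
    omega

end

/-! ### Highest weight tableaux for the colours `2, …, n` -/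

/-- `InnerHW A B C D d E t` says that `t` consists of `A` columns `1 2`, `B` columns `1 3`, `C`
columns `1 2̄`, `D` columns `2 3`, `d` columns `2 2̄` and `E` columns `2 1̄`, in this order, under the
conditions `C D = 0`, `D d = 0`, `d ≤ 1` and `B + C ≤ E`. These are the highest weight tableaux for
the colours `2, …, n`. -/
inductive InnerHW : ℕ → ℕ → ℕ → ℕ → ℕ → ℕ → Tab → Prop
  | nil : InnerHW 0 0 0 0 0 0 []
  | col21 {E : ℕ} {t : Tab} : InnerHW 0 0 0 0 0 E t → InnerHW 0 0 0 0 0 (E + 1) ((2, -1) :: t)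
  | col22 {E : ℕ} {t : Tab} : InnerHW 0 0 0 0 0 E t → InnerHW 0 0 0 0 1 E ((2, -2) :: t)
  | col23 {D E : ℕ} {t : Tab} : InnerHW 0 0 0 D 0 E t → InnerHW 0 0 0 (D + 1) 0 E ((2, 3) :: t)
  | col12' {C d E : ℕ} {t : Tab} : C < E → InnerHW 0 0 C 0 d E t →
      InnerHW 0 0 (C + 1) 0 d E ((1, -2) :: t)
  | col13 {B C D d E : ℕ} {t : Tab} : B + C < E → InnerHW 0 B C D d E t →
      InnerHW 0 (B + 1) C D d E ((1, 3) :: t)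
  | col12 {A B C D d E : ℕ} {t : Tab} : InnerHW A B C D d E t →
      InnerHW (A + 1) B C D d E ((1, 2) :: t)

theorem wordWt_nil (i : ℕ) : wordWt i [] = 0 := by simp [wordWt]

namespace InnerHW

variable {n A B C D d E : ℕ} {t : Tab}

theorem conditions (h : InnerHW A B C D d E t) :
    (C = 0 ∨ D = 0) ∧ (D = 0 ∨ d = 0) ∧ d ≤ 1 ∧ B + C ≤ E := by
  induction h <;> omega

theorem length_eq (h : InnerHW A B C D d E t) : t.length = A + B + C + D + d + E := by
  induction h <;> simp only [List.length_cons, List.length_nil] <;> omega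

/-- The tableau is determined by the numbers of its columns. -/
theorem eq_replicate (h : InnerHW A B C D d E t) :
    t = List.replicate A (1, 2) ++ (List.replicate B (1, 3) ++ (List.replicate C (1, -2) ++
      (List.replicate D (2, 3) ++ (List.replicate d (2, -2) ++ List.replicate E (2, -1))))) := by
  induction h with
  | nil => rfl
  | col21 _ ih | col22 _ ih | col23 _ ih | col12 _ ih => simpa [List.replicate_succ] using ih
  | col12' _ _ ih | col13 _ _ ih => simpa [List.replicate_succ] using ih

/-- The conditions on the numbers of the columns are also sufficient. -/
theorem exists_of_conditions (h1 : C = 0 ∨ D = 0) (h2 : D = 0 ∨ d = 0) (h3 : d ≤ 1)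
    (h4 : B + C ≤ E) : ∃ t, InnerHW A B C D d E t := by
  have e1 : ∀ E, ∃ t, InnerHW 0 0 0 0 0 E t := fun E => by
    induction E with
    | zero => exact ⟨_, nil⟩
    | succ E ih => exact ⟨_, col21 ih.choose_spec⟩
  have e2 : ∃ t, InnerHW 0 0 0 D d E t := by
    rcases Nat.eq_zero_or_pos d with rfl | hd
    · clear h1 h2 h3 h4
      induction D with
      | zero => exact e1 E
      | succ D ih => exact ⟨_, col23 ih.choose_spec⟩
    · obtain rfl : d = 1 := by omega
      obtain rfl : D = 0 := by omega
      exact ⟨_, col22 (e1 E).choose_spec⟩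
  have e3 : ∃ t, InnerHW 0 0 C D d E t := by
    rcases Nat.eq_zero_or_pos C with rfl | hC
    · exact e2
    · obtain rfl : D = 0 := by omega
      have h5 : C ≤ E := by omega
      clear h4 h1 hC
      induction C with
      | zero => exact e2
      | succ C ih => exact ⟨_, col12' (by omega) (ih (by omega)).choose_spec⟩
  have e4 : ∃ t, InnerHW 0 B C D d E t := by
    induction B with
    | zero => exact e3
    | succ B ih => exact ⟨_, col13 (by omega) (ih (by omega)).choose_spec⟩
  induction A with
  | zero => exact e4
  | succ A ih => exact ⟨_, col12 ih.choose_spec⟩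

theorem wordWt_one (h : InnerHW A B C D d E t) : wordWt 1 (word t) = A + B + C - E := by
  induction h <;> simp only [word, wordWt_cons, wordWt_nil] <;> norm_num <;> omega

theorem wordWt_two (h : InnerHW A B C D d E t) : wordWt 2 (word t) = A + D + E - C := by
  induction h <;> simp only [word, wordWt_cons, wordWt_nil] <;> norm_num <;> omega

theorem wordWt_three (h : InnerHW A B C D d E t) : wordWt 3 (word t) = B + D := by
  induction h <;> simp only [word, wordWt_cons, wordWt_nil] <;> norm_num <;> omega

end InnerHW

/-- The colour `2` as seen by the letters `1, 2, 3, 2̄, 1̄`. -/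
theorem letters_two {n : ℕ} (hn : 4 ≤ n) :
    (letterPhi n 2 1 = 0 ∧ letterEps n 2 1 = 0) ∧ (letterPhi n 2 2 = 1 ∧ letterEps n 2 2 = 0) ∧
    (letterPhi n 2 3 = 0 ∧ letterEps n 2 3 = 1) ∧
    (letterPhi n 2 (-2) = 0 ∧ letterEps n 2 (-2) = 1) ∧
    (letterPhi n 2 (-1) = 0 ∧ letterEps n 2 (-1) = 0) := by
  simp only [letterPhi_eq, letterEps_eq]
  refine ⟨⟨?_, ?_⟩, ⟨?_, ?_⟩, ⟨?_, ?_⟩, ⟨?_, ?_⟩, ⟨?_, ?_⟩⟩ <;>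
    first | exact if_pos (by omega) | exact if_neg (by omega)

theorem letterPhi_small {n i : ℕ} (hn : 4 ≤ n) (hi : 3 ≤ i) {x : ℤ} (h0 : |x| ≤ 2) :
    letterPhi n i x = 0 :=
  letterPhi_eq_zero_of_lt (by omega) (by omega)

/-- Only the letters `1, 2, 3, 2̄, 1̄` have no `ε_i` for `i ≥ 3`. -/
theorem exists_letterEps {n : ℕ} (hn : 4 ≤ n) {x : ℤ} (hx : x ≠ 0 ∧ -(n : ℤ) ≤ x ∧ x ≤ n) :
    (x = 1 ∨ x = -1 ∨ x = 2 ∨ x = -2 ∨ x = 3) ∨ ∃ i, 3 ≤ i ∧ i ≤ n ∧ letterEps n i x = 1 := by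
  by_cases h : x = 1 ∨ x = -1 ∨ x = 2 ∨ x = -2 ∨ x = 3
  · exact Or.inl h
  · refine Or.inr ?_
    rcases lt_or_ge 0 x with h0 | h0
    · refine ⟨(x - 1).toNat, by omega, by omega, ?_⟩
      rw [letterEps_eq, if_pos (by omega)]
    · refine ⟨(-x).toNat, by omega, by omega, ?_⟩
      rw [letterEps_eq, if_pos (by omega)]

namespace InnerHW

variable {n A B C D d E : ℕ} {t : Tab}

theorem phiEps_two (hn : 4 ≤ n) (h : InnerHW A B C D d E t) :
    wordPhiEps n 2 (word t) = (A + E - B - C, 0) := by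
  obtain ⟨⟨p1, e1⟩, ⟨p2, e2⟩, ⟨p3, e3⟩, ⟨p4, e4⟩, ⟨p5, e5⟩⟩ := letters_two hn
  have hc := h.conditions
  induction h with
  | nil => rfl
  | col21 h ih | col22 h ih | col23 h ih | col12 h ih =>
    simp only [word, wordPhiEps, ih h.conditions, p1, p2, p3, p4, p5, e1, e2, e3, e4, e5,
      Prod.mk.injEq]
    omega
  | col12' _ h ih | col13 _ h ih =>
    simp only [word, wordPhiEps, ih h.conditions, p1, p3, p4, e1, e3, e4, Prod.mk.injEq]
    omega

theorem phi_eq_zero (hn : 4 ≤ n) (h : InnerHW A B C D d E t) (hBD : B + D = 0) {i : ℕ}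
    (hi : 3 ≤ i) : (wordPhiEps n i (word t)).1 = 0 := by
  have s : ∀ x : ℤ, |x| ≤ 2 → letterPhi n i x = 0 := fun x => letterPhi_small hn hi
  induction h with
  | nil => rfl
  | col21 h ih | col22 h ih | col12 h ih =>
    simp only [word, wordPhiEps, ih (by omega)]
    rw [s _ (by norm_num), s _ (by norm_num)]
    simp
  | col12' _ h ih =>
    simp only [word, wordPhiEps, ih (by omega)]
    rw [s _ (by norm_num), s _ (by norm_num)]
    simp
  | col13 | col23 => omega

theorem kNTab (hn : 4 ≤ n) (h : InnerHW A B C D d E t) : KNTab n t := by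
  have hcol : ∀ a b : ℤ, (a = 1 ∧ (b = 2 ∨ b = 3 ∨ b = -2)) ∨
      (a = 2 ∧ (b = 3 ∨ b = -2 ∨ b = -1)) → ColOK n (a, b) := by
    intro a b h; simp only [ColOK, Le, Lt]; omega
  have hadj : ∀ a b c d : ℤ, (a = 1 ∨ a = 2) → (b = 2 ∨ b = 3 ∨ b = -2 ∨ b = -1) →
      (c = 1 ∨ c = 2) → (d = 2 ∨ d = 3 ∨ d = -2 ∨ d = -1) → a ≤ c → pos n b ≤ pos n d →
      ¬ (a = c ∧ d = -c) → ¬ (b = -a ∧ d = b) → Adj n (a, b) (c, d) := by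
    intro a b c d ha hb hc hd h1 h2 h3 h4
    refine ⟨(le_iff_pos ?_ ?_).2 ?_, (le_iff_pos ?_ ?_).2 ⟨h2, ?_⟩, h3, h4, ?_, ?_⟩ <;>
      simp only [IsLetter, pos] at * <;> omega
  induction h with
  | nil => exact ⟨by simp, List.IsChain.nil⟩
  | col21 h ih | col22 h ih | col23 h ih | col12 h ih =>
    cases h <;> first
    | exact kNTab_singleton.2 (hcol _ _ (by norm_num))
    | exact kNTab_cons_cons.2 ⟨hcol _ _ (by norm_num), hadj _ _ _ _ (by norm_num) (by norm_num)
        (by norm_num) (by norm_num) (by norm_num) (by simp [pos] <;> omega) (by norm_num)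
        (by norm_num), ih⟩
  | col12' hlt h ih | col13 hlt h ih =>
    cases h <;> first
    | omega
    | exact kNTab_cons_cons.2 ⟨hcol _ _ (by norm_num), hadj _ _ _ _ (by norm_num) (by norm_num)
        (by norm_num) (by norm_num) (by norm_num) (by simp [pos] <;> omega) (by norm_num)
        (by norm_num), ih⟩

/-- A highest weight word in normal form: `3 2` repeated `p` times, then `q` letters `2`. -/
def normalWord (p q : ℕ) : List ℤ := (List.replicate p [3, 2]).flatten ++ List.replicate q 2

theorem normalWord_succ (p q : ℕ) : normalWord (p + 1) q = [3, 2] ++ normalWord p q := by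
  simp [normalWord, List.replicate_succ]

theorem plactic_three_normalWord (hn : 4 ≤ n) (p q : ℕ) :
    Plactic n 2 (3 :: normalWord p (q + 1)) (normalWord (p + 1) q) := by
  induction p with
  | zero => exact .refl _
  | succ p ih =>
    have h : KnuthRel n [3, 2, 3] [3, 3, 2] := by
      refine .of (Or.inl ?_) ?_ ?_ ?_ ?_ ?_ ?_ <;> simp only [IsLetter, pos] <;> norm_num <;> omega
    have h' := ((h.plactic (by omega)).symm.mono one_le_two).append (.refl (normalWord p (q + 1)))
    rw [normalWord_succ, normalWord_succ]
    exact h'.trans ((Plactic.refl [3, 2]).append ih)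

theorem plactic_two_normalWord (hn : 4 ≤ n) (p q : ℕ) :
    Plactic n 2 (2 :: normalWord p q) (normalWord p (q + 1)) := by
  induction p with
  | zero => exact .refl _
  | succ p ih =>
    have h : KnuthRel n [3, 2, 2] [2, 3, 2] := by
      refine .of (Or.inr (Or.inr (Or.inr (Or.inl ?_)))) ?_ ?_ ?_ ?_ ?_ ?_ <;>
        simp only [IsLetter, pos] <;> norm_num <;> omega
    have h' := ((h.plactic (by omega)).symm.mono one_le_two).append (.refl (normalWord p q))
    rw [normalWord_succ, normalWord_succ]
    exact h'.trans ((Plactic.refl [3, 2]).append ih)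

/-- The normal form of a highest weight word depends on its weight for the letters `2` and `3` only:
the letters `1`, `1̄` do not matter, and the pairs `2̄ 2` are contracted. -/
theorem plactic_normalWord (hn : 4 ≤ n) (h : InnerHW A B C D d E t) :
    Plactic n 2 (word t) (normalWord (B + D) (A + E - B - C)) := by
  have one : ∀ {x : ℤ} {v w : List ℤ}, |x| = 1 → Plactic n 2 v w → Plactic n 2 (x :: v) w :=
    fun hx hv => (plactic_one (by omega) hx).append hv
  induction h with
  | nil => exact .refl _
  | col21 h ih => exact one (by norm_num) (ih.cons 2)
  | col22 h ih => exact (plactic_two hn).append ih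
  | @col23 D E t h ih => exact (Plactic.refl [3, 2]).append ih |>.trans (by
      rw [show 0 + (D + 1) = 0 + D + 1 by omega, normalWord_succ]; exact .refl _)
  | @col12' C d E t hlt h ih =>
    rw [show 0 + E - 0 - C = 0 + E - 0 - (C + 1) + 1 by omega] at ih
    exact ((one (by norm_num) ih).cons (-2)).trans ((plactic_two hn).append (.refl _))
  | @col13 B C D d E t hlt h ih =>
    rw [show 0 + E - B - C = 0 + E - (B + 1) - C + 1 by omega] at ih
    rw [show B + 1 + D = B + D + 1 by omega]
    exact ((one (by norm_num) ih).cons 3).trans (plactic_three_normalWord hn _ _)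
  | @col12 A B C D d E t h ih =>
    have := h.conditions
    rw [show A + 1 + E - B - C = A + E - B - C + 1 by omega]
    exact ((one (by norm_num) ih).cons 2).trans (plactic_two_normalWord hn _ _)

end InnerHW

/-- Every highest weight tableau for the colours `2, …, n` has the described form. -/
theorem exists_innerHW {n : ℕ} (hn : 4 ≤ n) {t : Tab} (ht : KNTab n t)
    (h : ∀ i, 2 ≤ i → i ≤ n → (wordPhiEps n i (word t)).2 = 0) :
    ∃ A B C D d E, InnerHW A B C D d E t := by
  induction t with
  | nil => exact ⟨_, _, _, _, _, _, .nil⟩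
  | cons c t ih =>
    obtain ⟨a, b⟩ := c
    have hc : ColOK n (a, b) := ht.1 _ List.mem_cons_self
    simp only [word, wordPhiEps] at h
    obtain ⟨A, B, C, D, d, E, ht'⟩ := ih ht.of_cons fun i hi hin => by have := h i hi hin; omega
    obtain ⟨⟨p1, e1⟩, ⟨p2, e2⟩, ⟨p3, e3⟩, ⟨p4, e4⟩, ⟨p5, e5⟩⟩ := letters_two hn
    have hA := ht'.conditions
    have h2 := h 2 le_rfl (by omega)
    rw [ht'.phiEps_two hn] at h2
    have ha : a = 1 ∨ a = 2 := by
      cases ht' with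
      | nil =>
        rcases exists_letterEps hn hc.1 with ha | ⟨i, hi, hin, ha⟩
        · obtain rfl | rfl | rfl | rfl | rfl : a = 1 ∨ a = -1 ∨ a = 2 ∨ a = -2 ∨ a = 3 := ha
          · exact Or.inl rfl
          · simp only [ColOK, Le, Lt] at hc; omega
          · exact Or.inr rfl
          · simp [e4] at h2
          · simp [e3] at h2
        · have h3 := h i (by omega) hin
          simp [ha, word, wordPhiEps] at h3
      | _ =>
        have := (kNTab_cons_cons.1 ht).2.1.1
        simp only [Le, Lt] at this
        omega
    have hb : b = 2 ∨ b = 3 ∨ b = -2 ∨ b = -1 := by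
      by_cases hBD : B + D = 0
      · rcases exists_letterEps hn hc.2.1 with hb | ⟨i, hi, hin, hb⟩
        · simp only [ColOK, Le, Lt] at hc; omega
        · have h3 := h i (by omega) hin
          rw [ht'.phi_eq_zero hn hBD hi, hb,
            letterPhi_small hn hi (x := a) (by rcases ha with rfl | rfl <;> norm_num)] at h3
          omega
      · simp only [ColOK, Le, Lt] at hc
        cases ht' with
        | col23 | col13 | col12 =>
          have := (kNTab_cons_cons.1 ht).2.1.2.1
          simp only [Le, Lt] at this
          omega
        | _ => omega
    have hh := ht'
    replace hc := hc.2.2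
    cases ht' with
    | nil =>
      rcases ha with rfl | rfl <;> rcases hb with rfl | rfl | rfl | rfl <;>
        simp only [p1, p2, e1, e2, e3, e4, e5] at h2 <;> first
        | (exfalso; clear hc; omega)
        | (exfalso; norm_num [Le, Lt] at hc; done)
        | exact ⟨_, _, _, _, _, _, .col12 hh⟩
        | exact ⟨_, _, _, _, _, _, .col23 hh⟩
        | exact ⟨_, _, _, _, _, _, .col22 hh⟩
        | exact ⟨_, _, _, _, _, _, .col21 hh⟩
    | _ =>
      have := (kNTab_cons_cons.1 ht).2.1
      rcases ha with rfl | rfl <;> rcases hb with rfl | rfl | rfl | rfl <;>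
        simp only [p1, p2, e1, e2, e3, e4, e5] at h2 <;> first
        | (exfalso; norm_num [Adj, Le, Lt] at this; done)
        | (exfalso; norm_num [Le, Lt] at hc; done)
        | exact ⟨_, _, _, _, _, _, .col12 hh⟩
        | exact ⟨_, _, _, _, _, _, .col13 (by omega) hh⟩
        | exact ⟨_, _, _, _, _, _, .col12' (by omega) hh⟩
        | exact ⟨_, _, _, _, _, _, .col23 hh⟩
        | exact ⟨_, _, _, _, _, _, .col22 hh⟩
        | exact ⟨_, _, _, _, _, _, .col21 hh⟩

/-! ### Positions in the components for the colours `2, …, n` -/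

section

theorem wt_eq_wordWt (i : ℕ) (t : Tab) : wt i t = wordWt i (word t) := rfl

variable {n : ℕ}

theorem isInnerHW_iff {u : Tab} :
    IsInnerHW n u ↔ ∀ i, 2 ≤ i → i ≤ n → (wordPhiEps n i (word u)).2 = 0 := by
  simp only [IsInnerHW, tabE_eq_none_iff]

/-- Every tableau is reached from a highest weight tableau by a path of arrows of the colours
`2, …, n`. -/
theorem KNTab.exists_path (hn : 4 ≤ n) {t : Tab} (ht : KNTab n t) :
    ∃ u w, KNTab n u ∧ u.length = t.length ∧ IsInnerHW n u ∧ (∀ i ∈ w, 2 ≤ i ∧ i ≤ n) ∧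
      applyF n w u = some t := by
  induction hm : ((word t).map (height n)).sum using Nat.strong_induction_on generalizing t with
  | _ m ih =>
    by_cases h : IsInnerHW n t
    · exact ⟨t, [], ht, rfl, h, by simp, rfl⟩
    · simp only [IsInnerHW, not_forall] at h
      obtain ⟨i, hi, hin, h⟩ := h
      obtain ⟨t', hE⟩ := Option.ne_none_iff_exists'.1 h
      obtain ⟨ht', hl, hw⟩ := ht.tabE (by omega) (by omega) hin hE
      have hlt := height_lt_of_wordE (by omega) (by omega) hw
      obtain ⟨u, w, h1, h2, h3, h4, h5⟩ := ih _ (hm ▸ hlt) ht' rfl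
      refine ⟨u, i :: w, h1, h2.trans hl, h3, by simpa using ⟨⟨hi, hin⟩, h4⟩, ?_⟩
      simp only [applyF, h5, Option.bind_some]
      exact tabF_of_wordF (wordF_of_wordE (by omega) (by omega) hw).1

theorem KNTab.applyF (hn : 4 ≤ n) {w : List ℕ} (hw : ∀ i ∈ w, 2 ≤ i ∧ i ≤ n) {u t : Tab}
    (hu : KNTab n u) (h : applyF n w u = some t) :
    KNTab n t ∧ t.length = u.length ∧ wordWt 1 (word t) = wordWt 1 (word u) := by
  induction w generalizing t with
  | nil => simp only [KR.applyF, Option.some.injEq] at h; subst h; exact ⟨hu, rfl, rfl⟩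
  | cons i w ih =>
    obtain ⟨s, hs, hst⟩ := Option.bind_eq_some_iff.1 h
    have hi := hw i (by simp)
    obtain ⟨h1, h2, h3⟩ := ih (fun j hj => hw j (by simp [hj])) hs
    obtain ⟨h4, h5, h6⟩ := h1.tabF (by omega) (by omega) hi.2 hst
    have := wordWt_one_of_wordF (by omega) (by omega) h6
    rw [if_neg (by omega)] at this
    exact ⟨h4, h5.trans h2, by omega⟩

theorem Plactic.applyF (hn : 4 ≤ n) {w : List ℕ} (hw : ∀ i ∈ w, 2 ≤ i ∧ i ≤ n) {u u' t : Tab}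
    (hu : KNTab n u) (hu' : KNTab n u') (huu : Plactic n 2 (word u) (word u'))
    (h : applyF n w u = some t) :
    ∃ t', KR.applyF n w u' = some t' ∧ Plactic n 2 (word t) (word t') := by
  induction w generalizing t with
  | nil => simp only [KR.applyF, Option.some.injEq] at h; subst h; exact ⟨u', rfl, huu⟩
  | cons i w ih =>
    obtain ⟨s, hs, hst⟩ := Option.bind_eq_some_iff.1 h
    have hi := hw i (by simp)
    have hw' : ∀ j ∈ w, 2 ≤ j ∧ j ≤ n := fun j hj => hw j (by simp [hj])
    obtain ⟨s', hs', hss⟩ := ih hw' hs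
    obtain ⟨-, -, h1⟩ := (hu.applyF hn hw' hs).1.tabF (by omega) (by omega) hi.2 hst
    obtain ⟨y, hy, hty⟩ := hss.exists_wordF hi.1 hi.2 h1
    obtain ⟨t', rfl, -⟩ := (hu'.applyF hn hw' hs').1.exists_of_wordF (by omega) (by omega) hi.2 hy
    exact ⟨t', by simp only [KR.applyF, hs', Option.bind_some]; exact tabF_of_wordF hy, hty⟩

/-- Plactically equivalent tableaux have the same paths from the highest weight tableaux. -/
theorem Plactic.exists_applyF (hn : 4 ≤ n) {w : List ℕ} (hw : ∀ i ∈ w, 2 ≤ i ∧ i ≤ n)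
    {u t t' : Tab} (hu : KNTab n u) (ht' : KNTab n t') (h : Plactic n 2 (word t) (word t'))
    (hut : KR.applyF n w u = some t) :
    ∃ u', KNTab n u' ∧ u'.length = t'.length ∧ Plactic n 2 (word u) (word u') ∧
      KR.applyF n w u' = some t' := by
  induction w generalizing t t' with
  | nil => simp only [KR.applyF, Option.some.injEq] at hut; subst hut; exact ⟨t', ht', rfl, h, rfl⟩
  | cons i w ih =>
    obtain ⟨s, hs, hst⟩ := Option.bind_eq_some_iff.1 hut
    have hi := hw i (by simp)
    have hw' : ∀ j ∈ w, 2 ≤ j ∧ j ≤ n := fun j hj => hw j (by simp [hj])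
    obtain ⟨-, -, h1⟩ := (hu.applyF hn hw' hs).1.tabF (by omega) (by omega) hi.2 hst
    obtain ⟨y, hy, hsy⟩ := h.exists_wordE hi.1 hi.2 (wordE_of_wordF (by omega) (by omega) h1).1
    have hE : KR.tabE n i t' = some (unword y) := by rw [KR.tabE, hy]; rfl
    obtain ⟨hs', hl, hE'⟩ := ht'.tabE (by omega) (by omega) hi.2 hE
    rw [hy, Option.some.injEq] at hE'
    obtain ⟨u', h2, h3, h4, h5⟩ := ih hw' hs' (hE' ▸ hsy) hs
    refine ⟨u', h2, h3.trans hl, h4, ?_⟩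
    simp only [KR.applyF, h5, Option.bind_some]
    exact tabF_of_wordF (hE' ▸ (wordF_of_wordE (by omega) (by omega) hy).1)

/-- Highest weight tableaux of the same weight are plactically equivalent. -/
theorem plactic_of_innerHW (hn : 4 ≤ n) {u u' : Tab} (hu : KNTab n u) (hu' : KNTab n u')
    (h : IsInnerHW n u) (h' : IsInnerHW n u') (h2 : wt 2 u = wt 2 u') (h3 : wt 3 u = wt 3 u') :
    Plactic n 2 (word u) (word u') := by
  obtain ⟨A, B, C, D, d, E, hi⟩ := exists_innerHW hn hu (isInnerHW_iff.1 h)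
  obtain ⟨A', B', C', D', d', E', hi'⟩ := exists_innerHW hn hu' (isInnerHW_iff.1 h')
  rw [wt_eq_wordWt, wt_eq_wordWt, hi.wordWt_two, hi'.wordWt_two] at h2
  rw [wt_eq_wordWt, wt_eq_wordWt, hi.wordWt_three, hi'.wordWt_three] at h3
  have := hi.conditions
  have := hi'.conditions
  have p := hi.plactic_normalWord hn
  rw [show B + D = B' + D' by omega, show A + E - B - C = A' + E' - B' - C' by omega] at p
  exact p.trans (hi'.plactic_normalWord hn).symm

/-- Two tableaux are at the same position if and only if their words are plactically equivalent for
the colours `2, …, n`. -/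
theorem samePosition_iff (hn : 4 ≤ n) {k j : ℕ} {t t' : Tab} (ht : IsKN n k t) (ht' : IsKN n j t') :
    SamePosition n k j t t' ↔ Plactic n 2 (word t) (word t') := by
  constructor
  · rintro ⟨u, u', hu, hu', hi, hi', hwt, w, hw, h, h'⟩
    have p := plactic_of_innerHW hn (isKN_iff.1 hu).2 (isKN_iff.1 hu').2 hi hi'
      (hwt 2 le_rfl (by omega)) (hwt 3 (by omega) (by omega))
    obtain ⟨s, hs, p'⟩ := p.applyF hn hw (isKN_iff.1 hu).2 (isKN_iff.1 hu').2 h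
    rw [h', Option.some.injEq] at hs
    exact hs ▸ p'
  · intro h
    obtain ⟨hk, ht⟩ := isKN_iff.1 ht
    obtain ⟨hj, ht'⟩ := isKN_iff.1 ht'
    obtain ⟨u, w, h1, h2, h3, h4, h5⟩ := ht.exists_path hn
    obtain ⟨u', h6, h7, h8, h9⟩ := h.exists_applyF hn h4 h1 ht' h5
    refine ⟨u, u', isKN_iff.2 ⟨h2.trans hk, h1⟩, isKN_iff.2 ⟨h7.trans hj, h6⟩, h3, ?_,
      fun i hi hin => h8.wordWt_eq (by omega) hi hin, w, h4, h5, h9⟩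
    rw [isInnerHW_iff] at h3 ⊢
    intro i hi hin
    rw [← h8.phiEps hi hin]
    exact h3 i hi hin

/-- A tableau is determined by its length, its position and its weight for the letter `1`. -/
theorem KNTab.eq_of_plactic (hn : 4 ≤ n) {t t' : Tab} (ht : KNTab n t) (ht' : KNTab n t')
    (h : Plactic n 2 (word t) (word t')) (hl : t.length = t'.length)
    (hwt : wordWt 1 (word t) = wordWt 1 (word t')) : t = t' := by
  obtain ⟨u, w, h1, h2, h3, h4, h5⟩ := ht.exists_path hn
  obtain ⟨u', h6, h7, h8, h9⟩ := h.exists_applyF hn h4 h1 ht' h5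
  rw [isInnerHW_iff] at h3
  obtain ⟨A, B, C, D, d, E, hi⟩ := exists_innerHW hn h1 h3
  obtain ⟨A', B', C', D', d', E', hi'⟩ := exists_innerHW hn h6 fun i hi hin => by
    rw [← h8.phiEps hi hin]; exact h3 i hi hin
  have e1 := (h1.applyF hn h4 h5).2.2
  have e1' := (h6.applyF hn h4 h9).2.2
  have e2 := h8.wordWt_eq (by omega) le_rfl (by omega)
  have e3 := h8.wordWt_eq (by omega) (i := 3) (by omega) (by omega)
  rw [hi.wordWt_one] at e1
  rw [hi'.wordWt_one] at e1'
  rw [hi.wordWt_two, hi'.wordWt_two] at e2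
  rw [hi.wordWt_three, hi'.wordWt_three] at e3
  have := hi.conditions
  have := hi'.conditions
  have := hi.length_eq
  have := hi'.length_eq
  obtain ⟨rfl, rfl, rfl, rfl, rfl, rfl⟩ :
      A = A' ∧ B = B' ∧ C = C' ∧ D = D' ∧ d = d' ∧ E = E' := by omega
  rw [hi.eq_replicate, ← hi'.eq_replicate, h9, Option.some.injEq] at h5
  exact h5.symm

/-- The symmetry of a classical component that negates the weight for the letter `1`. -/
theorem KNTab.exists_neg (hn : 4 ≤ n) {t : Tab} (ht : KNTab n t) :
    ∃ t', KNTab n t' ∧ t'.length = t.length ∧ Plactic n 2 (word t) (word t') ∧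
      wordWt 1 (word t') = -wordWt 1 (word t) := by
  obtain ⟨u, w, h1, h2, h3, h4, h5⟩ := ht.exists_path hn
  rw [isInnerHW_iff] at h3
  obtain ⟨A, B, C, D, d, E, hi⟩ := exists_innerHW hn h1 h3
  have hc := hi.conditions
  -- `A` and `E - B - C` are exchanged
  obtain ⟨u', hi'⟩ := InnerHW.exists_of_conditions (A := E - B - C) (B := B) (C := C) (D := D)
    (d := d) (E := A + B + C) hc.1 hc.2.1 hc.2.2.1 (by omega)
  have hu' := hi'.kNTab hn
  have p := hi'.plactic_normalWord hn
  rw [show E - B - C + (A + B + C) - B - C = A + E - B - C by omega] at p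
  obtain ⟨t', h6, h7⟩ := ((hi.plactic_normalWord hn).trans p.symm).applyF hn h4 h1 hu' h5
  obtain ⟨h8, h9, h10⟩ := hu'.applyF hn h4 h6
  have e1 := (h1.applyF hn h4 h5).2.2
  rw [hi.wordWt_one] at e1
  rw [hi'.wordWt_one] at h10
  have := hi.length_eq
  have := hi'.length_eq
  exact ⟨t', h8, by omega, h7, by omega⟩

/-! ### The rank in the branching component graph -/

theorem InnerHW.eq_zero_of_eps_one (hn : 4 ≤ n) {A B C D d E : ℕ} {t : Tab}
    (h : InnerHW A B C D d E t) (h1 : (wordPhiEps n 1 (word t)).2 = 0) :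
    B = 0 ∧ C = 0 ∧ D = 0 ∧ d = 0 ∧ E = 0 := by
  have e2 : letterEps n 1 2 = 1 := by rw [letterEps_eq, if_pos (by omega)]
  have key : ∀ {b : ℤ} {t : Tab}, InnerHW 0 0 0 0 0 0 t →
      (wordPhiEps n 1 (word ((2, b) :: t))).2 ≠ 0 := fun ht => by
    rw [ht.eq_replicate]
    simp [word, wordPhiEps, e2]
  induction h with
  | nil => simp
  | col21 h ih | col22 h ih | col23 h ih =>
    obtain ⟨-, -, hD, -, hE⟩ := ih (by simp only [word, wordPhiEps] at h1; omega)
    subst_vars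
    exact absurd h1 (key h)
  | col12' _ h ih | col13 _ h ih =>
    have := ih (by simp only [word, wordPhiEps] at h1; omega)
    omega
  | col12 h ih => exact ih (by simp only [word, wordPhiEps] at h1; omega)

theorem innerHW_hw (k : ℕ) : InnerHW k 0 0 0 0 0 (hw k) := by
  obtain ⟨t, ht⟩ := InnerHW.exists_of_conditions (A := k) (B := 0) (C := 0) (D := 0) (d := 0)
    (E := 0) (by simp) (by simp) (by simp) (by simp)
  have := ht.eq_replicate
  simp only [List.replicate_zero, List.append_nil] at this
  exact (show t = hw k from this) ▸ ht

theorem isKN_hw (hn : 4 ≤ n) (k : ℕ) : IsKN n k (hw k) :=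
  isKN_iff.2 ⟨by simp [hw], (innerHW_hw k).kNTab hn⟩

/-- The weight for the letter `1`, as a function on the vertices of the branching component
graph. -/
def compWt (hn : 4 ≤ n) (k : ℕ) : (innerGraph n k).ConnectedComponent → ℤ :=
  SimpleGraph.ConnectedComponent.lift (fun t => wordWt 1 (word t.1)) (by
    have key : ∀ t t' : KN n k, (innerGraph n k).Adj t t' →
        wordWt 1 (word t.1) = wordWt 1 (word t'.1) := by
      intro t t' h
      obtain ⟨-, ⟨i, hi, hin, h⟩ | ⟨i, hi, hin, h⟩⟩ := (SimpleGraph.fromRel_adj _ _ _).1 h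
      · have := wordWt_one_of_wordF (by omega) (by omega)
          ((isKN_iff.1 t.2).2.tabF (by omega) (by omega) hin h).2.2
        rw [if_neg (by omega)] at this; omega
      · have := wordWt_one_of_wordF (by omega) (by omega)
          ((isKN_iff.1 t'.2).2.tabF (by omega) (by omega) hin h).2.2
        rw [if_neg (by omega)] at this; omega
    intro t t' p _
    induction p with
    | nil => rfl
    | cons h p ih => exact (key _ _ h).trans (ih ‹SimpleGraph.Walk.IsPath _›.of_cons))

/-- Along an edge of the branching component graph the weight for the letter `1` changes by at most
one. -/
theorem compWt_le_of_walk (hn : 4 ≤ n) {k : ℕ} {v w : (innerGraph n k).ConnectedComponent}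
    (p : (BC n k).Walk v w) : compWt hn k v - compWt hn k w ≤ p.length := by
  induction p with
  | nil => simp
  | cons h p ih =>
    rw [SimpleGraph.Walk.length_cons]
    obtain ⟨-, ⟨t, t', rfl, rfl, hF⟩ | ⟨t, t', rfl, rfl, hF⟩⟩ :=
      (SimpleGraph.fromRel_adj _ _ _).1 h
    all_goals
      have := wordWt_one_of_wordF (by omega) le_rfl
        ((isKN_iff.1 t.2).2.tabF (by omega) le_rfl (by omega) hF).2.2
      rw [if_pos rfl] at this
      simp only [compWt, SimpleGraph.ConnectedComponent.lift_mk] at ih ⊢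
      push_cast
      omega

/-- A tableau that is not the highest weight tableau is the target of an arrow; following the arrows
backwards, one passes an edge of the graph only for the colour `1`. -/
theorem exists_walk_hw (hn : 4 ≤ n) {k : ℕ} (t : KN n k) :
    ∃ p : (BC n k).Walk ((innerGraph n k).connectedComponentMk ⟨hw k, isKN_hw hn k⟩)
      ((innerGraph n k).connectedComponentMk t), (p.length : ℤ) ≤ k - wordWt 1 (word t.1) := by
  induction hm : ((word t.1).map (height n)).sum using Nat.strong_induction_on generalizing t with
  | _ m ih =>
    obtain ⟨hl, ht⟩ := isKN_iff.1 t.2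
    by_cases h : ∀ i, 1 ≤ i → i ≤ n → KR.tabE n i t.1 = none
    · obtain ⟨A, B, C, D, d, E, hi⟩ := exists_innerHW hn ht fun i hi hin =>
        (tabE_eq_none_iff _ _ _).1 (h i (by omega) hin)
      obtain ⟨rfl, rfl, rfl, rfl, rfl⟩ := hi.eq_zero_of_eps_one hn
        ((tabE_eq_none_iff _ _ _).1 (h 1 le_rfl (by omega)))
      have hlen := hi.length_eq
      obtain rfl : A = k := by omega
      have e : t = ⟨hw A, isKN_hw hn A⟩ :=
        Subtype.ext (hi.eq_replicate.trans (innerHW_hw A).eq_replicate.symm)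
      subst e
      refine ⟨.nil, ?_⟩
      rw [(innerHW_hw A).wordWt_one]
      simp
    · simp only [not_forall] at h
      obtain ⟨i, hi, hin, h⟩ := h
      obtain ⟨s, hE⟩ := Option.ne_none_iff_exists'.1 h
      obtain ⟨hs, hl', hw⟩ := ht.tabE (by omega) (by omega) hin hE
      have hlt := height_lt_of_wordE (by omega) (by omega) hw
      have hF := (wordF_of_wordE (by omega) (by omega) hw).1
      have hwt := wordWt_one_of_wordF (by omega) (by omega) hF
      obtain ⟨p, hp⟩ := ih _ (hm ▸ hlt) ⟨s, isKN_iff.2 ⟨hl'.trans hl, hs⟩⟩ rfl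
      by_cases e : (innerGraph n k).connectedComponentMk ⟨s, isKN_iff.2 ⟨hl'.trans hl, hs⟩⟩ =
          (innerGraph n k).connectedComponentMk t
      · rw [← e]
        refine ⟨p, hp.trans ?_⟩
        split_ifs at hwt <;> simp only <;> omega
      · rcases hi.lt_or_eq with hi2 | rfl
        · refine absurd (SimpleGraph.ConnectedComponent.sound (SimpleGraph.Adj.reachable ?_)) e
          refine (SimpleGraph.fromRel_adj _ _ _).2
            ⟨fun h => e (congrArg _ h), Or.inl ⟨i, hi2, hin, ?_⟩⟩
          exact tabF_of_wordF hF
        · have hadj : (BC n k).Adj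
              ((innerGraph n k).connectedComponentMk ⟨s, isKN_iff.2 ⟨hl'.trans hl, hs⟩⟩)
              ((innerGraph n k).connectedComponentMk t) :=
            (SimpleGraph.fromRel_adj _ _ _).2 ⟨e, Or.inl ⟨_, _, rfl, rfl, tabF_of_wordF hF⟩⟩
          refine ⟨p.concat hadj, ?_⟩
          rw [SimpleGraph.Walk.length_concat]
          rw [if_pos rfl] at hwt
          simp only at hp
          push_cast
          omega

/-- The rank in the branching component graph is given by the weight for the letter `1`. -/
theorem rank_eq (hn : 4 ≤ n) {k : ℕ} {t : Tab} (ht : IsKN n k t) :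
    (rank n k t : ℤ) = k - wordWt 1 (word t) := by
  rw [rank, dif_pos ⟨isKN_hw hn k, ht⟩]
  obtain ⟨p, hp⟩ := exists_walk_hw hn ⟨t, ht⟩
  obtain ⟨q, hq⟩ := p.reachable.exists_walk_length_eq_dist
  have h1 := SimpleGraph.dist_le p
  have h2 := compWt_le_of_walk hn q
  simp only [compWt, SimpleGraph.ConnectedComponent.lift_mk] at h2
  rw [(innerHW_hw k).wordWt_one] at h2
  simp only at hp
  push_cast at h2
  omega

end

/-! ### Sliding the bottom row of a tableau -/

section

variable {n : ℕ}

theorem colOK_iff_pos {c : ℤ × ℤ} : ColOK n c ↔ IsLetter n c.1 ∧ IsLetter n c.2 ∧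
    (pos n c.1 < pos n c.2 ∨ (pos n c.2 = n ∧ pos n c.1 = n + 1)) ∧
    ¬ (pos n c.1 = 1 ∧ pos n c.2 = 2 * n) := by
  constructor
  · rintro ⟨h1, h2, h3, h4⟩
    have l1 : IsLetter n c.1 := h1
    have l2 : IsLetter n c.2 := h2
    rw [le_iff_pos l2 l1] at h3
    have p1 := pos_cases l1
    have p2 := pos_cases l2
    exact ⟨l1, l2, by omega, by omega⟩
  · rintro ⟨l1, l2, h3, h4⟩
    have p1 := pos_cases l1
    have p2 := pos_cases l2
    refine ⟨l1, l2, ?_, by omega⟩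
    rw [le_iff_pos l2 l1]
    omega

theorem eq_neg_iff_pos {x y : ℤ} (hx : IsLetter n x) (hy : IsLetter n y) :
    x = -y ↔ pos n x = 2 * n + 1 - pos n y := by
  rw [← pos_neg hy]
  exact ⟨fun h => h ▸ rfl, fun h => pos_inj hx hy.neg h⟩

theorem adj_iff_pos (hn : 2 ≤ n) {c d : ℤ × ℤ} (hc1 : IsLetter n c.1) (hc2 : IsLetter n c.2)
    (hd1 : IsLetter n d.1) (hd2 : IsLetter n d.2) : Adj n c d ↔
    (pos n c.1 ≤ pos n d.1 ∧ ¬ (pos n c.1 = n ∧ pos n d.1 = n + 1)) ∧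
    (pos n c.2 ≤ pos n d.2 ∧ ¬ (pos n c.2 = n ∧ pos n d.2 = n + 1)) ∧
    ¬ (pos n c.1 = pos n d.1 ∧ pos n d.2 = 2 * n + 1 - pos n d.1) ∧
    ¬ (pos n c.2 = 2 * n + 1 - pos n c.1 ∧ pos n d.2 = pos n c.2) ∧
    ¬ (pos n c.1 = n - 1 ∧ pos n c.2 = n ∧ pos n d.1 = n ∧ pos n d.2 = n + 2) ∧
    ¬ (pos n c.1 = n - 1 ∧ pos n c.2 = n + 1 ∧ pos n d.1 = n + 1 ∧ pos n d.2 = n + 2) := by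
  have e1 : c.1 = d.1 ↔ pos n c.1 = pos n d.1 := ⟨fun h => h ▸ rfl, pos_inj hc1 hd1⟩
  have e2 : d.2 = c.2 ↔ pos n d.2 = pos n c.2 := ⟨fun h => h ▸ rfl, pos_inj hd2 hc2⟩
  have e3 : c.1 = n - 1 ↔ pos n c.1 = n - 1 := by have := pos_cases hc1; omega
  have e4 : c.2 = n ↔ pos n c.2 = n := by have := pos_cases hc2; omega
  have e5 : d.1 = n ↔ pos n d.1 = n := by have := pos_cases hd1; omega
  have e6 : d.2 = -((n : ℤ) - 1) ↔ pos n d.2 = n + 2 := by have := pos_cases hd2; omega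
  have e7 : c.2 = -n ↔ pos n c.2 = n + 1 := by have := pos_cases hc2; omega
  have e8 : d.1 = -n ↔ pos n d.1 = n + 1 := by have := pos_cases hd1; omega
  rw [Adj, le_iff_pos hc1 hd1, le_iff_pos hc2 hd2, eq_neg_iff_pos hd2 hd1, eq_neg_iff_pos hc2 hc1,
    e1, e2, e3, e4, e5, e6, e7, e8]

/-- The column that appears between two neighbouring columns `c`, `d` when the bottom row of a
tableau slides by one step to the left: the top of `c` over the bottom of `d`, corrected according
to the plactic relations if this is a column `a` over `ā`. -/
def slideCol (n : ℕ) (c d : ℤ × ℤ) : ℤ × ℤ :=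
  if d.2 = -c.1 then if c.1 = (n : ℤ) - 1 then (-c.2, c.2) else (c.1 + 1, -(c.1 + 1))
  else (c.1, d.2)

/-- The three cases in the definition of `slideCol`, in terms of positions. -/
theorem slideCol_pos (hn : 2 ≤ n) {c d : ℤ × ℤ} (hc : ColOK n c) (hd : ColOK n d)
    (h : Adj n c d) : IsLetter n (slideCol n c d).1 ∧ IsLetter n (slideCol n c d).2 ∧
    ((pos n c.1 + pos n d.2 ≠ 2 * n + 1 ∧ pos n (slideCol n c d).1 = pos n c.1 ∧
        pos n (slideCol n c d).2 = pos n d.2) ∨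
      (pos n c.1 + pos n d.2 = 2 * n + 1 ∧ pos n c.1 = n - 1 ∧
        pos n (slideCol n c d).1 = 2 * n + 1 - pos n c.2 ∧
        pos n (slideCol n c d).2 = pos n c.2 ∧ (pos n c.2 = n ∨ pos n c.2 = n + 1)) ∨
      (pos n c.1 + pos n d.2 = 2 * n + 1 ∧ pos n c.1 < n - 1 ∧
        pos n (slideCol n c d).1 = pos n c.1 + 1 ∧
        pos n (slideCol n c d).2 = 2 * n - pos n c.1)) := by
  obtain ⟨c1, c2, hc3, hc4⟩ := (colOK_iff_pos).1 hc
  obtain ⟨d1, d2, hd3, hd4⟩ := (colOK_iff_pos).1 hd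
  rw [adj_iff_pos hn c1 c2 d1 d2] at h
  have p1 := pos_cases c1
  have e := eq_neg_iff_pos d2 c1
  unfold slideCol
  split_ifs with h1 h2
  · have := pos_neg c2
    exact ⟨c2.neg, c2, Or.inr (Or.inl (by simp only; grind))⟩
  · have l : IsLetter n (c.1 + 1) := by simp only [IsLetter] at *; grind
    have := pos_neg l
    have := pos_cases l
    have h3 : pos n c.1 < n - 1 := by grind
    exact ⟨l, l.neg, Or.inr (Or.inr (by simp only; grind))⟩
  · exact ⟨c1, d2, Or.inl (by simp only; grind)⟩

/-- One step of the sliding is one plactic relation. -/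
theorem slideCol_knuthRel (hn : 2 ≤ n) {c d : ℤ × ℤ} (hc : ColOK n c) (hd : ColOK n d)
    (h : Adj n c d) :
    KnuthRel n [c.2, c.1, d.2] [c.2, (slideCol n c d).2, (slideCol n c d).1] := by
  obtain ⟨s1, s2, hs⟩ := slideCol_pos hn hc hd h
  obtain ⟨c1, c2, hc3, hc4⟩ := (colOK_iff_pos).1 hc
  obtain ⟨d1, d2, hd3, hd4⟩ := (colOK_iff_pos).1 hd
  rw [adj_iff_pos hn c1 c2 d1 d2] at h
  obtain hs | hs | hs := hs
  · refine .of (Or.inl ⟨?_, ?_, ?_, ?_, ?_, ?_, ?_⟩) <;> grind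
  · obtain hb | hb := hs.2.2.2.2
    · refine .of (Or.inr (Or.inr (Or.inl ⟨?_, ?_, ?_, ?_, ?_, ?_⟩))) <;> grind
    · refine .of (Or.inr (Or.inl ⟨?_, ?_, ?_, ?_, ?_, ?_, ?_, ?_⟩)) <;> grind
  · refine .of (Or.inr (Or.inl ⟨?_, ?_, ?_, ?_, ?_, ?_, ?_, ?_⟩)) <;> grind

theorem slideCol_colOK (hn : 2 ≤ n) {c d : ℤ × ℤ} (hc : ColOK n c) (hd : ColOK n d)
    (h : Adj n c d) : ColOK n (slideCol n c d) := by
  obtain ⟨s1, s2, hs⟩ := slideCol_pos hn hc hd h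
  obtain ⟨c1, c2, hc3, hc4⟩ := (colOK_iff_pos).1 hc
  obtain ⟨d1, d2, hd3, hd4⟩ := (colOK_iff_pos).1 hd
  rw [adj_iff_pos hn c1 c2 d1 d2] at h
  have := pos_bound c1
  refine (colOK_iff_pos).2 ⟨s1, s2, ?_, ?_⟩ <;> grind (splits := 30)

theorem slideCol_adj (hn : 2 ≤ n) {c d e : ℤ × ℤ} (hc : ColOK n c) (hd : ColOK n d)
    (he : ColOK n e) (h : Adj n c d) (h' : Adj n d e) :
    Adj n (slideCol n c d) (slideCol n d e) := by
  obtain ⟨s1, s2, hs⟩ := slideCol_pos hn hc hd h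
  obtain ⟨t1, t2, ht⟩ := slideCol_pos hn hd he h'
  obtain ⟨c1, c2, hc3, hc4⟩ := (colOK_iff_pos).1 hc
  obtain ⟨d1, d2, hd3, hd4⟩ := (colOK_iff_pos).1 hd
  obtain ⟨e1, e2, he3, he4⟩ := (colOK_iff_pos).1 he
  rw [adj_iff_pos hn c1 c2 d1 d2] at h
  rw [adj_iff_pos hn d1 d2 e1 e2] at h'
  have := pos_bound c1
  rw [adj_iff_pos hn s1 s2 t1 t2]
  obtain hs | hs | hs := hs <;> obtain ht | ht | ht := ht <;>
    refine ⟨?_, ?_, ?_, ?_, ?_, ?_⟩ <;> grind (splits := 40)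

end

/-! ### The slid tableau -/

section

variable {n : ℕ}

/-- The bottom row slides by one step to the left, and `1̄` enters at the right. The entry of the
bottom row that leaves the tableau at the left is forgotten. -/
def slide (n : ℕ) : Tab → Tab
  | [] => []
  | [c] => [(c.1, -1)]
  | c :: d :: t => slideCol n c d :: slide n (d :: t)

/-- The column word of `slide n t` without the letter `1̄` that has entered. -/
def slideWord (n : ℕ) : Tab → List ℤ
  | [] => []
  | [c] => [c.1]
  | c :: d :: t => (slideCol n c d).2 :: (slideCol n c d).1 :: slideWord n (d :: t)

theorem length_slide (n : ℕ) (t : Tab) : (slide n t).length = t.length := by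
  induction t with
  | nil => rfl
  | cons c t ih =>
    cases t with
    | nil => rfl
    | cons d t => simpa [slide] using ih

/-- The word of a tableau is rewritten from right to left, with one plactic relation for each pair of
neighbouring columns. -/
theorem Plactic.slideWord (hn : 2 ≤ n) {c : ℤ × ℤ} {t : Tab} (h : KNTab n (c :: t)) :
    Plactic n 1 (word (c :: t)) (c.2 :: slideWord n (c :: t)) := by
  induction t generalizing c with
  | nil => exact .refl _
  | cons d t ih =>
    obtain ⟨hc, hcd, hd⟩ := kNTab_cons_cons.1 h
    have p := ((slideCol_knuthRel hn hc (hd.1 d (by simp)) hcd).plactic hn).append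
      (.refl (KR.slideWord n (d :: t)))
    exact (((ih hd).cons c.1).cons c.2).trans p

theorem plactic_slide (hn : 3 ≤ n) (t : Tab) :
    Plactic n 2 (word (slide n t)) (slideWord n t) := by
  induction t with
  | nil => exact .refl _
  | cons c t ih =>
    cases t with
    | nil => exact (plactic_one hn (by norm_num)).append (.refl [c.1])
    | cons d t => exact (ih.cons _).cons _

theorem wordWt_slide (n : ℕ) (c : ℤ × ℤ) (t : Tab) :
    wordWt 1 (word (slide n (c :: t))) = wordWt 1 (slideWord n (c :: t)) - 1 := by
  induction t generalizing c with
  | nil => simp only [slide, slideWord, word, wordWt_cons]; norm_num; ring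
  | cons d t ih => simp only [slide, slideWord, word, wordWt_cons, ih]; ring

/-- Plactically equivalent words for all colours have the same weight for the letter `1`. -/
theorem Plactic.wordWt_one_eq (hn : 3 ≤ n) {x y : List ℤ} (h : Plactic n 1 x y) :
    wordWt 1 x = wordWt 1 y := by
  have h2 := (h.mono one_le_two).wordWt_eq hn le_rfl (by omega)
  have h3 := phi_sub_eps_of_lt (n := n) le_rfl (by omega) x
  have h4 := phi_sub_eps_of_lt (n := n) le_rfl (by omega) y
  rw [h.phiEps le_rfl (by omega)] at h3
  norm_num at h3 h4
  omega

theorem isLetter_one (hn : 1 ≤ n) : IsLetter n 1 ∧ IsLetter n (-1) ∧ pos n 1 = 1 ∧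
    pos n (-1) = 2 * n := by
  simp only [IsLetter, pos]; norm_num; omega

/-- The sliding preserves the conditions of Kashiwara and Nakashima, also together with the column
`1` over `b`, where `b` is the letter that leaves the tableau. -/
theorem KNTab.slide (hn : 4 ≤ n) {c : ℤ × ℤ} {t : Tab} (h : KNTab n (c :: t))
    (hlast : ∀ d, (c :: t).getLast? = some d → d.1 ≠ 1) :
    KNTab n (slide n (c :: t)) ∧
      (c.2 ≠ -1 → KNTab n ((1, c.2) :: KR.slide n (c :: t))) := by
  obtain ⟨l1, l2, p1, p2⟩ := isLetter_one (n := n) (by omega)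
  have h2 : 2 ≤ n := by omega
  have hfst : ∀ c : ℤ × ℤ, ColOK n c → c.2 ≠ -1 → ColOK n (1, c.2) := by
    intro c hc h
    obtain ⟨c1, c2, hc3, hc4⟩ := colOK_iff_pos.1 hc
    have := pos_bound c1
    have : pos n c.2 ≠ 2 * n := fun e => h (pos_inj c2 l2 (e.trans p2.symm))
    exact colOK_iff_pos.2 ⟨l1, c2, by simp only; omega, by simp only; omega⟩
  have hlst : ∀ d : ℤ × ℤ, ColOK n d → d.1 ≠ 1 → ColOK n (d.1, -1) := by
    intro d hd h
    obtain ⟨c1, c2, hc3, hc4⟩ := colOK_iff_pos.1 hd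
    have := pos_bound c1
    have := pos_bound c2
    have : pos n d.1 ≠ 1 := fun e => h (pos_inj c1 l1 (e.trans p1.symm))
    exact colOK_iff_pos.2 ⟨c1, l2, by simp only; omega, by simp only; omega⟩
  induction t generalizing c with
  | nil =>
    have hc := kNTab_singleton.1 h
    have h1 := hlast c rfl
    have hk := hlst c hc h1
    refine ⟨kNTab_singleton.2 hk, fun hb => kNTab_cons_cons.2 ⟨hfst c hc hb, ?_,
      kNTab_singleton.2 hk⟩⟩
    obtain ⟨c1, c2, hc3, hc4⟩ := colOK_iff_pos.1 hc
    have := pos_bound c1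
    have := pos_bound c2
    have : pos n c.1 ≠ 1 := fun e => h1 (pos_inj c1 l1 (e.trans p1.symm))
    have : pos n c.2 ≠ 2 * n := fun e => hb (pos_inj c2 l2 (e.trans p2.symm))
    refine (adj_iff_pos (c := (1, c.2)) (d := (c.1, -1)) h2 l1 c2 c1 l2).2 ?_
    simp only
    omega
  | cons d t ih =>
    obtain ⟨hc, hcd, hd⟩ := kNTab_cons_cons.1 h
    have hd0 := hd.1 d (by simp)
    have ih' := (ih hd (fun e he => hlast e (by rw [List.getLast?_cons_cons]; exact he))).1
    obtain ⟨s1, s2, hs⟩ := slideCol_pos h2 hc hd0 hcd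
    obtain ⟨c1, c2, hc3, hc4⟩ := colOK_iff_pos.1 hc
    obtain ⟨d1, d2, hd3, hd4⟩ := colOK_iff_pos.1 hd0
    have hcd' := (adj_iff_pos h2 c1 c2 d1 d2).1 hcd
    have b1 := pos_bound c1
    have b2 := pos_bound d2
    have key : KNTab n (KR.slide n (c :: d :: t)) := by
      cases t with
      | nil =>
        have h1 := hlast d rfl
        have : pos n d.1 ≠ 1 := fun e => h1 (pos_inj d1 l1 (e.trans p1.symm))
        refine kNTab_cons_cons.2 ⟨slideCol_colOK h2 hc hd0 hcd, ?_, ih'⟩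
        refine (adj_iff_pos (d := (d.1, -1)) h2 s1 s2 d1 l2).2 ?_
        simp only
        refine ⟨?_, ?_, ?_, ?_, ?_, ?_⟩ <;> grind (splits := 30)
      | cons e t =>
        obtain ⟨-, hde, he⟩ := kNTab_cons_cons.1 hd
        exact kNTab_cons_cons.2 ⟨slideCol_colOK h2 hc hd0 hcd,
          slideCol_adj h2 hc hd0 (he.1 e (by simp)) hcd hde, ih'⟩
    refine ⟨key, fun hb => kNTab_cons_cons.2 ⟨hfst c hc hb, ?_, key⟩⟩
    have : pos n c.2 ≠ 2 * n := fun e => hb (pos_inj c2 l2 (e.trans p2.symm))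
    refine (adj_iff_pos (c := (1, c.2)) h2 l1 c2 s1 s2).2 ?_
    simp only
    refine ⟨?_, ?_, ?_, ?_, ?_, ?_⟩ <;> grind (splits := 30)

/-- The colour `1` as seen by a letter. -/
theorem letter_one_cases (hn : 2 ≤ n) (x : ℤ) :
    (letterPhi n 1 x = 1 ∧ letterEps n 1 x = 0 ∧ (x = 1 ∨ x = -2)) ∨
    (letterPhi n 1 x = 0 ∧ letterEps n 1 x = 1 ∧ (x = 2 ∨ x = -1)) ∨
    (letterPhi n 1 x = 0 ∧ letterEps n 1 x = 0 ∧ x ≠ 1 ∧ x ≠ -2 ∧ x ≠ 2 ∧ x ≠ -1) := by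
  rw [letterPhi_eq, letterEps_eq]; split_ifs <;> omega

end

/-! ### Lifting a tableau to the next component -/

section

variable {n : ℕ}

/-- The letter `1̄` that enters raises `ε₁` by one, unless its arrow is cancelled by a letter `2̄` in
front of it, which happens only if the first column is `2̄` over `1̄`. -/
theorem KNTab.phiEps_slide (hn : 4 ≤ n) {c : ℤ × ℤ} {t : Tab} (h : KNTab n (c :: t))
    (hlast : ∀ d, (c :: t).getLast? = some d → d.1 ≠ 1) :
    (c = (-2, -1) ∧ wordPhiEps n 1 (slideWord n (c :: t)) = (1, 0) ∧
      wordPhiEps n 1 (word (KR.slide n (c :: t))) = (0, 0)) ∨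
    ((wordPhiEps n 1 (word (KR.slide n (c :: t)))).1 =
        (wordPhiEps n 1 (slideWord n (c :: t))).1 ∧
      (wordPhiEps n 1 (word (KR.slide n (c :: t)))).2 =
        (wordPhiEps n 1 (slideWord n (c :: t))).2 + 1) := by
  have two : ∀ c : ℤ × ℤ, ColOK n c → c.1 = -2 → c = (-2, -1) := by
    intro c hc h
    simp only [ColOK, Le, Lt] at hc
    exact Prod.ext h (by simp only; omega)
  have em : letterPhi n 1 (-1) = 0 ∧ letterEps n 1 (-1) = 1 := by
    have := letter_one_cases (n := n) (by omega) (-1); omega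
  induction t generalizing c with
  | nil =>
    have h1 := hlast c rfl
    have hc := kNTab_singleton.1 h
    simp only [KR.slide, slideWord, word, wordPhiEps, em]
    rcases letter_one_cases (n := n) (by omega) c.1 with ⟨p, e, hx⟩ | ⟨p, e, hx⟩ | ⟨p, e, hx⟩
    · exact Or.inl ⟨two c hc (by tauto), by simp [p, e], by simp [p, e]⟩
    · exact Or.inr (by simp [p, e])
    · exact Or.inr (by simp [p, e])
  | cons d t ih =>
    obtain ⟨hc, hcd, hd⟩ := kNTab_cons_cons.1 h
    have ih' := ih hd (fun e he => hlast e (by rw [List.getLast?_cons_cons]; exact he))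
    simp only [KR.slide, slideWord, word]
    generalize slideWord n (d :: t) = m at *
    generalize word (KR.slide n (d :: t)) = s at *
    obtain ⟨hd2, hm, hs⟩ | ⟨h1, h2⟩ := ih'
    · by_cases hc1 : c.1 = 1
      · have : slideCol n c d = (2, -2) := by
          rw [slideCol, hd2, if_pos (by omega), if_neg (by omega), hc1]; norm_num
        rw [this]
        simp only [wordPhiEps, hm, hs]
        have h2 := letter_one_cases (n := n) (by omega) 2
        have h3 := letter_one_cases (n := n) (by omega) (-2)
        refine Or.inr ?_
        omega
      · have : slideCol n c d = (c.1, -1) := by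
          rw [slideCol, hd2, if_neg (by simp only; omega)]
        rw [this]
        simp only [wordPhiEps, hm, hs, em]
        rcases letter_one_cases (n := n) (by omega) c.1 with ⟨p, e, hx⟩ | ⟨p, e, hx⟩ | ⟨p, e, hx⟩
        · exact Or.inl ⟨two c hc (by tauto), by simp [p, e], by simp [p, e]⟩
        · exact Or.inr (by simp [p, e])
        · exact Or.inr (by simp [p, e])
    · refine Or.inr ?_
      simp only [wordPhiEps, h1, h2]
      exact ⟨trivial, by omega⟩

/-- If the first column is `1` over `2`, so that a letter `2` leaves the tableau, then the remaining word
still has an arrow of the colour `1`. -/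
theorem KNTab.one_le_phi_slideWord (hn : 4 ≤ n) {c : ℤ × ℤ} {t : Tab} (h : KNTab n (c :: t))
    (hlast : ∀ d, (c :: t).getLast? = some d → d.1 ≠ 1) (hc : c = (1, 2)) :
    1 ≤ (wordPhiEps n 1 (slideWord n (c :: t))).1 := by
  subst hc
  induction t with
  | nil => exact absurd rfl (hlast _ rfl)
  | cons d t ih =>
    obtain ⟨hc, hcd, hd⟩ := kNTab_cons_cons.1 h
    have e1 := letter_one_cases (n := n) (by omega) 1
    have e2 := letter_one_cases (n := n) (by omega) 2
    have e3 := letter_one_cases (n := n) (by omega) (-2)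
    have e4 := letter_one_cases (n := n) (by omega) d.2
    by_cases h1 : d.2 = -1
    · have : slideCol n (1, 2) d = (2, -2) := by
        rw [slideCol, h1, if_pos rfl, if_neg (by simp only; omega)]; norm_num
      rw [slideWord, this]
      simp only [wordPhiEps]
      omega
    · have : slideCol n (1, 2) d = (1, d.2) := by rw [slideCol, if_neg h1]
      rw [slideWord, this]
      simp only [wordPhiEps]
      by_cases h2 : d.2 = 2
      · have h3 : d = (1, 2) := by
          have := hd.1 d (by simp)
          simp only [ColOK, Le, Lt] at this
          exact Prod.ext (by simp only; omega) h2
        subst h3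
        have := ih hd (fun e he => hlast e (by rw [List.getLast?_cons_cons]; exact he))
        dsimp only at e4 ⊢
        omega
      · omega

/-- If the bottom row starts with `1̄`, then it consists of letters `1̄`. -/
theorem KNTab.phi_eq_zero (hn : 4 ≤ n) {t : Tab} (h : KNTab n t)
    (hb : ∀ c, t.head? = some c → c.2 = -1) : (wordPhiEps n 1 (word t)).1 = 0 := by
  induction t with
  | nil => rfl
  | cons c t ih =>
    have hc := h.1 c (by simp)
    have hc2 : c.2 = -1 := hb c rfl
    have ih' := ih h.of_cons fun d hd => by
      cases t with
      | nil => simp at hd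
      | cons e t =>
        obtain rfl : e = d := by simpa using hd
        obtain ⟨-, hce, he⟩ := kNTab_cons_cons.1 h
        have he0 := (he.1 e (by simp)).2.1
        have hle := hce.2.1
        rw [hc2] at hle
        simp only [Le, Lt] at hle
        omega
    have em := letter_one_cases (n := n) (by omega) (-1)
    have ec := letter_one_cases (n := n) (by omega) c.1
    simp only [word, wordPhiEps, ih', hc2]
    omega

theorem phiEps_two_bar_two (hn : 4 ≤ n) : wordPhiEps n 1 [-2, 2] = (1, 1) := by
  have e2 := letter_one_cases (n := n) (by omega) 2
  have e3 := letter_one_cases (n := n) (by omega) (-2)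
  simp only [wordPhiEps, Prod.mk.injEq]
  omega

/-- `t'` is the image of `t ∈ B(kϖ₂)` in `B((k+1)ϖ₂)`: it is at the same position and has the same
weight for the letter `1`; moreover `φ₁` and `ε₁` are larger by one. -/
def IsLift (n : ℕ) (t t' : Tab) : Prop :=
  KNTab n t' ∧ t'.length = t.length + 1 ∧ Plactic n 2 (word t) (word t') ∧
    wordWt 1 (word t') = wordWt 1 (word t) ∧
    (wordPhiEps n 1 (word t')).1 = (wordPhiEps n 1 (word t)).1 + 1 ∧
    (wordPhiEps n 1 (word t')).2 = (wordPhiEps n 1 (word t)).2 + 1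

/-- If the bottom row consists of letters `1̄`, then a column `2` over `2̄` is added at the left. -/
theorem KNTab.isLift_cons (hn : 4 ≤ n) {t : Tab} (h : KNTab n t)
    (hb : ∀ c, t.head? = some c → c.2 = -1) : IsLift n t ((2, -2) :: t) := by
  have h22 : ColOK n (2, -2) := by simp only [ColOK, Le, Lt]; omega
  have hw : word ((2, -2) :: t) = [-2, 2] ++ word t := rfl
  refine ⟨?_, rfl, ?_, ?_, ?_, ?_⟩
  · cases t with
    | nil => exact kNTab_singleton.2 h22
    | cons c t =>
      have hc := h.1 c (by simp)
      have hc2 := hb c rfl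
      refine kNTab_cons_cons.2 ⟨h22, ?_, h⟩
      simp only [Adj, ColOK, Le, Lt] at hc ⊢
      omega
  · exact (plactic_two hn).symm.append (.refl _)
  · simp only [word, wordWt_cons]; norm_num
  all_goals
    rw [hw, wordPhiEps_append, phiEps_two_bar_two hn, h.phi_eq_zero hn hb]
    omega

theorem wordWt_dual (i : ℕ) (w : List ℤ) : wordWt i (dual w) = -wordWt i w := by
  induction w with
  | nil => simp [dual, wordWt]
  | cons x w ih =>
    rw [dual_cons, wordWt_append, ih, wordWt_cons, wordWt_cons]
    simp only [neg_inj, wordWt_nil, neg_eq_iff_eq_neg (b := (i : ℤ))]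
    ring

/-- If the top row consists of letters `1`, then a column `2` over `2̄` is added at the right. -/
theorem KNTab.isLift_append (hn : 4 ≤ n) {t : Tab} (h : KNTab n t)
    (ha : ∀ c, t.getLast? = some c → c.1 = 1) : IsLift n t (t ++ [(2, -2)]) := by
  have hd : IsLift n (tabDual t) ((2, -2) :: tabDual t) := by
    refine h.dual.isLift_cons hn fun c hc => ?_
    rw [tabDual, List.head?_reverse, List.getLast?_map, Option.map_eq_some_iff] at hc
    obtain ⟨d, hd, rfl⟩ := hc
    simp [ha d hd]
  have e : t ++ [(2, -2)] = tabDual ((2, -2) :: tabDual t) := by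
    simp [tabDual, Function.comp_def]
  obtain ⟨h1, h2, h3, h4, h5, h6⟩ := hd
  have hw : word ((2, -2) :: tabDual t) = [-2, 2] ++ word (tabDual t) := rfl
  refine ⟨e ▸ h1.dual, by simp, ?_, ?_, ?_, ?_⟩
  · rw [word_append]
    simpa [word] using (Plactic.refl (word t)).append (plactic_two hn).symm
  · rw [e, word_tabDual, wordWt_dual, h4, word_tabDual, wordWt_dual, neg_neg]
  · rw [e, word_tabDual, wordPhiEps_dual, h6, word_tabDual, wordPhiEps_dual]
  · rw [e, word_tabDual, wordPhiEps_dual, h5, word_tabDual, wordPhiEps_dual]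

/-- The general case: the column `1` over `b` and the letter `1̄` are inserted around the slided
tableau. -/
theorem KNTab.isLift_slide (hn : 4 ≤ n) {c : ℤ × ℤ} {t : Tab} (h : KNTab n (c :: t))
    (hb : c.2 ≠ -1) (ha : ∀ d, (c :: t).getLast? = some d → d.1 ≠ 1) :
    IsLift n (c :: t) ((1, c.2) :: KR.slide n (c :: t)) := by
  have p := Plactic.slideWord (by omega) h
  have p2 := plactic_slide (n := n) (by omega) (c :: t)
  refine ⟨(h.slide hn ha).2 hb, by simp [length_slide], ?_, ?_, ?_⟩
  · exact (p.mono one_le_two).trans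
      ((((plactic_one (by omega) (by norm_num)).append p2).cons c.2).symm)
  · rw [p.wordWt_one_eq (by omega)]
    simp only [word, wordWt_cons, wordWt_slide]
    norm_num
  · rw [p.phiEps le_rfl (by omega)]
    have e1 := letter_one_cases (n := n) (by omega) 1
    have e2 := letter_one_cases (n := n) (by omega) c.2
    have hphi := h.one_le_phi_slideWord hn ha
    have hc := h.1 c (by simp)
    have h12 : c.2 = 2 → c = (1, 2) := fun h2 => by
      simp only [ColOK, Le, Lt] at hc
      exact Prod.ext (by simp only; omega) h2
    rcases h.phiEps_slide hn ha with ⟨hc2, -⟩ | ⟨h1, h2⟩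
    · exact absurd (by rw [hc2]) hb
    · by_cases hc2 : c.2 = 2
      · have := hphi (h12 hc2)
        simp only [word, wordPhiEps, h1, h2]
        omega
      · simp only [word, wordPhiEps, h1, h2]
        omega

theorem KNTab.exists_isLift (hn : 4 ≤ n) {t : Tab} (h : KNTab n t) : ∃ t', IsLift n t t' := by
  cases t with
  | nil => exact ⟨_, h.isLift_cons hn (by simp)⟩
  | cons c t =>
    by_cases hb : c.2 = -1
    · exact ⟨_, h.isLift_cons hn (by simpa using hb)⟩
    · by_cases ha : ∀ d, (c :: t).getLast? = some d → d.1 = 1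
      · exact ⟨_, h.isLift_append hn ha⟩
      · refine ⟨_, h.isLift_slide hn hb fun d hd h1 => ha fun e he => ?_⟩
        rw [hd, Option.some.injEq] at he
        exact he ▸ h1

end

/-! ### Columns `a` over `ā` in the tableaux of `𝒯(s)` -/

section

variable {n s : ℕ}

/-- The condition on a pair of columns of a tableau in `𝒯(s)`, the first one to the left. -/
def ColRel (n : ℕ) (c d : ℤ × ℤ) : Prop :=
  (Le n c.1 d.1 ∧ Le n c.2 d.2) ∧
    (¬ (c = ((n : ℤ) - 1, (n : ℤ)) ∧ d = ((n : ℤ), -((n : ℤ) - 1))) ∧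
    ¬ (c = ((n : ℤ) - 1, -(n : ℤ)) ∧ d = (-(n : ℤ), -((n : ℤ) - 1))))

theorem isT_iff {T : Tab} : IsT n s T ↔ T.length = s ∧
    (∀ c ∈ T, IsLetter n c.1 ∧ IsLetter n c.2 ∧ ¬ Le n c.2 c.1) ∧ T.Pairwise (ColRel n) := by
  have hl : ∀ x : ℤ, (1 ≤ |x| ∧ |x| ≤ n) ↔ IsLetter n x := fun x => by
    rw [abs_le, IsLetter]
    refine and_congr_left fun _ => ⟨?_, Int.one_le_abs⟩
    rintro h rfl
    simp at h
  simp only [IsT, hl]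
  constructor
  · rintro ⟨h1, h2, h3, h4, h5⟩
    have h3 := pairwise_le_of_isChain (fun c hc => ⟨(h2 c hc).1.2, (h2 c hc).2.2⟩) h3
    exact ⟨h1, fun c hc => ⟨(h2 c hc).1, (h2 c hc).2, h4 c hc⟩, h3.and h5⟩
  · rintro ⟨h1, h2, h3⟩
    exact ⟨h1, fun c hc => ⟨(h2 c hc).1, (h2 c hc).2.1⟩, (h3.imp fun h => h.1).isChain,
      fun c hc => (h2 c hc).2.2, h3.imp fun h => h.2⟩

/-- There are no columns `a` over `ā`. -/
def AntiFree (t : Tab) : Prop := ∀ c ∈ t, c.2 ≠ -c.1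

/-- The column `a` over `ā` between `A` and `C` has a left neighbour with top entry `a` or a right
neighbour with bottom entry `ā`. -/
def Touches (a : ℤ) (A C : Tab) : Prop :=
  (∃ b, A.getLast? = some (a, b)) ∨ ∃ d, C.head? = some (d, -a)

theorem AntiFree.takeWhile {A C : Tab} {a : ℤ} {M : ℕ} (hA : AntiFree A) :
    (A ++ List.replicate (M + 1) (a, -a) ++ C).takeWhile (fun c => decide (c.2 ≠ -c.1)) = A := by
  rw [List.append_assoc, List.takeWhile_append_of_pos fun c hc => decide_eq_true (hA c hc)]
  simp [List.replicate_succ]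

theorem antiFree_cons {c : ℤ × ℤ} {t : Tab} : AntiFree (c :: t) ↔ c.2 ≠ -c.1 ∧ AntiFree t :=
  List.forall_mem_cons

theorem antiFree_reverse {A : Tab} : AntiFree A.reverse ↔ AntiFree A := by simp [AntiFree]

/-- The decomposition of a tableau at its columns `a` over `ā` is unique. -/
theorem split_unique {A C A' C' : Tab} {a a' : ℤ} {M M' : ℕ} (hA : AntiFree A) (hC : AntiFree C)
    (hA' : AntiFree A') (hC' : AntiFree C')
    (h : A ++ List.replicate (M + 1) (a, -a) ++ C = A' ++ List.replicate (M' + 1) (a', -a') ++ C') :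
    A = A' ∧ C = C' ∧ a = a' := by
  have e1 : A = A' := by rw [← hA.takeWhile (a := a) (M := M) (C := C), h, hA'.takeWhile]
  have e2 : C = C' := by
    have h' := congrArg List.reverse h
    simp only [List.reverse_append, List.reverse_replicate, ← List.append_assoc] at h'
    rw [← List.reverse_inj, ← (antiFree_reverse.2 hC).takeWhile (a := a) (M := M) (C := A.reverse),
      h', (antiFree_reverse.2 hC').takeWhile]
  refine ⟨e1, e2, ?_⟩
  subst e1
  rw [List.append_assoc, List.append_assoc, List.append_cancel_left_eq] at h
  simp only [List.replicate_succ, List.cons_append, List.cons.injEq, Prod.mk.injEq] at h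
  exact h.1.1

/-- The rows between two columns `a` over `ā` and `c` over `c̄` are constant. -/
theorem eq_of_between {a c : ℤ} {d : ℤ × ℤ} (h1 : ColRel n (a, -a) d) (h2 : ColRel n d (c, -c))
    (h3 : ColRel n (a, -a) (c, -c)) : c = a ∧ d = (a, -a) := by
  simp only [ColRel, Le, Lt] at h1 h2 h3
  have : c = a := by omega
  subst this
  exact ⟨rfl, Prod.ext (by simp only; omega) (by simp only; omega)⟩

theorem eq_of_colRel {a c : ℤ} (h3 : ColRel n (a, -a) (c, -c)) : c = a := by
  simp only [ColRel, Le, Lt] at h3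
  omega

/-- The columns `a` over `ā` of a tableau are neighbours of each other and have the same `a`. -/
theorem antiFree_or_split {T : Tab} (hT : T.Pairwise (ColRel n)) :
    AntiFree T ∨ ∃ a M A C, T = A ++ List.replicate (M + 1) (a, -a) ++ C ∧
      AntiFree A ∧ AntiFree C := by
  induction T with
  | nil => exact Or.inl (by simp [AntiFree])
  | cons c T ih =>
    obtain ⟨hc, hT'⟩ := List.pairwise_cons.1 hT
    clear hT
    rename' hT' => hT
    by_cases h : c.2 = -c.1
    · obtain ⟨c, c'⟩ := c
      obtain rfl : c' = -c := h
      obtain ih | ⟨a, M, A, C, rfl, hA, hC⟩ := ih hT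
      · exact Or.inr ⟨c, 0, [], T, rfl, by simp [AntiFree], ih⟩
      · have e := eq_of_colRel (hc (a, -a) (by simp))
        cases A with
        | nil => exact Or.inr ⟨a, M + 1, [], C, by simp [List.replicate_succ, e], hA, hC⟩
        | cons d A =>
          rw [List.cons_append, List.cons_append, List.pairwise_cons] at hT
          have := eq_of_between (hc d (by simp)) (hT.1 (a, -a) (by simp)) (hc (a, -a) (by simp))
          exact absurd (by rw [this.2]) (hA d (by simp))
    · obtain ih | ⟨a, M, A, C, rfl, hA, hC⟩ := ih hT
      · exact Or.inl (antiFree_cons.2 ⟨h, ih⟩)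
      · exact Or.inr ⟨a, M, c :: A, C, rfl, antiFree_cons.2 ⟨h, hA⟩, hC⟩

theorem antiFree_left {a : ℤ} {m : ℕ} {A C : Tab} (hm : 1 ≤ m)
    (hT : (A ++ List.replicate m (a, -a) ++ C).Pairwise (ColRel n))
    (h : A.getLast? ≠ some (a, -a)) : AntiFree A := by
  rcases List.eq_nil_or_concat A with rfl | ⟨A, d, rfl⟩
  · simp [AntiFree]
  · have hx : (a, -a) ∈ List.replicate m (a, -a) := List.mem_replicate.2 ⟨by omega, rfl⟩
    simp only [List.concat_eq_append, List.append_assoc, List.pairwise_append,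
      List.mem_append, List.mem_singleton] at hT h
    have hd : d ≠ (a, -a) := by simpa using h
    have h1 : ∀ c : ℤ, ColRel n (c, -c) (a, -a) → ColRel n (c, -c) d → ColRel n d (a, -a) →
        False := fun c h1 h2 h3 => by
      have := eq_of_between h2 h3 h1
      exact hd (by rw [this.2, this.1])
    intro c hc
    rw [List.concat_eq_append, List.mem_append, List.mem_singleton] at hc
    obtain ⟨c, c'⟩ := c
    intro h2
    obtain rfl : c' = -c := h2
    have h3 := hT.2.1.2.2 d rfl (a, -a) (Or.inl hx)
    rcases hc with hc | rfl
    · exact h1 c (hT.2.2 _ hc _ (Or.inr (Or.inl hx))) (hT.2.2 _ hc d (Or.inl rfl)) h3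
    · have := eq_of_colRel h3
      exact hd (by rw [this])

theorem antiFree_right {a : ℤ} {m : ℕ} {A C : Tab} (hm : 1 ≤ m)
    (hT : (A ++ List.replicate m (a, -a) ++ C).Pairwise (ColRel n))
    (h : C.head? ≠ some (a, -a)) : AntiFree C := by
  cases C with
  | nil => simp [AntiFree]
  | cons d C =>
    have hx : (a, -a) ∈ List.replicate m (a, -a) := List.mem_replicate.2 ⟨by omega, rfl⟩
    have hd : d ≠ (a, -a) := by simpa using h
    simp only [List.pairwise_append, List.mem_append, List.pairwise_cons] at hT
    rintro ⟨c, c'⟩ hc h2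
    obtain rfl : c' = -c := h2
    have h3 := hT.2.2 (a, -a) (Or.inr hx)
    rcases List.mem_cons.1 hc with rfl | hc'
    · have := eq_of_colRel (h3 (c, -c) List.mem_cons_self)
      exact hd (by rw [this])
    · have := eq_of_between (h3 d (by simp)) (hT.2.1.1 _ hc') (h3 _ hc)
      exact hd this.2

/-- What the drop map removes. -/
theorem RemovesConfig.cases {T t : Tab} (hT : T.Pairwise (ColRel n)) (h : RemovesConfig n T t) :
    ∃ a M A C, T = A ++ List.replicate (M + 1) (a, -a) ++ C ∧ AntiFree A ∧ AntiFree C ∧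
      (Touches a A C ∧ t = A ++ C ∨ ¬ Touches a A C ∧ t = A ++ [(a, -a)] ++ C) := by
  obtain ⟨a, m, A, C, -, hm, h⟩ := h
  obtain ⟨M, rfl⟩ : ∃ M, m = M + 1 := ⟨m - 1, by omega⟩
  obtain ⟨rfl, rfl, ⟨b, h1, h2⟩, h3⟩ | ⟨rfl, rfl, ⟨d, h1, h2⟩, h3⟩ | ⟨rfl, rfl, h1, h2⟩ := h
  · exact ⟨a, M, A, C, rfl, antiFree_left hm hT (by rw [h1]; simpa using h2),
      antiFree_right hm hT h3, Or.inl ⟨Or.inl ⟨b, h1⟩, rfl⟩⟩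
  · exact ⟨a, M, A, C, rfl, antiFree_left hm hT h3,
      antiFree_right hm hT (by rw [h1]; simpa using h2), Or.inl ⟨Or.inr ⟨d, h1⟩, rfl⟩⟩
  · refine ⟨a, M + 1, A, C, rfl, antiFree_left (by omega) hT fun h => h1 _ h rfl,
      antiFree_right (by omega) hT fun h => h2 _ h rfl, Or.inr ⟨?_, rfl⟩⟩
    rintro (⟨b, h⟩ | ⟨d, h⟩)
    · exact h1 _ h rfl
    · exact h2 _ h rfl

theorem removesConfig_of_split {a : ℤ} {M : ℕ} {A C t : Tab}
    (ha : (1 ≤ a ∧ a ≤ n) ∨ a = -(n : ℤ)) (hA : AntiFree A) (hC : AntiFree C)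
    (h : Touches a A C ∧ t = A ++ C ∨ ¬ Touches a A C ∧ 1 ≤ M ∧ t = A ++ [(a, -a)] ++ C) :
    RemovesConfig n (A ++ List.replicate (M + 1) (a, -a) ++ C) t := by
  obtain ⟨⟨b, h⟩ | ⟨d, h⟩, rfl⟩ | ⟨h, hM, rfl⟩ := h
  · refine ⟨a, M + 1, A, C, ha, by omega, Or.inl ⟨rfl, rfl, ⟨b, h, ?_⟩, ?_⟩⟩
    · exact hA _ (List.mem_of_getLast? h)
    · exact fun h => hC _ (List.mem_of_head? h) rfl
  · refine ⟨a, M + 1, A, C, ha, by omega, Or.inr (Or.inl ⟨rfl, rfl, ⟨d, h, ?_⟩, ?_⟩)⟩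
    · intro hd; exact hC _ (List.mem_of_head? h) (by rw [hd])
    · exact fun h => hA _ (List.mem_of_getLast? h) rfl
  · refine ⟨a, M, A, C, ha, hM, Or.inr (Or.inr ⟨rfl, rfl, ?_, ?_⟩)⟩
    · rintro ⟨c1, c2⟩ hc rfl; exact h (Or.inl ⟨_, hc⟩)
    · rintro ⟨c1, c2⟩ hc hc2; simp only at hc2; subst hc2; exact h (Or.inr ⟨_, hc⟩)

end

/-! ### The values of the drop map -/

section

variable {n s : ℕ}

theorem IsT.sublist {T t : Tab} (hT : IsT n s T) (h : t.Sublist T) : IsT n t.length t := by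
  obtain ⟨-, h2, h3⟩ := isT_iff.1 hT
  exact isT_iff.2 ⟨rfl, fun c hc => h2 c (h.subset hc), h3.sublist h⟩

theorem AntiFree.isKN {k : ℕ} {t : Tab} (h : AntiFree t) (ht : IsT n k t) : IsKN n k t := by
  refine ⟨ht, ?_, fun h1 => h _ h1 rfl⟩
  rw [List.isChain_iff_getElem]
  intro i hi
  refine ⟨fun h1 => h _ (List.getElem_mem hi) (by rw [← h1.1]; rw [← h1.1] at h1; exact h1.2),
    fun h1 => h _ (List.getElem_mem (by omega)) h1.1⟩

theorem isKN_of_not_touches {k : ℕ} {a : ℤ} {A C : Tab} (hA : AntiFree A) (hC : AntiFree C)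
    (h : ¬ Touches a A C) (h1 : (1, -1) ∉ A ++ [(a, -a)] ++ C)
    (ht : IsT n k (A ++ [(a, -a)] ++ C)) : IsKN n k (A ++ [(a, -a)] ++ C) := by
  refine ⟨ht, ?_, h1⟩
  have key : ∀ t : Tab, AntiFree t → t.IsChain (fun c d : ℤ × ℤ =>
      ¬ (c.1 = d.1 ∧ d.2 = -d.1) ∧ ¬ (c.2 = -c.1 ∧ d.2 = c.2)) := by
    intro t ht
    rw [List.isChain_iff_getElem]
    intro i hi
    exact ⟨fun h1 => ht _ (List.getElem_mem hi) h1.2,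
      fun h1 => ht _ (List.getElem_mem (by omega)) h1.1⟩
  rw [List.append_assoc]
  refine List.isChain_append.2 ⟨key A hA, ?_, ?_⟩
  · refine List.isChain_append.2 ⟨List.isChain_singleton _, key C hC, ?_⟩
    rintro c hc ⟨d1, d2⟩ hd
    obtain rfl : (a, -a) = c := by simpa using hc
    refine ⟨fun h1 => hC _ (List.mem_of_head? hd) h1.2, fun h1 => ?_⟩
    obtain rfl : d2 = -a := h1.2
    exact h (Or.inr ⟨_, hd⟩)
  · rintro ⟨c1, c2⟩ hc d hd
    obtain rfl : (a, -a) = d := by simpa using hd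
    refine ⟨fun h1 => ?_, fun h1 => hA _ (List.mem_of_getLast? hc) h1.1⟩
    obtain rfl : c1 = a := h1.1
    exact h (Or.inl ⟨_, hc⟩)

theorem not_isKN_of_touches {k M : ℕ} {a : ℤ} {A C : Tab} (h : Touches a A C ∨ 1 ≤ M) :
    ¬ IsKN n k (A ++ List.replicate (M + 1) (a, -a) ++ C) := by
  rintro ⟨-, h1, -⟩
  obtain (⟨b, h⟩ | ⟨d, h⟩) | h := h
  · rw [List.append_assoc, List.isChain_append] at h1
    exact (h1.2.2 _ h (a, -a) (by simp [List.replicate_succ])).1 ⟨rfl, rfl⟩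
  · rw [List.isChain_append] at h1
    exact (h1.2.2 (a, -a) (by simp [List.getLast?_replicate]) _ h).2 ⟨rfl, rfl⟩
  · obtain ⟨M, rfl⟩ : ∃ m, M = m + 1 := ⟨M - 1, by omega⟩
    rw [List.append_assoc, List.isChain_append, List.replicate_succ, List.replicate_succ,
      List.cons_append, List.cons_append, List.isChain_cons_cons] at h1
    exact h1.2.1.1.1 ⟨rfl, rfl⟩

/-- A column `1` over `1̄` that touches nothing is alone. -/
theorem eq_replicate_of_not_touches {M : ℕ} {A C : Tab}
    (hT : IsT n s (A ++ List.replicate (M + 1) (1, -1) ++ C)) (h : ¬ Touches 1 A C) :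
    A ++ List.replicate (M + 1) (1, -1) ++ C = List.replicate s (1, -1) := by
  obtain ⟨h1, h2, h3⟩ := isT_iff.1 hT
  have hA : A = [] := by
    rcases List.eq_nil_or_concat A with rfl | ⟨A, ⟨d1, d2⟩, rfl⟩
    · rfl
    · refine absurd (Or.inl ⟨d2, ?_⟩) h
      simp only [List.pairwise_append, List.mem_append, List.mem_replicate] at h3
      have h4 := (h3.1.2.2 (d1, d2) (by simp) (1, -1) (by simp)).1.1
      have h5 := (h2 (d1, d2) (by simp)).1
      simp only [Le, Lt, IsLetter] at h4 h5
      simp only [List.concat_eq_append, List.getLast?_append, List.getLast?_singleton,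
        Option.some_or, Option.some.injEq, Prod.mk.injEq, and_true]
      omega
  have hC : C = [] := by
    cases C with
    | nil => rfl
    | cons d C =>
      obtain ⟨d1, d2⟩ := d
      refine absurd (Or.inr ⟨d1, ?_⟩) h
      simp only [List.pairwise_append, List.mem_append, List.mem_replicate] at h3
      have h4 := (h3.2.2 (1, -1) (by simp) (d1, d2) (by simp)).1.2
      have h5 := (h2 (d1, d2) (by simp)).2.1
      simp only [Le, Lt, IsLetter] at h4 h5
      simp only [List.head?_cons, Option.some.injEq, Prod.mk.injEq, true_and]
      omega
  subst hA hC
  rw [List.nil_append, List.append_nil, List.length_replicate] at h1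
  rw [List.nil_append, List.append_nil, h1]

/-- The drop map takes values in the union of the `B(kϖ₂)`, `k ≤ s`. -/
theorem isKN_drop {T : Tab} (hT : IsT n s T) :
    KNTab n (drop n s T) ∧ (drop n s T).length ≤ s := by
  suffices ∃ k ≤ s, IsKN n k (drop n s T) by
    obtain ⟨k, hk, h⟩ := this
    obtain ⟨h1, h2⟩ := isKN_iff.1 h
    exact ⟨h2, by omega⟩
  have hP := (isT_iff.1 hT).2.2
  unfold drop
  split_ifs with h1 h2 h3
  · exact ⟨0, by simp, isKN_iff.2 ⟨rfl, by simp [KNTab]⟩⟩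
  · exact ⟨s, le_rfl, h2⟩
  · have hr := h3.choose_spec
    generalize h3.choose = t at hr
    obtain ⟨a, M, A, C, rfl, hA, hC, ⟨h, rfl⟩ | ⟨h, rfl⟩⟩ := hr.cases hP
    · have hs : (A ++ C).Sublist (A ++ List.replicate (M + 1) (a, -a) ++ C) :=
        (List.sublist_append_left _ _).append (List.Sublist.refl _)
      refine ⟨_, hT.1 ▸ hs.length_le, AntiFree.isKN ?_ (hT.sublist hs)⟩
      exact List.forall_mem_append.2 ⟨hA, hC⟩
    · have hs : (A ++ [(a, -a)] ++ C).Sublist (A ++ List.replicate (M + 1) (a, -a) ++ C) := by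
        refine ((List.Sublist.refl A).append ?_).append (List.Sublist.refl _)
        simp [List.replicate_succ]
      refine ⟨_, hT.1 ▸ hs.length_le, isKN_of_not_touches hA hC h ?_ (hT.sublist hs)⟩
      intro hm
      simp only [List.mem_append, List.mem_singleton, Prod.mk.injEq] at hm
      obtain (hm | hm) | hm := hm
      · exact hA _ hm rfl
      · obtain rfl : a = 1 := hm.1.symm
        exact h1 (eq_replicate_of_not_touches hT h)
      · exact hC _ hm rfl
  · exfalso
    obtain h | ⟨a, M, A, C, rfl, hA, hC⟩ := antiFree_or_split hP
    · exact h2 (h.isKN hT)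
    · have ha : (1 ≤ a ∧ a ≤ n) ∨ a = -(n : ℤ) := by
        have := (isT_iff.1 hT).2.1 (a, -a) (by simp)
        simp only [IsLetter, Le, Lt] at this
        omega
      by_cases ht : Touches a A C
      · exact h3 ⟨_, removesConfig_of_split ha hA hC (Or.inl ⟨ht, rfl⟩)⟩
      · rcases Nat.eq_zero_or_pos M with rfl | hM
        · refine h2 (isKN_of_not_touches hA hC ht ?_ hT)
          intro hm
          simp only [List.mem_append, List.mem_singleton, Prod.mk.injEq] at hm
          obtain (hm | hm) | hm := hm
          · exact hA _ hm rfl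
          · obtain rfl : a = 1 := hm.1.symm
            exact h1 (eq_replicate_of_not_touches hT ht)
          · exact hC _ hm rfl
        · exact h3 ⟨_, removesConfig_of_split ha hA hC (Or.inr ⟨ht, hM, rfl⟩)⟩

/-- The value of the drop map in terms of the decomposition of a tableau at its columns `a` over `ā`;
by the uniqueness of the decomposition it does not depend on a choice. -/
theorem drop_of_split {a : ℤ} {M : ℕ} {A C t : Tab}
    (hT : IsT n s (A ++ List.replicate (M + 1) (a, -a) ++ C))
    (hA : AntiFree A) (hC : AntiFree C)
    (h1 : A ++ List.replicate (M + 1) (a, -a) ++ C ≠ List.replicate s (1, -1))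
    (h : Touches a A C ∧ t = A ++ C ∨ ¬ Touches a A C ∧ 1 ≤ M ∧ t = A ++ [(a, -a)] ++ C) :
    drop n s (A ++ List.replicate (M + 1) (a, -a) ++ C) = t := by
  have ha : (1 ≤ a ∧ a ≤ n) ∨ a = -(n : ℤ) := by
    have := (isT_iff.1 hT).2.1 (a, -a) (by simp)
    simp only [IsLetter, Le, Lt] at this
    omega
  have hr := removesConfig_of_split ha hA hC h
  have h2 := not_isKN_of_touches (n := n) (k := s) (h.imp And.left fun h => h.2.1)
  rw [drop, if_neg h1, if_neg h2, dif_pos ⟨t, hr⟩]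
  have hc : RemovesConfig n _ (Exists.choose ⟨t, hr⟩) := Exists.choose_spec ⟨t, hr⟩
  generalize Exists.choose (⟨t, hr⟩ : ∃ t, RemovesConfig n _ t) = t' at hc
  obtain ⟨a', M', A', C', e, hA', hC', h'⟩ := hc.cases (isT_iff.1 hT).2.2
  obtain ⟨rfl, rfl, rfl⟩ := split_unique hA hC hA' hC' e
  obtain ⟨h, rfl⟩ | ⟨h, -, rfl⟩ := h <;> obtain ⟨h', rfl⟩ | ⟨h', rfl⟩ := h'
  · rfl
  · exact absurd h h'
  · exact absurd h' h
  · rfl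

end

/-! ### Preimages under the drop map -/

section

variable {n s : ℕ}

theorem colRel_self (hn : 2 ≤ n) (c : ℤ × ℤ) : ColRel n c c := by
  refine ⟨⟨Or.inl rfl, Or.inl rfl⟩, ?_, ?_⟩ <;>
  · rintro ⟨h1, h2⟩
    rw [h1, Prod.mk.injEq] at h2
    omega

theorem pairwise_replicate {α : Type} {R : α → α → Prop} {A C : List α} {x : α} (hx : R x x)
    (h : (A ++ [x] ++ C).Pairwise R) (m : ℕ) : (A ++ List.replicate m x ++ C).Pairwise R := by
  simp only [List.pairwise_append, List.mem_append, List.mem_singleton, List.mem_replicate,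
    List.pairwise_replicate] at h ⊢
  refine ⟨⟨h.1.1, Or.inr hx, fun a ha b hb => h.1.2.2 a ha b hb.2⟩, h.2.1, ?_⟩
  rintro a (ha | ha) b hb
  · exact h.2.2 a (Or.inl ha) b hb
  · exact h.2.2 a (Or.inr ha.2) b hb

/-- A column of a tableau in `𝒯(k)` may be replaced by any number of copies of itself. -/
theorem isT_insert (hn : 2 ≤ n) {x : ℤ × ℤ} {A C : Tab} {k : ℕ} (hT : IsT n k (A ++ [x] ++ C))
    {m : ℕ} (hm : (A ++ C).length + m = s) : IsT n s (A ++ List.replicate m x ++ C) := by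
  obtain ⟨-, h2, h3⟩ := isT_iff.1 hT
  refine isT_iff.2 ⟨?_, ?_, pairwise_replicate (colRel_self hn x) h3 m⟩
  · rw [← hm]; simp only [List.length_append, List.length_replicate]; omega
  · intro c hc
    refine h2 c ?_
    simp only [List.mem_append, List.mem_replicate, List.mem_singleton] at hc ⊢
    tauto

theorem ColRel.of_le {c d : ℤ × ℤ} (h1 : Le n c.1 d.1) (h2 : Le n c.2 d.2)
    (h : c.2 = -c.1 ∨ d.2 = -d.1) : ColRel n c d := by
  refine ⟨⟨h1, h2⟩, ?_, ?_⟩ <;>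
  · rintro ⟨rfl, rfl⟩
    simp only at h
    omega

/-- A tableau without columns `a` over `ā` is cut into the columns `a` over `b` with `b < ā` and
those with `b > ā`. -/
theorem exists_cut {t : Tab} (ht : ∀ c ∈ t, IsLetter n c.1 ∧ IsLetter n c.2 ∧ ¬ Le n c.2 c.1)
    (hP : t.Pairwise (ColRel n)) (h : AntiFree t) :
    ∃ A C, t = A ++ C ∧ (∀ c ∈ A, pos n c.1 + pos n c.2 < 2 * n + 1) ∧
      (∀ c ∈ C, 2 * n + 1 < pos n c.1 + pos n c.2) := by
  induction t with
  | nil => exact ⟨[], [], rfl, by simp, by simp⟩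
  | cons c t ih =>
    obtain ⟨hc, hP⟩ := List.pairwise_cons.1 hP
    obtain ⟨hc0, h⟩ := antiFree_cons.1 h
    obtain ⟨hl, ht⟩ := List.forall_mem_cons.1 ht
    obtain ⟨A, C, rfl, hA, hC⟩ := ih ht hP h
    have hne : pos n c.1 + pos n c.2 ≠ 2 * n + 1 := fun e =>
      hc0 ((eq_neg_iff_pos hl.2.1 hl.1).2 (by omega))
    rcases lt_or_gt_of_ne hne with h1 | h1
    · exact ⟨c :: A, C, rfl, List.forall_mem_cons.2 ⟨h1, hA⟩, hC⟩
    · refine ⟨[], c :: (A ++ C), rfl, by simp, List.forall_mem_cons.2 ⟨h1, fun d hd => ?_⟩⟩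
      have hcd := (hc d hd).1
      have hd := ht d hd
      rw [le_iff_pos hl.1 hd.1, le_iff_pos hl.2.1 hd.2.1] at hcd
      omega

/-- A column `a` over `ā` that touches a neighbour fits into a tableau without such columns: it is
inserted at the cut of `exists_cut`, with the entry that it shares taken from the neighbour on the
left or on the right. -/
theorem exists_insert {k : ℕ} {t : Tab} (ht : IsT n k t) (h : AntiFree t)
    (h0 : t ≠ []) : ∃ a A C, t = A ++ C ∧ Touches a A C ∧
      IsT n (k + 1) (A ++ [(a, -a)] ++ C) := by
  obtain ⟨h1, h2, h3⟩ := isT_iff.1 ht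
  obtain ⟨A, C, rfl, hA, hC⟩ := exists_cut h2 h3 h
  -- it suffices to find a letter `a` that fits between `A` and `C`
  have key : ∀ a : ℤ, IsLetter n a → pos n a ≤ n - 1 → Touches a A C →
      (∀ c ∈ A, pos n c.1 ≤ pos n a ∧ pos n c.2 ≤ 2 * n + 1 - pos n a) →
      (∀ c ∈ C, pos n a ≤ pos n c.1 ∧ 2 * n + 1 - pos n a ≤ pos n c.2) →
      ∃ a A' C', A ++ C = A' ++ C' ∧ Touches a A' C' ∧
        IsT n (k + 1) (A' ++ [(a, -a)] ++ C') := by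
    intro a ha hb ht hA' hC'
    have hp := pos_neg ha
    refine ⟨a, A, C, rfl, ht, isT_iff.2 ⟨?_, ?_, ?_⟩⟩
    · rw [← h1]; simp only [List.length_append, List.length_singleton]; omega
    · intro c hc
      simp only [List.mem_append, List.mem_singleton] at hc
      obtain (hc | rfl) | hc := hc
      · exact h2 c (by simp [hc])
      · refine ⟨ha, ha.neg, ?_⟩
        rw [le_iff_pos ha.neg ha]
        omega
      · exact h2 c (by simp [hc])
    · have h4 := List.pairwise_append.1 h3
      have hAx : ∀ c ∈ A, ColRel n c (a, -a) := fun c hc => by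
        have h5 := h2 c (by simp [hc])
        have h6 := hA' c hc
        have h7 := hA c hc
        rw [le_iff_pos h5.2.1 h5.1] at h5
        refine ColRel.of_le ((le_iff_pos h5.1 ha).2 ?_) ((le_iff_pos h5.2.1 ha.neg).2 ?_)
          (Or.inr rfl) <;> omega
      have hxC : ∀ c ∈ C, ColRel n (a, -a) c := fun c hc => by
        have h5 := h2 c (by simp [hc])
        have h6 := hC' c hc
        refine ColRel.of_le ((le_iff_pos ha h5.1).2 ?_) ((le_iff_pos ha.neg h5.2.1).2 ?_)
          (Or.inl rfl) <;> omega
      simp only [List.pairwise_append, List.mem_append, List.mem_singleton]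
      refine ⟨⟨h4.1, List.pairwise_singleton _ _, fun c hc d hd => hd ▸ hAx c hc⟩, h4.2.1, ?_⟩
      rintro c (hc | rfl) d hd
      · exact h4.2.2 c hc d hd
      · exact hxC d hd
  have hle : ∀ {c d : ℤ × ℤ}, (c ∈ A ∨ c ∈ C) → (d ∈ A ∨ d ∈ C) → ColRel n c d →
      pos n c.1 ≤ pos n d.1 ∧ pos n c.2 ≤ pos n d.2 := fun {c d} hc hd h => by
    have h5 := h2 c (List.mem_append.2 hc)
    have h6 := h2 d (List.mem_append.2 hd)
    exact ⟨((le_iff_pos h5.1 h6.1).1 h.1.1).1, ((le_iff_pos h5.2.1 h6.2.1).1 h.1.2).1⟩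
  -- the top entry of the last column of `A` bounds those of `A`
  have hlast : ∀ c, A.getLast? = some c → c ∈ A ∧ ∀ d ∈ A, pos n d.1 ≤ pos n c.1 ∧
      pos n d.2 ≤ pos n c.2 := by
    intro c hc
    refine ⟨List.mem_of_getLast? hc, fun d hd => ?_⟩
    obtain ⟨A', rfl⟩ : ∃ A', A = A' ++ [c] := List.getLast?_eq_some_iff.1 hc
    rcases List.mem_append.1 hd with hd' | hd'
    · have h4 := (List.pairwise_append.1 (List.pairwise_append.1 h3).1).2.2 d hd' c (by simp)
      exact hle (Or.inl hd) (Or.inl (by simp)) h4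
    · rw [List.mem_singleton.1 hd']; exact ⟨le_rfl, le_rfl⟩
  have hfirst : ∀ c, C.head? = some c → c ∈ C ∧ ∀ d ∈ C, pos n c.1 ≤ pos n d.1 ∧
      pos n c.2 ≤ pos n d.2 := by
    intro c hc
    refine ⟨List.mem_of_head? hc, fun d hd => ?_⟩
    obtain ⟨C', rfl⟩ : ∃ C', C = c :: C' := List.head?_eq_some_iff.1 hc
    rcases List.mem_cons.1 hd with rfl | hd'
    · exact ⟨le_rfl, le_rfl⟩
    · have h4 := (List.pairwise_cons.1 (List.pairwise_append.1 h3).2.1).1 d hd'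
      exact hle (Or.inr (by simp)) (Or.inr hd) h4
  have hcross := (List.pairwise_append.1 h3).2.2
  have left : ∀ c, A.getLast? = some c → (∀ d ∈ C, 2 * n + 1 - pos n c.1 ≤ pos n d.2) →
      ∃ a A' C', A ++ C = A' ++ C' ∧ Touches a A' C' ∧
        IsT n (k + 1) (A' ++ [(a, -a)] ++ C') := by
    intro c hc hcC
    obtain ⟨hcA, hAc⟩ := hlast c hc
    have h5 := h2 c (by simp [hcA])
    have h6 := hA c hcA
    rw [le_iff_pos h5.2.1 h5.1] at h5
    refine key c.1 h5.1 (by omega) (Or.inl ⟨c.2, hc⟩) (fun d hd => ?_) fun d hd =>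
      ⟨(hle (Or.inl hcA) (Or.inr hd) (hcross c hcA d hd)).1, hcC d hd⟩
    have := hAc d hd
    omega
  rcases hC0 : C.head? with _ | e
  · obtain rfl := List.head?_eq_none_iff.1 hC0
    rcases hA0 : A.getLast? with _ | c
    · obtain rfl := List.getLast?_eq_none_iff.1 hA0
      exact absurd rfl h0
    · exact left c hA0 (by simp)
  · obtain ⟨heC, hCe⟩ := hfirst e hC0
    have h5 := h2 e (by simp [heC])
    have h6 := hC e heC
    rw [le_iff_pos h5.2.1 h5.1] at h5
    by_cases hc : ∃ c, A.getLast? = some c ∧ 2 * n + 1 - pos n c.1 ≤ pos n e.2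
    · obtain ⟨c, hc, hce⟩ := hc
      exact left c hc fun d hd => hce.trans (hCe d hd).2
    · have hp := pos_neg h5.2.1
      have hb := pos_bound h5.1
      refine key (-e.2) h5.2.1.neg (by omega) (Or.inr ⟨e.1, by rw [neg_neg]; exact hC0⟩)
        (fun d hd => ?_) fun d hd => ?_
      · rcases hA0 : A.getLast? with _ | c
        · obtain rfl := List.getLast?_eq_none_iff.1 hA0
          simp at hd
        · obtain ⟨hcA, hAc⟩ := hlast c hA0
          have h7 : ¬ (2 * n + 1 - pos n c.1 ≤ pos n e.2) := fun h => hc ⟨c, hA0, h⟩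
          have h8 := (hle (Or.inl hd) (Or.inr heC) (hcross d hd e heC)).2
          have h9 := hAc d hd
          omega
      · have := hCe d hd
        omega

/-- Every tableau of `B(kϖ₂)`, `k ≤ s`, is the image of a tableau of `𝒯(s)` under the drop map. -/
theorem exists_drop_eq (hn : 4 ≤ n) {t : Tab} (ht : KNTab n t) (hl : t.length ≤ s) :
    ∃ T, IsT n s T ∧ drop n s T = t := by
  have hKN := isKN_iff.2 ⟨rfl, ht⟩
  have h1t : (1, -1) ∉ t := hKN.2.2
  rcases eq_or_ne t [] with rfl | h0
  · refine ⟨List.replicate s (1, -1), isT_iff.2 ⟨by simp, fun c hc => ?_, ?_⟩, ?_⟩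
    · rw [(List.mem_replicate.1 hc).2]
      simp only [IsLetter, Le, Lt]
      omega
    · exact List.pairwise_replicate.2 (Or.inr (colRel_self (by omega) _))
    · rw [drop, if_pos rfl]
  rcases hl.eq_or_lt with rfl | hlt
  · refine ⟨t, hKN.1, ?_⟩
    rw [drop, if_neg, if_pos hKN]
    intro h
    refine h1t ?_
    rw [h]
    exact List.mem_replicate.2 ⟨by simpa using h0, rfl⟩
  obtain ⟨m, hm⟩ : ∃ m, s = t.length + (m + 1) := ⟨s - t.length - 1, by omega⟩
  obtain h | ⟨a, M, A, C, rfl, hA, hC⟩ := antiFree_or_split (isT_iff.1 hKN.1).2.2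
  · obtain ⟨a, A, C, rfl, htouch, hT⟩ := exists_insert hKN.1 h h0
    have hT' := isT_insert (s := s) (by omega) hT (m := m + 1) (by omega)
    obtain ⟨hA, hC⟩ := List.forall_mem_append.1 h
    refine ⟨_, hT', drop_of_split hT' hA hC ?_ (Or.inl ⟨htouch, rfl⟩)⟩
    intro e
    have hall : ∀ c ∈ A ++ C, c = (1, -1) := fun c hc =>
      (List.mem_replicate.1 (e ▸ (by
        simp only [List.mem_append] at hc ⊢; tauto :
          c ∈ A ++ List.replicate (m + 1) (a, -a) ++ C))).2
    obtain ⟨c, hc⟩ := List.exists_mem_of_ne_nil _ h0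
    exact h1t (hall c hc ▸ hc)
  · have hM : ¬ (Touches a A C ∨ 1 ≤ M) := fun h => not_isKN_of_touches h hKN
    push Not at hM
    obtain rfl : M = 0 := by omega
    have hT' := isT_insert (s := s) (by omega) hKN.1 (m := m + 2) (by
      rw [hm]; simp only [List.length_append, List.length_replicate]; omega)
    refine ⟨_, hT', drop_of_split (M := m + 1) hT' hA hC ?_ (Or.inr ⟨hM.1, by omega, rfl⟩)⟩
    intro e
    have hx : (a, -a) ∈ List.replicate s ((1 : ℤ), (-1 : ℤ)) := by
      rw [← e]; simp
    refine h1t ?_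
    rw [← (List.mem_replicate.1 hx).2]
    simp

/-- The fill map is a section of the drop map. -/
theorem fill_spec (hn : 4 ≤ n) {t : Tab} (ht : KNTab n t) (hl : t.length ≤ s) :
    IsT n s (fill n s t) ∧ drop n s (fill n s t) = t := by
  have h := exists_drop_eq hn ht hl
  rw [fill, dif_pos h]
  exact h.choose_spec

end

/-! ### The maps `ι` and `σ` -/

section

variable {n s : ℕ}

/-- `t` and `t'` are at the same position and have the same weight for the letter `1`: `t'` is the
image of `t` under one of the maps `ι_k^j`. -/
def IotaRel (n : ℕ) (t t' : Tab) : Prop :=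
  KNTab n t ∧ KNTab n t' ∧ Plactic n 2 (word t) (word t') ∧ wordWt 1 (word t) = wordWt 1 (word t')

theorem IotaRel.symm {t t' : Tab} (h : IotaRel n t t') : IotaRel n t' t :=
  ⟨h.2.1, h.1, h.2.2.1.symm, h.2.2.2.symm⟩

theorem IotaRel.trans {t t' t'' : Tab} (h : IotaRel n t t') (h' : IotaRel n t' t'') :
    IotaRel n t t'' :=
  ⟨h.1, h'.2.1, h.2.2.1.trans h'.2.2.1, h.2.2.2.trans h'.2.2.2⟩

theorem KNTab.iotaRel {t : Tab} (h : KNTab n t) : IotaRel n t t := ⟨h, h, .refl _, rfl⟩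

theorem IotaRel.eq (hn : 4 ≤ n) {t t' : Tab} (h : IotaRel n t t') (hl : t.length = t'.length) :
    t = t' := h.1.eq_of_plactic hn h.2.1 h.2.2.1 hl h.2.2.2

theorem isIota_iff (hn : 4 ≤ n) {k j : ℕ} {t t' : Tab} :
    IsIota n k j t t' ↔ t.length = k ∧ t'.length = j ∧ IotaRel n t t' := by
  constructor
  · rintro ⟨h, h', hp, hr⟩
    rw [samePosition_iff hn h h'] at hp
    have r1 := rank_eq hn h
    have r2 := rank_eq hn h'
    obtain ⟨hk, h⟩ := isKN_iff.1 h
    obtain ⟨hj, h'⟩ := isKN_iff.1 h'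
    exact ⟨hk, hj, h, h', hp, by omega⟩
  · rintro ⟨rfl, rfl, h1, h2, hp, hw⟩
    have h := isKN_iff.2 ⟨rfl, h1⟩
    have h' := isKN_iff.2 ⟨rfl, h2⟩
    have r1 := rank_eq hn h
    have r2 := rank_eq hn h'
    exact ⟨h, h', (samePosition_iff hn h h').2 hp, by omega⟩

theorem iota_eq_some_iff (hn : 4 ≤ n) {k j : ℕ} {t t' : Tab} :
    iota n k j t = some t' ↔ t.length = k ∧ t'.length = j ∧ IotaRel n t t' := by
  rw [← isIota_iff hn, iota]
  constructor
  · intro h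
    split_ifs at h with he
    exact (Option.some.inj h) ▸ he.choose_spec
  · intro h
    have he : ∃ t', IsIota n k j t t' := ⟨t', h⟩
    rw [dif_pos he, Option.some.injEq]
    obtain ⟨-, h1, h2⟩ := (isIota_iff hn).1 he.choose_spec
    obtain ⟨-, h3, h4⟩ := (isIota_iff hn).1 h
    exact (h2.symm.trans h4).eq hn (h1.trans h3.symm)

theorem IsLift.iotaRel {t t' : Tab} (ht : KNTab n t) (h : IsLift n t t') : IotaRel n t t' :=
  ⟨ht, h.1, h.2.2.1, h.2.2.2.1.symm⟩

/-- If `t'` is the image of `t` one component further, then `φ₁` and `ε₁` are larger by one. -/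
theorem IotaRel.isLift (hn : 4 ≤ n) {t t' : Tab} (h : IotaRel n t t')
    (hl : t'.length = t.length + 1) : IsLift n t t' := by
  obtain ⟨r, hr⟩ := h.1.exists_isLift hn
  have := ((hr.iotaRel h.1).symm.trans h).eq hn (hr.2.1.trans hl.symm)
  exact this ▸ hr

theorem KNTab.exists_iotaRel (hn : 4 ≤ n) {t : Tab} (h : KNTab n t) {j : ℕ} (hj : t.length ≤ j) :
    ∃ t', IotaRel n t t' ∧ t'.length = j := by
  induction j, hj using Nat.le_induction with
  | base => exact ⟨t, h.iotaRel, rfl⟩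
  | succ j _ ih =>
    obtain ⟨r, hr, rfl⟩ := ih
    obtain ⟨r', hr'⟩ := hr.2.1.exists_isLift hn
    exact ⟨r', hr.trans (hr'.iotaRel hr.2.1), hr'.2.1⟩

/-- The smallest length of a tableau that is related to `t` by one of the maps `ι_k^j`. -/
noncomputable def minLength (n : ℕ) (t : Tab) : ℕ :=
  sInf {l | ∃ t', IotaRel n t t' ∧ t'.length = l}

theorem minLength_le {t t' : Tab} (h : IotaRel n t t') : minLength n t ≤ t'.length :=
  Nat.sInf_le ⟨t', h, rfl⟩

theorem exists_iotaRel_iff (hn : 4 ≤ n) {t : Tab} (h : KNTab n t) {j : ℕ} :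
    (∃ t', IotaRel n t t' ∧ t'.length = j) ↔ minLength n t ≤ j := by
  constructor
  · rintro ⟨t', h, rfl⟩
    exact minLength_le h
  · intro hj
    obtain ⟨r, hr, hl⟩ : minLength n t ∈ {l | ∃ t', IotaRel n t t' ∧ t'.length = l} :=
      Nat.sInf_mem ⟨_, t, h.iotaRel, rfl⟩
    obtain ⟨t', h1, h2⟩ := hr.2.1.exists_iotaRel hn (hl.trans_le hj)
    exact ⟨t', hr.trans h1, h2⟩

theorem IotaRel.minLength_eq {t t' : Tab} (h : IotaRel n t t') :
    minLength n t = minLength n t' := by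
  unfold minLength
  congr 1
  ext l
  exact ⟨fun ⟨r, hr, hl⟩ => ⟨r, h.symm.trans hr, hl⟩, fun ⟨r, hr, hl⟩ => ⟨r, h.trans hr, hl⟩⟩

theorem depth_eq (hn : 4 ≤ n) {t : Tab} (h : KNTab n t) (hs : t.length ≤ s) :
    depth n s t.length t = minLength n t := by
  obtain ⟨r, hr, hrs⟩ := h.exists_iotaRel hn hs
  have hir : iota n t.length s t = some r := (iota_eq_some_iff hn).2 ⟨rfl, hrs, hr⟩
  have hset : {l | l ≤ s ∧ ∃ t' r, IsKN n l t' ∧ iota n t.length s t = some r ∧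
      iota n l s t' = some r} = {l | l ≤ s ∧ minLength n t ≤ l} := by
    ext l
    refine and_congr_right fun hl => ?_
    rw [← exists_iotaRel_iff hn h]
    constructor
    · rintro ⟨t', r', -, h1, h2⟩
      obtain ⟨-, -, h1⟩ := (iota_eq_some_iff hn).1 h1
      obtain ⟨h3, -, h2⟩ := (iota_eq_some_iff hn).1 h2
      exact ⟨t', h1.trans h2.symm, h3⟩
    · rintro ⟨t', h1, rfl⟩
      exact ⟨t', r, isKN_iff.2 ⟨rfl, h1.2.1⟩, hir,
        (iota_eq_some_iff hn).2 ⟨rfl, hrs, h1.symm.trans hr⟩⟩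
  rw [depth, hset]
  have hle : minLength n t ≤ s := (minLength_le h.iotaRel).trans hs
  exact le_antisymm (Nat.sInf_le ⟨hle, le_rfl⟩) (le_csInf ⟨_, hle, le_rfl⟩ fun l hl => hl.2)

/-- `t'` is at the same position as `t` and has the opposite weight for the letter `1`. -/
def NegRel (n : ℕ) (t t' : Tab) : Prop :=
  KNTab n t ∧ KNTab n t' ∧ Plactic n 2 (word t) (word t') ∧ wordWt 1 (word t) = -wordWt 1 (word t')

theorem NegRel.symm {t t' : Tab} (h : NegRel n t t') : NegRel n t' t :=
  ⟨h.2.1, h.1, h.2.2.1.symm, by rw [h.2.2.2, neg_neg]⟩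

theorem NegRel.trans {t t' t'' : Tab} (h : NegRel n t t') (h' : NegRel n t' t'') :
    IotaRel n t t'' :=
  ⟨h.1, h'.2.1, h.2.2.1.trans h'.2.2.1, by rw [h.2.2.2, h'.2.2.2, neg_neg]⟩

theorem IotaRel.trans_negRel {t t' t'' : Tab} (h : IotaRel n t t') (h' : NegRel n t' t'') :
    NegRel n t t'' :=
  ⟨h.1, h'.2.1, h.2.2.1.trans h'.2.2.1, by rw [h.2.2.2, h'.2.2.2]⟩

theorem KNTab.exists_negRel (hn : 4 ≤ n) {t : Tab} (h : KNTab n t) :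
    ∃ t', NegRel n t t' ∧ t'.length = t.length := by
  obtain ⟨t', h1, h2, h3, h4⟩ := h.exists_neg hn
  exact ⟨t', ⟨h, h1, h3, by rw [h4, neg_neg]⟩, h2⟩

theorem NegRel.minLength_eq (hn : 4 ≤ n) {t t' : Tab} (h : NegRel n t t') :
    minLength n t = minLength n t' := by
  have key : ∀ {t t' : Tab}, NegRel n t t' → minLength n t' ≤ minLength n t := fun {t t'} h => by
    obtain ⟨r, hr, hl⟩ := (exists_iotaRel_iff hn h.1).2 le_rfl
    obtain ⟨r', hr', hl'⟩ := hr.2.1.exists_negRel hn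
    rw [← hl, ← hl']
    exact minLength_le (h.symm.trans (hr.trans_negRel hr'))
  exact le_antisymm (key h.symm) (key h)

/-- `t'` is the image of `t` under `σ` in the crystal of `𝒯(s)`: the ranks `R` and `2s - R` belong to
opposite weights for the letter `1`, and `minLength n t` is the number `ℓ` in the definition
of `σ`. -/
def SigmaRel (n s : ℕ) (t t' : Tab) : Prop :=
  NegRel n t t' ∧ t.length ≤ s ∧ t.length + t'.length = s + minLength n t

theorem SigmaRel.length_le {t t' : Tab} (h : SigmaRel n s t t') : t'.length ≤ s := by
  have := minLength_le h.1.1.iotaRel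
  have := h.2.2
  omega

theorem SigmaRel.symm (hn : 4 ≤ n) {t t' : Tab} (h : SigmaRel n s t t') : SigmaRel n s t' t :=
  ⟨h.1.symm, h.length_le, by rw [← h.1.minLength_eq hn, ← h.2.2, add_comm]⟩

theorem SigmaRel.unique (hn : 4 ≤ n) {t t' t'' : Tab} (h : SigmaRel n s t t')
    (h' : SigmaRel n s t t'') : t' = t'' :=
  (h.1.symm.trans h'.1).eq hn (by have := h.2.2; have := h'.2.2; omega)

theorem KNTab.exists_sigmaRel (hn : 4 ≤ n) {t : Tab} (h : KNTab n t) (hs : t.length ≤ s) :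
    ∃ t', SigmaRel n s t t' := by
  obtain ⟨r, hr, hl⟩ := (exists_iotaRel_iff hn h (j := s + minLength n t - t.length)).2 (by omega)
  obtain ⟨t', h1, h2⟩ := hr.2.1.exists_negRel hn
  exact ⟨t', hr.trans_negRel h1, hs, by omega⟩

theorem isSigma_iff (hn : 4 ≤ n) {t t' : Tab} (h : KNTab n t) (hs : t.length ≤ s) :
    IsSigma n s t.length t t' ↔ SigmaRel n s t t' := by
  rw [IsSigma, depth_eq hn h hs]
  have hm := minLength_le h.iotaRel
  have hk := isKN_iff.2 ⟨rfl, h⟩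
  constructor
  · rintro ⟨-, h1, h2, h3⟩
    rw [samePosition_iff hn hk h1] at h2
    have r1 := rank_eq hn hk
    have r2 := rank_eq hn h1
    simp only [bigRank] at h3
    obtain ⟨h4, h5⟩ := isKN_iff.1 h1
    exact ⟨⟨h, h5, h2, by omega⟩, hs, by omega⟩
  · rintro ⟨⟨-, h1, h2, h3⟩, -, h4⟩
    have hk' : IsKN n (s + minLength n t - t.length) t' := isKN_iff.2 ⟨by omega, h1⟩
    have r1 := rank_eq hn hk
    have r2 := rank_eq hn hk'
    refine ⟨hk, hk', (samePosition_iff hn hk hk').2 h2, ?_⟩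
    simp only [bigRank]
    omega

/-- The involution `σ` on the union of the `B(kϖ₂)`, `k ≤ s`. -/
noncomputable def sigmaTab (n s : ℕ) (t : Tab) : Tab :=
  Classical.epsilon fun t' => SigmaRel n s t t'

theorem sigmaRel_sigmaTab (hn : 4 ≤ n) {t : Tab} (h : KNTab n t) (hs : t.length ≤ s) :
    SigmaRel n s t (sigmaTab n s t) := Classical.epsilon_spec (h.exists_sigmaRel hn hs)

theorem sigma_eq (hn : 4 ≤ n) {T : Tab} (hT : IsT n s T) :
    sigma n s T = some (fill n s (sigmaTab n s (drop n s T))) := by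
  obtain ⟨h, hs⟩ := isKN_drop hT
  have hr := sigmaRel_sigmaTab hn h hs
  have he : ∃ t', IsSigma n s (drop n s T).length (drop n s T) t' :=
    ⟨_, (isSigma_iff hn h hs).2 hr⟩
  rw [sigma, dif_pos he, ((isSigma_iff hn h hs).1 he.choose_spec).unique hn hr]

/-! ### The strings of the affine crystal -/

/-- A criterion for the length of the strings of a partial map. -/
theorem lengths_eq {g : Tab → Option Tab} {P : Tab → Prop} {N : Tab → ℕ}
    (h0 : ∀ T, P T → N T = 0 → g T = none)
    (h1 : ∀ T, P T → N T ≠ 0 → ∃ T', g T = some T' ∧ P T' ∧ N T = N T' + 1) {T : Tab} (hT : P T) :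
    lengths g T = Set.Iic (N T) := by
  ext p
  simp only [lengths, Set.mem_ofPred_eq, Set.mem_Iic]
  induction p generalizing T with
  | zero => simp
  | succ p ih =>
    rw [Function.iterate_succ_apply, Option.bind_some]
    by_cases hN : N T = 0
    · rw [h0 T hT hN, Function.iterate_fixed rfl]
      simp [hN]
    · obtain ⟨T', h2, h3, h4⟩ := h1 T hT hN
      rw [h2, ih h3]
      omega

/-- Since the fill map is a section of the drop map, the strings of the colours `1, …, n` in `𝒯(s)`
are those of the words. -/
theorem lengths_clE (hn : 4 ≤ n) {i : ℕ} (hi : 1 ≤ i) (hin : i ≤ n) {T : Tab} (hT : IsT n s T) :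
    lengths (affE n s i) T = Set.Iic (wordPhiEps n i (word (drop n s T))).2 := by
  refine lengths_eq (P := IsT n s) (N := fun T => (wordPhiEps n i (word (drop n s T))).2)
    (fun T hT h => ?_) (fun T hT h => ?_) hT
  · rw [affE, if_neg (by omega), clE, (tabE_eq_none_iff _ _ _).2 h]
    rfl
  · obtain ⟨h1, h2⟩ := isKN_drop hT
    obtain ⟨t, ht⟩ := Option.ne_none_iff_exists'.1 (mt (tabE_eq_none_iff _ _ _).1 h)
    obtain ⟨h3, h4, h5⟩ := h1.tabE (by omega) hi hin ht
    obtain ⟨h6, h7⟩ := fill_spec (s := s) hn h3 (by omega)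
    refine ⟨fill n s t, ?_, h6, ?_⟩
    · rw [affE, if_neg (by omega), clE, ht]
      rfl
    · rw [h7]
      exact (wordF_of_wordE (by omega) hi h5).2.2

theorem lengths_clF (hn : 4 ≤ n) {i : ℕ} (hi : 1 ≤ i) (hin : i ≤ n) {T : Tab} (hT : IsT n s T) :
    lengths (affF n s i) T = Set.Iic (wordPhiEps n i (word (drop n s T))).1 := by
  refine lengths_eq (P := IsT n s) (N := fun T => (wordPhiEps n i (word (drop n s T))).1)
    (fun T hT h => ?_) (fun T hT h => ?_) hT
  · rw [affF, if_neg (by omega), clF, (tabF_eq_none_iff _ _ _).2 h]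
    rfl
  · obtain ⟨h1, h2⟩ := isKN_drop hT
    obtain ⟨t, ht⟩ := Option.ne_none_iff_exists'.1 (mt (tabF_eq_none_iff _ _ _).1 h)
    obtain ⟨h3, h4, h5⟩ := h1.tabF (by omega) hi hin ht
    obtain ⟨h6, h7⟩ := fill_spec (s := s) hn h3 (by omega)
    refine ⟨fill n s t, ?_, h6, ?_⟩
    · rw [affF, if_neg (by omega), clF, ht]
      rfl
    · rw [h7]
      exact (wordE_of_wordF (by omega) hi h5).2.1

/-- `σ` is an involution, so the strings of the colour `0` through `T` are those of the colour `1`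
through `σ(T)`. -/
theorem lengths_affE_zero (hn : 4 ≤ n) {T : Tab} (hT : IsT n s T) :
    lengths (affE n s 0) T =
      Set.Iic (wordPhiEps n 1 (word (sigmaTab n s (drop n s T)))).2 := by
  refine lengths_eq (P := IsT n s)
    (N := fun T => (wordPhiEps n 1 (word (sigmaTab n s (drop n s T)))).2)
    (fun T hT h => ?_) (fun T hT h => ?_) hT
  all_goals
    obtain ⟨h1, h2⟩ := isKN_drop hT
    have h3 := sigmaRel_sigmaTab hn h1 h2
    have h4 := fill_spec hn h3.1.2.1 h3.length_le
    rw [affE, if_pos rfl, sigma_eq hn hT, Option.bind_some, clE, h4.2]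
  · rw [(tabE_eq_none_iff _ _ _).2 h]
    rfl
  · obtain ⟨t, ht⟩ := Option.ne_none_iff_exists'.1 (mt (tabE_eq_none_iff _ _ _).1 h)
    obtain ⟨h5, h6, h7⟩ := h3.1.2.1.tabE (by omega) le_rfl (by omega) ht
    have h8 : t.length ≤ s := h6.trans_le h3.length_le
    have h9 := fill_spec hn h5 h8
    have h10 := sigmaRel_sigmaTab hn h5 h8
    have h11 := fill_spec hn h10.1.2.1 h10.length_le
    refine ⟨fill n s (sigmaTab n s t), ?_, h11.1, ?_⟩
    · rw [ht, Option.map_some, Option.bind_some, sigma_eq hn h9.1, h9.2]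
    · rw [h11.2, (sigmaRel_sigmaTab hn h10.1.2.1 h10.length_le).unique hn (h10.symm hn)]
      exact (wordF_of_wordE (by omega) le_rfl h7).2.2

theorem lengths_affF_zero (hn : 4 ≤ n) {T : Tab} (hT : IsT n s T) :
    lengths (affF n s 0) T =
      Set.Iic (wordPhiEps n 1 (word (sigmaTab n s (drop n s T)))).1 := by
  refine lengths_eq (P := IsT n s)
    (N := fun T => (wordPhiEps n 1 (word (sigmaTab n s (drop n s T)))).1)
    (fun T hT h => ?_) (fun T hT h => ?_) hT
  all_goals
    obtain ⟨h1, h2⟩ := isKN_drop hT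
    have h3 := sigmaRel_sigmaTab hn h1 h2
    have h4 := fill_spec hn h3.1.2.1 h3.length_le
    rw [affF, if_pos rfl, sigma_eq hn hT, Option.bind_some, clF, h4.2]
  · rw [(tabF_eq_none_iff _ _ _).2 h]
    rfl
  · obtain ⟨t, ht⟩ := Option.ne_none_iff_exists'.1 (mt (tabF_eq_none_iff _ _ _).1 h)
    obtain ⟨h5, h6, h7⟩ := h3.1.2.1.tabF (by omega) le_rfl (by omega) ht
    have h8 : t.length ≤ s := h6.trans_le h3.length_le
    have h9 := fill_spec hn h5 h8
    have h10 := sigmaRel_sigmaTab hn h5 h8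
    have h11 := fill_spec hn h10.1.2.1 h10.length_le
    refine ⟨fill n s (sigmaTab n s t), ?_, h11.1, ?_⟩
    · rw [ht, Option.map_some, Option.bind_some, sigma_eq hn h9.1, h9.2]
    · rw [h11.2, (sigmaRel_sigmaTab hn h10.1.2.1 h10.length_le).unique hn (h10.symm hn)]
      exact (wordE_of_wordF (by omega) le_rfl h7).2.1

theorem bddAbove_lengths (hn : 4 ≤ n) {T : Tab} (hT : IsT n s T) {i : ℕ} (hin : i ≤ n) :
    BddAbove (lengths (affE n s i) T) ∧ BddAbove (lengths (affF n s i) T) := by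
  rcases Nat.eq_zero_or_pos i with rfl | hi
  · rw [lengths_affE_zero hn hT, lengths_affF_zero hn hT]
    exact ⟨bddAbove_Iic, bddAbove_Iic⟩
  · rw [lengths_clE hn hi hin hT, lengths_clF hn hi hin hT]
    exact ⟨bddAbove_Iic, bddAbove_Iic⟩

theorem eps_eq (hn : 4 ≤ n) {T : Tab} (hT : IsT n s T) {i : ℕ} (hi : 1 ≤ i) (hin : i ≤ n) :
    eps n s i T = (wordPhiEps n i (word (drop n s T))).2 := by
  rw [eps, lengths_clE hn hi hin hT, csSup_Iic]

theorem phi_eq (hn : 4 ≤ n) {T : Tab} (hT : IsT n s T) {i : ℕ} (hi : 1 ≤ i) (hin : i ≤ n) :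
    phi n s i T = (wordPhiEps n i (word (drop n s T))).1 := by
  rw [phi, lengths_clF hn hi hin hT, csSup_Iic]

theorem eps_zero_eq (hn : 4 ≤ n) {T : Tab} (hT : IsT n s T) : eps n s 0 T =
    (wordPhiEps n 1 (word (sigmaTab n s (drop n s T)))).2 := by
  rw [eps, lengths_affE_zero hn hT, csSup_Iic]

theorem phi_zero_eq (hn : 4 ≤ n) {T : Tab} (hT : IsT n s T) : phi n s 0 T =
    (wordPhiEps n 1 (word (sigmaTab n s (drop n s T)))).1 := by
  rw [phi, lengths_affF_zero hn hT, csSup_Iic]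

/-! ### The level -/

/-- The level in terms of the image under `σ`. -/
theorem level_eq (hn : 4 ≤ n) {T t' : Tab} (hT : IsT n s T) (h : SigmaRel n s (drop n s T) t') :
    level n s T = (wordPhiEps n 1 (word t')).2 + (wordPhiEps n 1 (word (drop n s T))).2 +
      2 * (∑ i ∈ Finset.Icc 2 (n - 2), (wordPhiEps n i (word (drop n s T))).2) +
      (wordPhiEps n (n - 1) (word (drop n s T))).2 + (wordPhiEps n n (word (drop n s T))).2 := by
  have hs := (sigmaRel_sigmaTab hn h.1.1 h.2.1).unique hn h
  rw [level, eps_zero_eq hn hT, eps_eq hn hT le_rfl (by omega), eps_eq hn hT (by omega) (by omega),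
    eps_eq hn hT (by omega) le_rfl, hs]
  congr 4
  refine Finset.sum_congr rfl fun i hi => ?_
  rw [Finset.mem_Icc] at hi
  rw [eps_eq hn hT (by omega) (by omega)]

theorem level_fill (hn : 4 ≤ n) {t t' : Tab} (h : SigmaRel n s t t') :
    level n s (fill n s t) = (wordPhiEps n 1 (word t')).2 + (wordPhiEps n 1 (word t)).2 +
      2 * (∑ i ∈ Finset.Icc 2 (n - 2), (wordPhiEps n i (word t)).2) +
      (wordPhiEps n (n - 1) (word t)).2 + (wordPhiEps n n (word t)).2 := by
  obtain ⟨h1, h2⟩ := fill_spec hn h.1.1 h.2.1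
  rw [level_eq hn h1 (h2.symm ▸ h), h2]

/-- `σ` reverses the direction of the maps `ι`, since the lengths of `t` and `σ(t)` have a sum that
depends only on the orbit of `t` under these maps. -/
theorem IotaRel.sigma_isLift (hn : 4 ≤ n) {t t' u u' : Tab} (h : IotaRel n t t')
    (hl : t'.length = t.length + 1) (hu : SigmaRel n s t u) (hu' : SigmaRel n s t' u') :
    IsLift n u' u := by
  refine IotaRel.isLift hn (hu'.1.symm.trans (h.symm.trans_negRel hu.1)) ?_
  have := h.minLength_eq
  have := hu.2.2
  have := hu'.2.2
  omega

theorem IotaRel.level_eq (hn : 4 ≤ n) {t t' : Tab} (h : IotaRel n t t') (ht : t.length ≤ s)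
    (ht' : t'.length ≤ s) : level n s (fill n s t') = level n s (fill n s t) := by
  have step : ∀ {t t' : Tab}, IotaRel n t t' → t'.length ≤ s → t'.length = t.length + 1 →
      level n s (fill n s t') = level n s (fill n s t) := fun {t t'} h ht' hl => by
    have hu := sigmaRel_sigmaTab hn h.1 (by omega : t.length ≤ s)
    have hu' := sigmaRel_sigmaTab hn h.2.1 ht'
    have l1 := (h.isLift hn hl).2.2.2.2.2
    have l2 := (h.sigma_isLift hn hl hu hu').2.2.2.2.2
    rw [level_fill hn hu, level_fill hn hu']
    have e : ∀ i, 2 ≤ i → i ≤ n → (wordPhiEps n i (word t')).2 = (wordPhiEps n i (word t)).2 :=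
      fun i hi hin => by rw [h.2.2.1.phiEps hi hin]
    rw [e (n - 1) (by omega) (by omega), e n (by omega) le_rfl,
      Finset.sum_congr rfl fun i hi => e i (Finset.mem_Icc.1 hi).1
        ((Finset.mem_Icc.1 hi).2.trans (by omega))]
    omega
  have up : ∀ {t t' : Tab}, IotaRel n t t' → t'.length ≤ s → t.length ≤ t'.length →
      level n s (fill n s t') = level n s (fill n s t) := fun {t t'} h ht' hle => by
    induction hd : t'.length - t.length generalizing t' with
    | zero => rw [h.eq hn (by omega)]
    | succ d ih =>
      obtain ⟨r, hr, hl⟩ := h.1.exists_iotaRel hn (j := t'.length - 1) (by omega)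
      rw [step (hr.symm.trans h) ht' (by omega), ih hr (by omega) (by omega) (by omega)]
  rcases le_total t.length t'.length with hle | hle
  · exact up h ht' hle
  · exact (up h.symm ht hle).symm

end

end KR

theorem proposition7p2 (n s : ℕ) (hn : 4 ≤ n) :
    -- all strings in the crystal are finite, so that `ε_i` and `φ_i` are maxima
    (∀ T : KR.Tab, KR.IsT n s T → ∀ i ≤ n,
      BddAbove (KR.lengths (KR.affE n s i) T) ∧ BddAbove (KR.lengths (KR.affF n s i) T)) ∧
    -- the tableaux `T_m` exist for `ℓ ≤ m ≤ s`, and consecutive ones compare as claimed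
    (∀ k ≤ s, ∀ t : KR.Tab, KR.IsKN n k t →
      ∀ l : ℕ, IsLeast {j | j ≤ s ∧ KR.iota n k j t ≠ none} l →
      ∃ T : ℕ → KR.Tab,
        (∀ m, l ≤ m → m ≤ s →
          ∃ tm, KR.iota n k m t = some tm ∧ T m = KR.fill n s tm ∧ KR.IsT n s (T m)) ∧
        (∀ m, l ≤ m → m < s →
          KR.eps n s 1 (T (m + 1)) = KR.eps n s 1 (T m) + 1 ∧
          KR.eps n s 0 (T (m + 1)) + 1 = KR.eps n s 0 (T m) ∧
          KR.phi n s 1 (T (m + 1)) = KR.phi n s 1 (T m) + 1 ∧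
          KR.phi n s 0 (T (m + 1)) + 1 = KR.phi n s 0 (T m))) ∧
    -- the maps `ι_k^j` preserve the level
    (∀ k ≤ s, ∀ j ≤ s, ∀ t t' : KR.Tab, KR.IsKN n k t → KR.iota n k j t = some t' →
      KR.level n s (KR.fill n s t') = KR.level n s (KR.fill n s t)) ∧
    -- the map `Υ_s^{s+1}` raises the level by exactly one
    (∀ T : KR.Tab, KR.IsT n s T →
      KR.IsT n (s + 1) (KR.upsilon n s (s + 1) T) ∧
      KR.level n (s + 1) (KR.upsilon n s (s + 1) T) = KR.level n s T + 1) := by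
  refine ⟨fun T hT i hi => KR.bddAbove_lengths hn hT hi, ?_, ?_, ?_⟩
  · rintro k hk t ht l ⟨⟨hls, hl⟩, -⟩
    obtain ⟨rfl, ht⟩ := KR.isKN_iff.1 ht
    obtain ⟨tl, htl⟩ := Option.ne_none_iff_exists'.1 hl
    obtain ⟨-, rfl, hr⟩ := (KR.iota_eq_some_iff hn).1 htl
    have hex : ∀ m, ∃ tm, tl.length ≤ m → KR.IotaRel n t tm ∧ tm.length = m := fun m => by
      by_cases hm : tl.length ≤ m
      · obtain ⟨r, h1, h2⟩ := hr.2.1.exists_iotaRel hn hm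
        exact ⟨r, fun _ => ⟨hr.trans h1, h2⟩⟩
      · exact ⟨[], fun h => absurd h hm⟩
    choose U hU using hex
    refine ⟨fun m => KR.fill n s (U m), fun m hm hms => ?_, fun m hm hms => ?_⟩
    · obtain ⟨h1, h2⟩ := hU m hm
      exact ⟨U m, (KR.iota_eq_some_iff hn).2 ⟨rfl, h2, h1⟩, rfl,
        (KR.fill_spec hn h1.2.1 (h2.trans_le hms)).1⟩
    · obtain ⟨h1, h2⟩ := hU m hm
      obtain ⟨h3, h4⟩ := hU (m + 1) (by omega)
      obtain ⟨f1, f2⟩ := KR.fill_spec (s := s) hn h1.2.1 (by omega)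
      obtain ⟨f3, f4⟩ := KR.fill_spec (s := s) hn h3.2.1 (by omega)
      have s1 := KR.sigmaRel_sigmaTab (s := s) hn h1.2.1 (by omega)
      have s2 := KR.sigmaRel_sigmaTab (s := s) hn h3.2.1 (by omega)
      have h := h1.symm.trans h3
      have l1 := h.isLift hn (by omega)
      have l2 := h.sigma_isLift hn (by omega) s1 s2
      simp only
      rw [KR.eps_eq hn f3 le_rfl (by omega), KR.eps_eq hn f1 le_rfl (by omega),
        KR.phi_eq hn f3 le_rfl (by omega), KR.phi_eq hn f1 le_rfl (by omega),
        KR.eps_zero_eq hn f3, KR.eps_zero_eq hn f1, KR.phi_zero_eq hn f3, KR.phi_zero_eq hn f1,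
        f2, f4]
      exact ⟨l1.2.2.2.2.2, l2.2.2.2.2.2.symm, l1.2.2.2.2.1, l2.2.2.2.2.1.symm⟩
  · intro k hk j hj t t' _ h
    obtain ⟨rfl, rfl, h'⟩ := (KR.iota_eq_some_iff hn).1 h
    exact h'.level_eq hn hk hj
  · intro T hT
    obtain ⟨h1, h2⟩ := KR.isKN_drop hT
    have f := KR.fill_spec (s := s + 1) hn h1 (by omega)
    refine ⟨f.1, ?_⟩
    have s1 := KR.sigmaRel_sigmaTab hn h1 h2
    have s2 := KR.sigmaRel_sigmaTab (s := s + 1) hn h1 (by omega)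
    have l := KR.IotaRel.isLift hn (s1.1.symm.trans s2.1) (by
      have := s1.2.2; have := s2.2.2; omega)
    rw [KR.upsilon, KR.level_fill hn s2, KR.level_eq hn hT s1, l.2.2.2.2.2]
    ring
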